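/- Let $\mathbb{F}_4$ be the field with four elements, $\mathbb{W}=W(\mathbb{F}_4)$ its ring of $2$-typical Witt vectors, $\sigma$ the Frobenius automorphism of $\mathbb{W}$, and $\zeta\in\mathbb{F}_4$ a primitive third root of unity with Teichmüller lift $\omega\in\mathbb{W}$. Let $F_{\mathcal{C}}$ be the formal group law over $\mathbb{F}_4$ of the supersingular elliptic curve $\mathcal{C}: y^2-y=x^3$ in the parameter $z=-x/y$ at the origin, and let $F_2$ be the Honda formal group law of height $2$ over $\mathbb{F}_4$, that is, the reduction modulo $2$ of the formal group law over $\mathbb{Z}$ with logarithm $\sum_{k\ge 0}x^{4^k}/2^k$. Both are commutative formal group laws. Let $\mathrm{End}(F)$ be the ring of endomorphisms of $F$ over $\mathbb{F}_4$, with product $f\circ g$ and sum $F(f(x),g(x))$, and let $\mathbb{S}_{\mathcal{C}}=\mathrm{End}(F_{\mathcal{C}})^\times=\mathrm{Aut}(F_{\mathcal{C}})$ and $\mathbb{S}_2=\mathrm{End}(F_2)^\times=\mathrm{Aut}(F_2)$. There are ring isomorphisms $$\mathbb{W}\langle T\rangle/(T^2=-2,\ aT=Ta^{\sigma})\;\cong\;\mathrm{End}(F_{\mathcal{C}}),\qquad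 \mathbb{W}\langle S\rangle/(S^2=2,\ aS=Sa^{\sigma})\;\cong\;\mathrm{End}(F_2)$$ (with the relations for all $a\in\mathbb{W}$), which send $T$, respectively $S$, to $x^2$ and the Teichmüller lift of each $c\in\mathbb{F}_4$ to $cx$; in particular they identify $\mathbb{S}_{\mathcal{C}}$ and $\mathbb{S}_2$ with the unit groups of the rings on the left. Moreover, $-7$ has a square root $\sqrt{-7}\in\mathbb{W}$ with $\sqrt{-7}\equiv 1$ modulo $4$, the element $\alpha=(1-2\omega)/\sqrt{-7}$ lies in $\mathbb{W}$ and satisfies $\alpha\alpha^{\sigma}=-1$, and under these identifications the map $$a+bT\longmapsto a+b(\alpha S)\qquad(a,b\in\mathbb{W})$$ is an isomorphism of groups $\mathbb{S}_{\mathcal{C}}\to\mathbb{S}_2$. -/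

import Mathlib

noncomputable section

/-! ### Endomorphisms of a one-dimensional formal group law -/

namespace FormalGroup

variable {R : Type*} [CommRing R]

/-- An endomorphism of a formal group law `F` over `R`: a power series `f` with `f(0) = 0` and
`f(F(x, y)) = F(f(x), f(y))`. -/
@[ext]
structure Endo (F : FormalGroup R) where
  /-- The underlying power series. -/
  toSeries : PowerSeries R
  constantCoeff_eq_zero : PowerSeries.constantCoeff toSeries = 0
  map_law : toSeries.subst F.toPowerSeries =
    F.toPowerSeries.subst
      ![toSeries.subst (MvPowerSeries.X 0 : MvPowerSeries (Fin 2) R),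
        toSeries.subst (MvPowerSeries.X 1 : MvPowerSeries (Fin 2) R)]

variable (F : FormalGroup R)

theorem hasSubst_pair {τ : Type*} {u v : MvPowerSeries τ R}
    (hu : PowerSeries.HasSubst u) (hv : PowerSeries.HasSubst v) :
    MvPowerSeries.HasSubst ![u, v] :=
  MvPowerSeries.hasSubst_of_constantCoeff_nilpotent fun s => by fin_cases s <;> simpa

theorem subst_law_subst {σ τ : Type*} {u v : MvPowerSeries σ R} {h : σ → MvPowerSeries τ R}
    (hu : PowerSeries.HasSubst u) (hv : PowerSeries.HasSubst v) (hh : MvPowerSeries.HasSubst h) :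
    (F.toPowerSeries.subst ![u, v]).subst h = F.toPowerSeries.subst ![u.subst h, v.subst h] := by
  rw [MvPowerSeries.subst_comp_subst_apply (hasSubst_pair hu hv) hh]
  congr 1
  funext s
  fin_cases s <;> rfl

namespace Endo

variable {F}

theorem hasSubst (f : F.Endo) : PowerSeries.HasSubst f.toSeries :=
  PowerSeries.HasSubst.of_constantCoeff_zero' f.constantCoeff_eq_zero

theorem hasSubst_subst (f : F.Endo) {τ : Type*} {u : MvPowerSeries τ R}
    (hu : PowerSeries.HasSubst u) : PowerSeries.HasSubst (f.toSeries.subst u) :=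
  PowerSeries.coe_substAlgHom (R := R) hu ▸ PowerSeries.HasSubst.comp f.hasSubst hu

theorem map_law' (f : F.Endo) {τ : Type*} {u v : MvPowerSeries τ R}
    (hu : PowerSeries.HasSubst u) (hv : PowerSeries.HasSubst v) :
    f.toSeries.subst (F.toPowerSeries.subst ![u, v]) =
      F.toPowerSeries.subst ![f.toSeries.subst u, f.toSeries.subst v] := by
  have hF : PowerSeries.HasSubst F.toPowerSeries :=
    PowerSeries.HasSubst.of_constantCoeff_zero F.zero_constantCoeff
  have huv := hasSubst_pair hu hv
  have h := congrArg (MvPowerSeries.subst ![u, v]) f.map_law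
  rw [subst_law_subst F (f.hasSubst_subst (PowerSeries.HasSubst.X 0))
    (f.hasSubst_subst (PowerSeries.HasSubst.X 1)) huv] at h
  simp only [PowerSeries.subst] at h ⊢
  rw [MvPowerSeries.subst_comp_subst_apply hF.const huv,
    MvPowerSeries.subst_comp_subst_apply (PowerSeries.HasSubst.X 0).const huv,
    MvPowerSeries.subst_comp_subst_apply (PowerSeries.HasSubst.X 1).const huv] at h
  simpa [MvPowerSeries.subst_X huv] using h

/-- The identity endomorphism `x`. -/
instance : One F.Endo where
  one :=
    { toSeries := PowerSeries.X
      constantCoeff_eq_zero := by simp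
      map_law := by
        rw [PowerSeries.subst_X (PowerSeries.HasSubst.of_constantCoeff_zero F.zero_constantCoeff),
          PowerSeries.subst_X (PowerSeries.HasSubst.X 0),
          PowerSeries.subst_X (PowerSeries.HasSubst.X 1)]
        have : (![MvPowerSeries.X 0, MvPowerSeries.X 1] : Fin 2 → MvPowerSeries (Fin 2) R) =
            MvPowerSeries.X := by
          funext s; fin_cases s <;> rfl
        rw [this, MvPowerSeries.subst_self, id] }

/-- Multiplication is composition: `(f * g)(x) = f(g(x))`. -/
instance : Mul F.Endo where
  mul f g :=
    { toSeries := f.toSeries.subst g.toSeries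
      constantCoeff_eq_zero :=
        PowerSeries.constantCoeff_subst_eq_zero g.constantCoeff_eq_zero _ f.constantCoeff_eq_zero
      map_law := by
        have hF : PowerSeries.HasSubst F.toPowerSeries :=
          PowerSeries.HasSubst.of_constantCoeff_zero F.zero_constantCoeff
        rw [PowerSeries.subst_comp_subst_apply g.hasSubst hF,
          PowerSeries.subst_comp_subst_apply g.hasSubst (PowerSeries.HasSubst.X 0),
          PowerSeries.subst_comp_subst_apply g.hasSubst (PowerSeries.HasSubst.X 1),
          g.map_law, f.map_law' (g.hasSubst_subst (PowerSeries.HasSubst.X 0))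
            (g.hasSubst_subst (PowerSeries.HasSubst.X 1))] }

theorem one_toSeries : (1 : F.Endo).toSeries = PowerSeries.X := rfl

theorem mul_toSeries (f g : F.Endo) : (f * g).toSeries = f.toSeries.subst g.toSeries := rfl

/-- The monoid of endomorphisms under composition. Its group of units `(F.Endo)ˣ` is the
automorphism group of `F`. -/
instance : Monoid F.Endo where
  mul_assoc f g h := Endo.ext <| by
    simp only [mul_toSeries]
    exact PowerSeries.subst_comp_subst_apply g.hasSubst h.hasSubst _
  one_mul f := Endo.ext (PowerSeries.subst_X f.hasSubst)
  mul_one f := Endo.ext (PowerSeries.X_subst f.toSeries)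

/-- The zero endomorphism. -/
instance : Zero F.Endo where
  zero :=
    { toSeries := 0
      constantCoeff_eq_zero := by simp
      map_law := by
        have h0 (u : MvPowerSeries (Fin 2) R) (hu : PowerSeries.HasSubst u) :
            (0 : PowerSeries R).subst u = 0 := by
          rw [← PowerSeries.coe_substAlgHom hu, map_zero]
        rw [h0 _ (PowerSeries.HasSubst.of_constantCoeff_zero F.zero_constantCoeff),
          h0 _ (PowerSeries.HasSubst.X 0), h0 _ (PowerSeries.HasSubst.X 1),
          F.add_zero PowerSeries.HasSubst.zero] }

theorem zero_toSeries : (0 : F.Endo).toSeries = 0 := rfl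

theorem subst_law (f g : F.Endo) {τ : Type*} {h : MvPowerSeries τ R}
    (hh : PowerSeries.HasSubst h) :
    PowerSeries.subst h (F.toPowerSeries.subst ![f.toSeries, g.toSeries] : PowerSeries R) =
      F.toPowerSeries.subst ![f.toSeries.subst h, g.toSeries.subst h] :=
  F.subst_law_subst f.hasSubst g.hasSubst hh.const

/-- For a commutative formal group law, addition is `(f + g)(x) = F(f(x), g(x))`. -/
instance [F.IsComm] : Add F.Endo where
  add f g :=
    { toSeries := F.toPowerSeries.subst ![f.toSeries, g.toSeries]
      constantCoeff_eq_zero :=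
        MvPowerSeries.constantCoeff_subst_eq_zero (hasSubst_pair f.hasSubst g.hasSubst)
          (fun s => by
            fin_cases s
            · exact f.constantCoeff_eq_zero
            · exact g.constantCoeff_eq_zero) F.zero_constantCoeff
      map_law := by
        have hF : PowerSeries.HasSubst F.toPowerSeries :=
          PowerSeries.HasSubst.of_constantCoeff_zero F.zero_constantCoeff
        have h0 : PowerSeries.HasSubst (MvPowerSeries.X 0 : MvPowerSeries (Fin 2) R) :=
          PowerSeries.HasSubst.X 0
        have h1 : PowerSeries.HasSubst (MvPowerSeries.X 1 : MvPowerSeries (Fin 2) R) :=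
          PowerSeries.HasSubst.X 1
        rw [subst_law f g hF, subst_law f g h0, subst_law f g h1, f.map_law, g.map_law]
        have key (a b c d : F.Point (Fin 2)) := congrArg Subtype.val (add_add_add_comm a b c d)
        exact key ⟨_, f.hasSubst_subst h0⟩ ⟨_, f.hasSubst_subst h1⟩
          ⟨_, g.hasSubst_subst h0⟩ ⟨_, g.hasSubst_subst h1⟩ }

theorem add_toSeries [F.IsComm] (f g : F.Endo) :
    (f + g).toSeries = F.toPowerSeries.subst ![f.toSeries, g.toSeries] := rfl

/-- The endomorphism ring of a commutative formal group law (only the semiring structure is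
recorded; a ring isomorphism onto it shows in particular that negatives exist). -/
instance [F.IsComm] : Semiring F.Endo where
  add_assoc f g h := Endo.ext (F.assoc' f.hasSubst g.hasSubst h.hasSubst)
  zero_add f := Endo.ext (F.zero_add f.hasSubst)
  add_zero f := Endo.ext (F.add_zero f.hasSubst)
  add_comm f g := Endo.ext (F.comm' f.hasSubst g.hasSubst)
  nsmul := nsmulRec
  left_distrib f g h := Endo.ext (f.map_law' g.hasSubst h.hasSubst)
  right_distrib f g h := Endo.ext (subst_law f g h.hasSubst)
  zero_mul f := Endo.ext <| by
    rw [mul_toSeries, zero_toSeries, ← PowerSeries.coe_substAlgHom f.hasSubst, map_zero]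
  mul_zero f := Endo.ext (PowerSeries.subst_zero_of_constantCoeff_zero f.constantCoeff_eq_zero)

end Endo

end FormalGroup

/-! ### The formal group law of a Weierstrass curve -/

namespace WeierstrassCurve

variable {R : Type*} [CommRing R] (E : WeierstrassCurve R)

/-- The right-hand side of the Weierstrass equation in the coordinates `z = -x/y`, `w = -1/y`. -/
def wStep (w : PowerSeries R) : PowerSeries R :=
  PowerSeries.X ^ 3 + PowerSeries.C E.a₁ * PowerSeries.X * w
    + PowerSeries.C E.a₂ * PowerSeries.X ^ 2 * w + PowerSeries.C E.a₃ * w ^ 2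
    + PowerSeries.C E.a₄ * PowerSeries.X * w ^ 2 + PowerSeries.C E.a₆ * w ^ 3

/-- The expansion `w(z)` of `w = -1/y` at the origin in terms of `z = -x/y`: the solution of
`w = z³ + a₁zw + a₂z²w + a₃w² + a₄zw² + a₆w³` with `w(0) = 0`, obtained by iteration
(see `wSeries_eq`). -/
def wSeries : PowerSeries R :=
  PowerSeries.mk fun n => PowerSeries.coeff n (E.wStep^[n + 1] 0)

theorem dvd_wStep_sub {u v : PowerSeries R} {n : ℕ} (hu : PowerSeries.X ∣ u)
    (hv : PowerSeries.X ∣ v) (h : PowerSeries.X ^ n ∣ u - v) :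
    PowerSeries.X ^ (n + 1) ∣ E.wStep u - E.wStep v := by
  obtain ⟨u, rfl⟩ := hu
  obtain ⟨v, rfl⟩ := hv
  obtain ⟨d, hd⟩ := h
  have h1 : E.wStep (PowerSeries.X * u) - E.wStep (PowerSeries.X * v) =
      (PowerSeries.X * u - PowerSeries.X * v) * (PowerSeries.X * (PowerSeries.C E.a₁
        + PowerSeries.C E.a₂ * PowerSeries.X + PowerSeries.C E.a₃ * (u + v)
        + PowerSeries.C E.a₄ * PowerSeries.X * (u + v)
        + PowerSeries.C E.a₆ * PowerSeries.X * (u ^ 2 + u * v + v ^ 2))) := by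
    simp only [wStep]; ring
  rw [h1, hd]
  exact ⟨d * (PowerSeries.C E.a₁ + PowerSeries.C E.a₂ * PowerSeries.X
    + PowerSeries.C E.a₃ * (u + v) + PowerSeries.C E.a₄ * PowerSeries.X * (u + v)
    + PowerSeries.C E.a₆ * PowerSeries.X * (u ^ 2 + u * v + v ^ 2)), by ring⟩

theorem X_dvd_wStep {u : PowerSeries R} (hu : PowerSeries.X ∣ u) : PowerSeries.X ∣ E.wStep u := by
  obtain ⟨u, rfl⟩ := hu
  refine ⟨PowerSeries.X ^ 2 + PowerSeries.C E.a₁ * PowerSeries.X * u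
    + PowerSeries.C E.a₂ * PowerSeries.X ^ 2 * u + PowerSeries.C E.a₃ * PowerSeries.X * u ^ 2
    + PowerSeries.C E.a₄ * PowerSeries.X ^ 2 * u ^ 2
    + PowerSeries.C E.a₆ * PowerSeries.X ^ 2 * u ^ 3, ?_⟩
  simp only [wStep]; ring

theorem X_dvd_iterate (n : ℕ) : PowerSeries.X ∣ E.wStep^[n] 0 := by
  induction n with
  | zero => simp
  | succ n ih => rw [Function.iterate_succ_apply']; exact E.X_dvd_wStep ih

theorem dvd_iterate_sub (n k : ℕ) :
    PowerSeries.X ^ n ∣ E.wStep^[n + k] 0 - E.wStep^[n] 0 := by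
  induction n with
  | zero => simp
  | succ n ih =>
    rw [show n + 1 + k = (n + k) + 1 by ring, Function.iterate_succ_apply',
      Function.iterate_succ_apply']
    exact E.dvd_wStep_sub (E.X_dvd_iterate _) (E.X_dvd_iterate _) ih

theorem dvd_wSeries_sub (n : ℕ) : PowerSeries.X ^ n ∣ E.wSeries - E.wStep^[n] 0 := by
  rw [PowerSeries.X_pow_dvd_iff]
  intro m hm
  obtain ⟨k, rfl⟩ : ∃ k, n = m + 1 + k := ⟨n - (m + 1), by omega⟩
  have := (PowerSeries.X_pow_dvd_iff.mp (E.dvd_iterate_sub (m + 1) k)) m (by omega)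
  rw [map_sub, sub_eq_zero] at this
  rw [map_sub, this, wSeries, PowerSeries.coeff_mk, sub_self]

theorem X_dvd_wSeries : PowerSeries.X ∣ E.wSeries := by
  have := dvd_add (E.dvd_wSeries_sub 1) (pow_one (PowerSeries.X (R := R)) ▸ E.X_dvd_iterate 1)
  simpa using this

/-- `w(z) = z³ + a₁zw(z) + a₂z²w(z) + a₃w(z)² + a₄zw(z)² + a₆w(z)³`. -/
theorem wSeries_eq : E.wSeries = PowerSeries.X ^ 3 + PowerSeries.C E.a₁ * PowerSeries.X * E.wSeries
    + PowerSeries.C E.a₂ * PowerSeries.X ^ 2 * E.wSeries + PowerSeries.C E.a₃ * E.wSeries ^ 2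
    + PowerSeries.C E.a₄ * PowerSeries.X * E.wSeries ^ 2
    + PowerSeries.C E.a₆ * E.wSeries ^ 3 := by
  change E.wSeries = E.wStep E.wSeries
  ext n
  have h1 := E.dvd_wSeries_sub (n + 1)
  have h2 := E.dvd_wStep_sub E.X_dvd_wSeries (E.X_dvd_iterate n) (E.dvd_wSeries_sub n)
  rw [← Function.iterate_succ_apply' E.wStep] at h2
  have h3 := dvd_sub h1 h2
  rw [sub_sub_sub_cancel_right] at h3
  have := PowerSeries.X_pow_dvd_iff.mp h3 n (by omega)
  rwa [map_sub, sub_eq_zero] at this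

/-- The slope `λ(z₁, z₂) = (w(z₂) - w(z₁)) / (z₂ - z₁)`. Since
`(z₂ᵐ - z₁ᵐ) / (z₂ - z₁) = ∑_{i + j + 1 = m} z₁ⁱ z₂ʲ`, its coefficient at `z₁ⁱ z₂ʲ` is the
coefficient of `w` in degree `i + j + 1`. -/
def slopeSeries : MvPowerSeries (Fin 2) R :=
  fun n => PowerSeries.coeff (n 0 + n 1 + 1) E.wSeries

/-- `ν(z₁, z₂) = w(z₁) - λ(z₁, z₂) z₁`, so that `w = λ z + ν` is the line through
`(z₁, w(z₁))` and `(z₂, w(z₂))`. -/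
def interceptSeries : MvPowerSeries (Fin 2) R :=
  E.wSeries.subst (MvPowerSeries.X 0 : MvPowerSeries (Fin 2) R)
    - E.slopeSeries * MvPowerSeries.X 0

/-- The `z`-coordinate of the third point of intersection of the curve with the line
`w = λ z + ν`: minus `z₁`, minus `z₂`, plus the sum of the three roots of the cubic obtained
by substituting the line into the equation of the curve. -/
def thirdPointSeries : MvPowerSeries (Fin 2) R :=
  - MvPowerSeries.X 0 - MvPowerSeries.X 1
    - (MvPowerSeries.C E.a₁ * E.slopeSeries + MvPowerSeries.C E.a₂ * E.interceptSeries
        + MvPowerSeries.C E.a₃ * E.slopeSeries ^ 2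
        + 2 * MvPowerSeries.C E.a₄ * E.slopeSeries * E.interceptSeries
        + 3 * MvPowerSeries.C E.a₆ * E.slopeSeries ^ 2 * E.interceptSeries)
      * MvPowerSeries.invOfUnit (1 + MvPowerSeries.C E.a₂ * E.slopeSeries
        + MvPowerSeries.C E.a₄ * E.slopeSeries ^ 2
        + MvPowerSeries.C E.a₆ * E.slopeSeries ^ 3) 1

/-- The `z`-coordinate of the inverse of the point with parameter `z`:
`-z / (1 - a₁ z - a₃ w(z))`. -/
def negSeries : PowerSeries R :=
  - PowerSeries.X * PowerSeries.invOfUnit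
    (1 - PowerSeries.C E.a₁ * PowerSeries.X - PowerSeries.C E.a₃ * E.wSeries) 1

/-- The formal group law `F_E(z₁, z₂)` of a Weierstrass curve in the parameter `z = -x/y`, as a
power series: the inverse of the third point on the line through the points with parameters
`z₁` and `z₂`. -/
def formalGroupSeries : MvPowerSeries (Fin 2) R :=
  E.negSeries.subst E.thirdPointSeries

end WeierstrassCurve

/-! ### The two formal group laws over the field with four elements -/

/-- The field with four elements. -/
abbrev F4 : Type := GaloisField 2 2

/-- The supersingular curve `y² - y = x³` over the field with four elements. -/
def curveC : WeierstrassCurve F4 where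
  a₁ := 0
  a₂ := 0
  a₃ := -1
  a₄ := 0
  a₆ := 0

/-- The Honda logarithm of height two at the prime two, `ℓ(x) = ∑_k x^(4^k) / 2^k`. -/
def hondaLog : PowerSeries ℚ :=
  PowerSeries.mk fun n => ∑ k ∈ Finset.range (n + 1), if n = 4 ^ k then (1 / 2 : ℚ) ^ k else 0

/-- `F` is the Honda formal group law of height two at the prime two over the field with four
elements: the reduction of the (unique) formal group law `G` over `ℤ` with logarithm `ℓ`, that is,
with `ℓ(G(x, y)) = ℓ(x) + ℓ(y)` over `ℚ`. -/
def IsHondaFormalGroup (F : FormalGroup F4) : Prop :=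
  ∃ G : FormalGroup ℤ,
    hondaLog.subst (G.map (Int.castRingHom ℚ)).toPowerSeries =
      hondaLog.subst (MvPowerSeries.X 0 : MvPowerSeries (Fin 2) ℚ)
        + hondaLog.subst (MvPowerSeries.X 1 : MvPowerSeries (Fin 2) ℚ) ∧
    F = G.map (Int.castRingHom F4)

/-! ### The twisted extensions of the Witt vectors -/

/-- The ring of Witt vectors of the field with four elements. -/
abbrev W4 : Type := WittVector 2 F4

/-- The Frobenius automorphism `σ` of the Witt vectors. -/
def frob : W4 →+* W4 := WittVector.frobenius

theorem frob_frob (a : W4) : frob (frob a) = a := by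
  ext n
  simp only [frob, WittVector.coeff_frobenius_charP]
  have h : Nat.card F4 = 4 := by
    have := GaloisField.card 2 2 (by norm_num)
    simpa using this
  have : Fintype F4 := Fintype.ofFinite _
  have h2 := FiniteField.pow_card (a.coeff n)
  rw [← Nat.card_eq_fintype_card, h] at h2
  rw [← pow_mul]
  exact h2

/-- The ring `W⟨T⟩ / (T² = t, aT = Ta^σ)` for an integer `t`, with the element `a + bT` written
as the pair `(a, b)`. That this ring has the stated presentation is
`TwistedWitt.existsUnique_lift`. -/
@[ext]
structure TwistedWitt (t : ℤ) where
  /-- The coefficient `a` of `a + bT`. -/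
  re : W4
  /-- The coefficient `b` of `a + bT`. -/
  im : W4

namespace TwistedWitt

variable {t : ℤ}

instance : Zero (TwistedWitt t) := ⟨⟨0, 0⟩⟩

instance : One (TwistedWitt t) := ⟨⟨1, 0⟩⟩

instance : Add (TwistedWitt t) := ⟨fun x y => ⟨x.re + y.re, x.im + y.im⟩⟩

instance : Neg (TwistedWitt t) := ⟨fun x => ⟨-x.re, -x.im⟩⟩

/-- `(a + bT)(c + dT) = (ac + t b d^σ) + (ad + b c^σ) T`. -/
instance : Mul (TwistedWitt t) :=
  ⟨fun x y => ⟨x.re * y.re + (t : W4) * (x.im * frob y.im), x.re * y.im + x.im * frob y.re⟩⟩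

@[simp] theorem zero_re : (0 : TwistedWitt t).re = 0 := rfl

@[simp] theorem zero_im : (0 : TwistedWitt t).im = 0 := rfl

@[simp] theorem one_re : (1 : TwistedWitt t).re = 1 := rfl

@[simp] theorem one_im : (1 : TwistedWitt t).im = 0 := rfl

@[simp] theorem add_re (x y : TwistedWitt t) : (x + y).re = x.re + y.re := rfl

@[simp] theorem add_im (x y : TwistedWitt t) : (x + y).im = x.im + y.im := rfl

@[simp] theorem neg_re (x : TwistedWitt t) : (-x).re = -x.re := rfl

@[simp] theorem neg_im (x : TwistedWitt t) : (-x).im = -x.im := rfl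

@[simp] theorem mul_re (x y : TwistedWitt t) :
    (x * y).re = x.re * y.re + (t : W4) * (x.im * frob y.im) := rfl

@[simp] theorem mul_im (x y : TwistedWitt t) :
    (x * y).im = x.re * y.im + x.im * frob y.re := rfl

instance : Ring (TwistedWitt t) where
  add_assoc x y z := by ext1 <;> simp [add_assoc]
  zero_add x := by ext1 <;> simp
  add_zero x := by ext1 <;> simp
  add_comm x y := by ext1 <;> simp [add_comm]
  neg_add_cancel x := by ext1 <;> simp
  nsmul := nsmulRec
  zsmul := zsmulRec
  mul_assoc x y z := by
    ext1 <;> simp only [mul_re, mul_im, map_add, map_mul, map_intCast, frob_frob] <;> ring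
  one_mul x := by ext1 <;> simp
  mul_one x := by ext1 <;> simp
  left_distrib x y z := by ext1 <;> simp only [mul_re, mul_im, add_re, add_im, map_add] <;> ring
  right_distrib x y z := by ext1 <;> simp only [mul_re, mul_im, add_re, add_im] <;> ring
  zero_mul x := by ext1 <;> simp
  mul_zero x := by ext1 <;> simp

variable (t) in
/-- The inclusion of the Witt vectors. -/
def of : W4 →+* TwistedWitt t where
  toFun a := ⟨a, 0⟩
  map_zero' := rfl
  map_one' := rfl
  map_add' a b := by ext1 <;> simp
  map_mul' a b := by ext1 <;> simp

variable (t) in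
/-- The generator `T`. -/
def gen : TwistedWitt t := ⟨0, 1⟩

theorem eq_of_add_of_mul_gen (x : TwistedWitt t) : x = of t x.re + of t x.im * gen t := by
  ext1 <;> simp [of, gen]

theorem gen_mul_gen : gen t * gen t = (t : TwistedWitt t) := by
  rw [← map_intCast (of t)]
  have h : of t (t : W4) = ⟨(t : W4), 0⟩ := rfl
  rw [h]
  ext1 <;> simp [gen]

theorem of_mul_gen (a : W4) : of t a * gen t = gen t * of t (frob a) := by
  ext1 <;> simp [of, gen, frob_frob]

/-- The universal property of `W⟨T⟩ / (T² = t, aT = Ta^σ)`. -/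
theorem existsUnique_lift {A : Type*} [Ring A] (f : W4 →+* A) (s : A) (hs : s * s = (t : A))
    (hfs : ∀ a, f a * s = s * f (frob a)) :
    ∃! g : TwistedWitt t →+* A, g.comp (of t) = f ∧ g (gen t) = s := by
  have hsf (a : W4) : s * f a = f (frob a) * s := by rw [hfs, frob_frob]
  refine ⟨{ toFun := fun x => f x.re + f x.im * s
            map_zero' := by simp
            map_one' := by simp
            map_add' := fun x y => by simp only [add_re, add_im, map_add]; noncomm_ring
            map_mul' := fun x y => ?_ }, ⟨?_, ?_⟩, ?_⟩
  · simp only [mul_re, mul_im, map_add, map_mul, map_intCast]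
    have h1 : f x.im * s * (f y.im * s) = (t : A) * (f x.im * f (frob y.im)) := by
      calc f x.im * s * (f y.im * s) = f x.im * (s * f y.im) * s := by noncomm_ring
        _ = f x.im * f (frob y.im) * (s * s) := by rw [hsf]; noncomm_ring
        _ = _ := by rw [hs, Int.cast_comm]
    have h2 : f x.im * s * f y.re = f x.im * f (frob y.re) * s := by
      rw [mul_assoc, hsf, mul_assoc]
    rw [mul_add, add_mul, add_mul, add_mul, h1, h2]
    noncomm_ring
  · ext a; simp [of]
  · simp [gen]
  · rintro g ⟨hg1, hg2⟩
    ext x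
    conv_lhs => rw [eq_of_add_of_mul_gen x]
    rw [map_add, map_mul, hg2, ← RingHom.comp_apply, ← RingHom.comp_apply, hg1]
    rfl

end TwistedWitt

end

noncomputable section

/-! ### Rings complete for the powers of a one-sided uniformizer -/

/-! Both endomorphism rings come from one criterion, `IsUniformizedBy.exists_ringEquiv`. Suppose two
rings have a common residue field and each is separated and complete for the powers of a right
regular generator of the kernel of reduction. If they share compatible copies of a subring that
contains the generators, surjects onto the residue field and whose non-units modulo the generator
are divisible by it inside the subring, then the rings are isomorphic: the closure of the diagonal
copy in the product is the graph of an isomorphism. The subring here is the order of elements `i + j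
w + (k + l w) τ` with integer coefficients, where `w` is a primitive cube root of unity, `τ² = ±2`
and `τ w = w² τ`.

For the twisted Witt vectors the filtration is the 2-adic one. For a formal group law in
characteristic two with Frobenius-fixed coefficients, the uniformizer is `T = x²`: an endomorphism
with zero linear coefficient is a series in `x²` (`exists_toSeries_eq_expand`), hence a right
multiple of `T`, and limits of endomorphisms are endomorphisms. So `exists_ringEquiv_twistedWitt`
needs only three inputs for each group: Frobenius invariance, multiplication by `ζ`, and the value
of `T²`.

For the Honda group, the functional equation `ℓ(x) = x + ℓ(x⁴)/2` gives integrality of the law, by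
Hazewinkel's argument, and the congruence `[2](x) ≡ x⁴` modulo 2, so `T² = 2`. The exponents in `ℓ`
are 1 modulo 3, which gives multiplication by `ζ`.

For the curve, the chord construction is compared with the group of points over the fraction field
of a power series ring in three variables; associativity there gives associativity of the law. The
tangent at `x` meets the curve again at parameter `x⁴`, so `[2](x)` is the inverse of `x⁴` and `T² =
-2`. Multiplication by `ζ` fixes `w` because `ζ³ = 1`.

Finally, `-7` is a square in the Witt vectors by Hensel's lemma and `1 - 2ω` has norm 7, so `α` has
norm `-1` and `(αS)² = α α^σ S² = -2`. Hence `T ↦ αS` even extends to an isomorphism of the full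
rings, and the statement on unit groups follows. -/

/-- `τ` is a right regular generator of the kernel of `χ`, and the ring is separated and complete
for the filtration by the left ideals generated by the even powers of `τ`. -/
structure IsUniformizedBy {B k : Type*} [Ring B] [Ring k] (χ : B →+* k) (τ : B) : Prop where
  map_eq_zero : χ τ = 0
  exists_of_map_eq_zero : ∀ b, χ b = 0 → ∃ c, b = c * τ
  eq_zero_of_mul : ∀ b, b * τ = 0 → b = 0
  separated : ∀ b, (∀ n, ∃ c, b = c * τ ^ (2 * n)) → b = 0
  complete : ∀ b : ℕ → B, (∀ n, ∃ c, b (n + 1) - b n = c * τ ^ (2 * n)) →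
    ∃ l, ∀ n, ∃ c, l - b n = c * τ ^ (2 * n)

namespace IsUniformizedBy

/-! ### Approximation by a dense subring -/

section Dense

variable {B D k : Type*} [Ring B] [Ring D] [Ring k] {χ : B →+* k} {π : D →+* B} {τ : D}
  {A : Subring D}

/-- The kernel of `χ` is two-sided, so `τ b` lies in it and is again a left multiple of `τ`. The
left ideals of the filtration are therefore two-sided, which makes the closure of a subring a
subring. -/
theorem exists_pow_mul (h : IsUniformizedBy χ (π τ)) (n : ℕ) (b : B) :
    ∃ c, (π τ) ^ n * b = c * (π τ) ^ n := by
  induction n generalizing b with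
  | zero => exact ⟨b, by simp⟩
  | succ n ih =>
    obtain ⟨c, hc⟩ := h.exists_of_map_eq_zero (π τ * b) (by rw [map_mul, h.map_eq_zero, zero_mul])
    obtain ⟨d, hd⟩ := ih c
    exact ⟨d, by rw [pow_succ, mul_assoc, hc, ← mul_assoc, hd, mul_assoc]⟩

/-- The filtration of the big ring induces the `τ`-adic filtration on `A`: divide by `τ` inside `A`
and cancel `τ` on the right in the big ring. The map `π` is kept general so that both projections of
a product can be used. -/
theorem exists_mem_of_map_eq (h : IsUniformizedBy χ (π τ))
    (hker : ∀ a ∈ A, χ (π a) = 0 → ∃ a' ∈ A, a = a' * τ) (n : ℕ) {a : D} (ha : a ∈ A)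
    (hb : ∃ b, π a = b * π τ ^ n) : ∃ a' ∈ A, a = a' * τ ^ n := by
  induction n generalizing a with
  | zero => exact ⟨a, ha, by simp⟩
  | succ n ih =>
    obtain ⟨b, hb⟩ := hb
    obtain ⟨a', ha', rfl⟩ := hker a ha (by
      rw [hb, pow_succ, map_mul, map_mul, h.map_eq_zero, mul_zero, mul_zero])
    obtain ⟨a'', ha'', rfl⟩ := ih ha' ⟨b, by
      rw [← sub_eq_zero]
      refine h.eq_zero_of_mul _ ?_
      rw [sub_mul, sub_eq_zero, ← map_mul, hb, pow_succ, mul_assoc]⟩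
    exact ⟨a'', ha'', by rw [pow_succ, mul_assoc]⟩

/-- A `τ`-adic expansion with digits in `A`: match the residue, divide the difference by `τ`,
repeat. -/
theorem exists_approx (h : IsUniformizedBy χ (π τ)) (hτ : τ ∈ A)
    (hsurj : ∀ c, ∃ a ∈ A, χ (π a) = c) (n : ℕ) (b : B) :
    ∃ a ∈ A, ∃ c, b - π a = c * π τ ^ n := by
  induction n generalizing b with
  | zero => exact ⟨0, A.zero_mem, b, by simp⟩
  | succ n ih =>
    obtain ⟨a, ha, hab⟩ := hsurj (χ b)
    obtain ⟨b', hb'⟩ := h.exists_of_map_eq_zero (b - π a) (by rw [map_sub, hab, sub_self])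
    obtain ⟨a', ha', c, hc⟩ := ih b'
    refine ⟨a + a' * τ, A.add_mem ha (A.mul_mem ha' hτ), c, ?_⟩
    rw [map_add, ← sub_sub, hb', map_mul, ← sub_mul, hc, pow_succ, mul_assoc]

end Dense

/-! ### The closure of a common subring as the graph of an isomorphism -/

section Equiv

variable {B C k : Type*} [Ring B] [Ring C] [Ring k] {χB : B →+* k} {χC : C →+* k} {τB : B} {τC : C}

/-- The closure of a subring of `B × C` in the topology of the uniformizers. -/
def closure (hB : IsUniformizedBy χB τB) (hC : IsUniformizedBy χC τC) (A : Subring (B × C)) :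
    Subring (B × C) where
  carrier := {p | ∀ n, ∃ a ∈ A, ∃ d, p - a = d * (τB, τC) ^ (2 * n)}
  zero_mem' n := ⟨0, A.zero_mem, 0, by simp⟩
  one_mem' n := ⟨1, A.one_mem, 0, by simp⟩
  neg_mem' {p} hp n := by
    obtain ⟨a, ha, d, hd⟩ := hp n
    exact ⟨-a, A.neg_mem ha, -d, by rw [neg_mul, ← hd]; abel⟩
  add_mem' {p q} hp hq n := by
    obtain ⟨a, ha, d, hd⟩ := hp n
    obtain ⟨a', ha', d', hd'⟩ := hq n
    exact ⟨a + a', A.add_mem ha ha', d + d', by rw [add_mul, ← hd, ← hd']; abel⟩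
  mul_mem' {p q} hp hq n := by
    obtain ⟨a, ha, d, hd⟩ := hp n
    obtain ⟨a', ha', d', hd'⟩ := hq n
    obtain ⟨b, hb⟩ := hB.exists_pow_mul (π := RingHom.id B) (2 * n) q.1
    obtain ⟨c, hc⟩ := hC.exists_pow_mul (π := RingHom.id C) (2 * n) q.2
    have hq' : (τB, τC) ^ (2 * n) * q = (b, c) * (τB, τC) ^ (2 * n) := by
      ext
      · simpa using hb
      · simpa using hc
    refine ⟨a * a', A.mul_mem ha ha', d * (b, c) + a * d', ?_⟩
    calc p * q - a * a' = (p - a) * q + a * (q - a') := by noncomm_ring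
      _ = _ := by rw [hd, hd', mul_assoc, hq']; noncomm_ring

/-- Two rings with uniformizers containing compatible copies of a dense subring are isomorphic. -/
theorem exists_ringEquiv (hB : IsUniformizedBy χB τB) (hC : IsUniformizedBy χC τC)
    (A : Subring (B × C)) (hτ : (τB, τC) ∈ A) (hχ : ∀ a ∈ A, χB a.1 = χC a.2)
    (hsurj : ∀ c, ∃ a ∈ A, χB a.1 = c)
    (hker : ∀ a ∈ A, χB a.1 = 0 → ∃ a' ∈ A, a = a' * (τB, τC)) :
    ∃ e : B ≃+* C, ∀ a ∈ A, e a.1 = a.2 := by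
  have hB' : IsUniformizedBy χB (RingHom.fst B C (τB, τC)) := hB
  have hC' : IsUniformizedBy χC (RingHom.snd B C (τB, τC)) := hC
  have hkerC : ∀ a ∈ A, χC (RingHom.snd B C a) = 0 → ∃ a' ∈ A, a = a' * (τB, τC) :=
    fun a ha h => hker a ha (by rw [hχ a ha]; exact h)
  have hsurjC : ∀ c, ∃ a ∈ A, χC (RingHom.snd B C a) = c := fun c => by
    obtain ⟨a, ha, h⟩ := hsurj c
    exact ⟨a, ha, by rw [← h, hχ a ha]; rfl⟩
  -- The closure is the graph of the isomorphism; both projections are shown to be bijective.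
  let Γ := closure hB hC A
  have hAΓ : ∀ a ∈ A, a ∈ Γ := fun a ha n => ⟨a, ha, 0, by simp⟩
  have bijB : Function.Bijective ((RingHom.fst B C).comp Γ.subtype) := by
    constructor
    · rw [injective_iff_map_eq_zero]
      rintro ⟨⟨b, c⟩, hp⟩ (rfl : b = 0)
      -- An approximant of `(0, c)` has first coordinate in the `2n`-th ideal, hence is itself
      -- divisible by the `2n`-th power within `A`; its second coordinate, and so `c`, is then deep
      -- in the filtration.
      have : c = 0 := hC.separated c fun n => by
        obtain ⟨a, ha, d, hd⟩ := hp n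
        have h1 := congrArg Prod.fst hd
        have h2 := congrArg Prod.snd hd
        simp only [Prod.fst_sub, Prod.snd_sub, Prod.fst_mul, Prod.snd_mul, Prod.pow_fst,
          Prod.pow_snd] at h1 h2
        obtain ⟨a', -, ha'⟩ := hB'.exists_mem_of_map_eq hker (2 * n) ha
          ⟨-d.1, by simpa [neg_eq_iff_eq_neg] using h1⟩
        refine ⟨d.2 + a'.2, ?_⟩
        rw [sub_eq_iff_eq_add] at h2
        rw [h2, ha']
        simp [add_mul]
      subst this
      rfl
    · intro b
      choose a ha c hc using fun n => hB'.exists_approx hτ hsurj (2 * n) b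
      -- Successive approximants of `b` differ by a multiple of the uniformizer power inside `A`, so
      -- their second coordinates form a Cauchy sequence too.
      have key (n : ℕ) : ∃ a' ∈ A, a (n + 1) - a n = a' * (τB, τC) ^ (2 * n) := by
        refine hB'.exists_mem_of_map_eq hker (2 * n) (A.sub_mem (ha _) (ha _))
          ⟨c n - c (n + 1) * τB ^ 2, ?_⟩
        have h1 := hc n
        have h2 := hc (n + 1)
        rw [show 2 * (n + 1) = 2 + 2 * n by ring, pow_add] at h2
        rw [map_sub, sub_mul, ← h1, mul_assoc]
        simp only [RingHom.coe_fst] at h1 h2 ⊢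
        rw [← h2]
        abel
      choose a' _ ha' using key
      obtain ⟨l, hl⟩ := hC.complete (fun n => (a n).2) fun n => ⟨(a' n).2, by
        have := congrArg Prod.snd (ha' n)
        simpa using this⟩
      choose d hd using hl
      refine ⟨⟨(b, l), fun n => ⟨a n, ha n, (c n, d n), ?_⟩⟩, rfl⟩
      ext
      · simpa using hc n
      · simpa using hd n
  have bijC : Function.Bijective ((RingHom.snd B C).comp Γ.subtype) := by
    constructor
    · rw [injective_iff_map_eq_zero]
      rintro ⟨⟨b, c⟩, hp⟩ (rfl : c = 0)
      have : b = 0 := hB.separated b fun n => by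
        obtain ⟨a, ha, d, hd⟩ := hp n
        have h1 := congrArg Prod.fst hd
        have h2 := congrArg Prod.snd hd
        simp only [Prod.fst_sub, Prod.snd_sub, Prod.fst_mul, Prod.snd_mul, Prod.pow_fst,
          Prod.pow_snd] at h1 h2
        obtain ⟨a', -, ha'⟩ := hC'.exists_mem_of_map_eq hkerC (2 * n) ha
          ⟨-d.2, by simpa [neg_eq_iff_eq_neg] using h2⟩
        refine ⟨d.1 + a'.1, ?_⟩
        rw [sub_eq_iff_eq_add] at h1
        rw [h1, ha']
        simp [add_mul]
      subst this
      rfl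
    · intro b
      choose a ha c hc using fun n => hC'.exists_approx hτ hsurjC (2 * n) b
      have key (n : ℕ) : ∃ a' ∈ A, a (n + 1) - a n = a' * (τB, τC) ^ (2 * n) := by
        refine hC'.exists_mem_of_map_eq hkerC (2 * n) (A.sub_mem (ha _) (ha _))
          ⟨c n - c (n + 1) * τC ^ 2, ?_⟩
        have h1 := hc n
        have h2 := hc (n + 1)
        rw [show 2 * (n + 1) = 2 + 2 * n by ring, pow_add] at h2
        rw [map_sub, sub_mul, ← h1, mul_assoc]
        simp only [RingHom.coe_snd] at h1 h2 ⊢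
        rw [← h2]
        abel
      choose a' _ ha' using key
      obtain ⟨l, hl⟩ := hB.complete (fun n => (a n).1) fun n => ⟨(a' n).1, by
        have := congrArg Prod.fst (ha' n)
        simpa using this⟩
      choose d hd using hl
      refine ⟨⟨(l, b), fun n => ⟨a n, ha n, (d n, c n), ?_⟩⟩, rfl⟩
      ext
      · simpa using hd n
      · simpa using hc n
  refine ⟨(RingEquiv.ofBijective _ bijB).symm.trans (RingEquiv.ofBijective _ bijC), fun a ha => ?_⟩
  have h1 : (RingEquiv.ofBijective _ bijB).symm a.1 = ⟨a, hAΓ a ha⟩ := by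
    rw [RingEquiv.symm_apply_eq]
    rfl
  rw [RingEquiv.trans_apply, h1]
  rfl

end Equiv

end IsUniformizedBy

/-! ### The order spanned by a cube root of unity and a square root of an integer -/

/-- The subring of elements `i + j w + (k + l w) τ` with integers `i, j, k, l`. -/
def quaternionOrder {D : Type*} [Ring D] (w τ : D) (t : ℤ) (hw : w * w = -1 - w)
    (hτw : τ * w = (-1 - w) * τ) (hτ : τ * τ = (t : D)) : Subring D where
  carrier := {x | ∃ i j k l : ℤ, x = i + j * w + (k + l * w) * τ}
  zero_mem' := ⟨0, 0, 0, 0, by simp⟩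
  one_mem' := ⟨1, 0, 0, 0, by simp⟩
  neg_mem' := by
    rintro _ ⟨i, j, k, l, rfl⟩
    exact ⟨-i, -j, -k, -l, by push_cast; noncomm_ring⟩
  add_mem' := by
    rintro _ _ ⟨i, j, k, l, rfl⟩ ⟨i', j', k', l', rfl⟩
    exact ⟨i + i', j + j', k + k', l + l', by push_cast; noncomm_ring⟩
  mul_mem' := by
    rintro _ _ ⟨i, j, k, l, rfl⟩ ⟨i', j', k', l', rfl⟩
    have hmul (a b c d : ℤ) : ((a : D) + b * w) * (c + d * w) =
        ((a * c - b * d : ℤ) : D) + ((a * d + b * c - b * d : ℤ) : D) * w := by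
      have h1 : ((a : D) + b * w) * (c + d * w) =
          a * c + a * (d * w) + b * (w * c) + b * (w * d) * w := by noncomm_ring
      rw [h1, ← Int.cast_comm c w, ← Int.cast_comm d w]
      have h2 : (b : D) * (d * w) * w = b * d * (w * w) := by noncomm_ring
      rw [h2, hw, ← mul_assoc, ← mul_assoc]
      push_cast
      noncomm_ring
    -- Passing `τ` across `a + b w` replaces `w` by its conjugate `-1 - w`.
    have hconj (a b : ℤ) : τ * ((a : D) + b * w) = (((a - b : ℤ) : D) + ((-b : ℤ) : D) * w) * τ := by
      have h1 : τ * ((a : D) + b * w) = τ * a + τ * b * w := by noncomm_ring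
      rw [h1, ← Int.cast_comm a τ, ← Int.cast_comm b τ, mul_assoc, hτw]
      push_cast
      noncomm_ring
    have hexp : ((i : D) + j * w + (k + l * w) * τ) * (i' + j' * w + (k' + l' * w) * τ) =
        (i + j * w) * (i' + j' * w) + (i + j * w) * (k' + l' * w) * τ
          + (k + l * w) * (τ * (i' + j' * w)) + (k + l * w) * (τ * (k' + l' * w)) * τ := by
      noncomm_ring
    have h3 (x : D) : x * τ * τ = x * (t + (0 : ℤ) * w) := by rw [mul_assoc, hτ]; simp
    have h4 (a b c d e f g h : ℤ) : (a : D) + b * w + (c + d * w) * τ + (e + f * w) * τ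
        + (g + h * w) = ((a + g : ℤ) : D) + ((b + h : ℤ) : D) * w
          + (((c + e : ℤ) : D) + ((d + f : ℤ) : D) * w) * τ := by
      push_cast
      noncomm_ring
    rw [Set.mem_ofPred_eq, hexp, hconj, hconj, ← mul_assoc, ← mul_assoc, hmul, hmul, hmul, hmul, h3,
      hmul, h4]
    exact ⟨_, _, _, _, rfl⟩

/-! ### The Witt vectors of the field with four elements -/

theorem card_F4 : Nat.card F4 = 4 := by
  have := GaloisField.card 2 2 (by norm_num)
  simpa using this

theorem pow_four (c : F4) : c ^ 4 = c := by
  have : Fintype F4 := Fintype.ofFinite _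
  have h2 := FiniteField.pow_card c
  rwa [← Nat.card_eq_fintype_card, card_F4] at h2

namespace F4

theorem eq_cases {ζ : F4} (hζ : IsPrimitiveRoot ζ 3) (c : F4) :
    c = 0 ∨ c = 1 ∨ c = ζ ∨ c = ζ ^ 2 := by
  by_cases h : c = 0
  · exact Or.inl h
  have h3 : c ^ 3 = 1 := by
    have := pow_four c
    refine mul_left_cancel₀ h ?_
    rw [← pow_succ', this, mul_one]
  obtain ⟨i, hi, rfl⟩ := hζ.eq_pow_of_pow_eq_one h3
  interval_cases i <;> simp

/-- This is the independence of `1` and `ζ` over the prime field. It determines which elements of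
the integral order reduce to zero. -/
theorem even_of_add_mul_eq_zero {ζ : F4} (hζ : IsPrimitiveRoot ζ 3) {i j : ℤ}
    (h : (i : F4) + j * ζ = 0) : Even i ∧ Even j := by
  have hc (n : ℤ) : (n : F4) = 0 ∨ (n : F4) = 1 := by
    rcases Int.even_or_odd' n with ⟨m, rfl | rfl⟩
    · left; push_cast; rw [show (2 : F4) = 0 from CharTwo.two_eq_zero]; simp
    · right; push_cast; rw [show (2 : F4) = 0 from CharTwo.two_eq_zero]; simp
  have h0 (n : ℤ) : (n : F4) = 0 → Even n := fun hn => by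
    rw [CharP.intCast_eq_zero_iff F4 2] at hn
    exact even_iff_two_dvd.mpr (by exact_mod_cast hn)
  have hζ0 : ζ ≠ 0 := hζ.ne_zero (by norm_num)
  have hζ1 : ζ ≠ 1 := hζ.ne_one (by norm_num)
  rcases hc i with hi | hi <;> rcases hc j with hj | hj
  · exact ⟨h0 _ hi, h0 _ hj⟩
  · simp [hi, hj, hζ0] at h
  · simp [hi, hj] at h
  · rw [hi, hj, one_mul] at h
    exact absurd (CharTwo.add_eq_zero.mp h).symm hζ1

end F4

namespace W4

theorem two_dvd_iff (a : W4) : 2 ∣ a ↔ a.coeff 0 = 0 := by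
  rw [← WittVector.mem_span_p_iff_coeff_zero_eq_zero (p := 2), Ideal.mem_span_singleton]
  norm_cast

/-- Multiplication by 2 is injective on Witt vectors, and an odd integer is nonzero in the residue
field. -/
instance : CharZero W4 := by
  have : ∀ n : ℕ, (n : W4) = 0 → n = 0 := by
    intro n hn
    by_contra h
    obtain ⟨k, m, hm, rfl⟩ := Nat.exists_eq_two_pow_mul_odd h
    have h1 : (m : W4) = 0 := by
      clear h
      induction k with
      | zero => simpa using hn
      | succ k ih =>
        refine ih (WittVector.eq_zero_of_p_mul_eq_zero (p := 2) _ ?_)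
        rw [← hn]
        push_cast
        ring
    have h2 : (WittVector.constantCoeff (m : W4) : F4) = 0 := by rw [h1, map_zero]
    rw [map_natCast, CharP.cast_eq_zero_iff F4 2] at h2
    exact (Nat.not_even_iff_odd.mpr hm) (even_iff_two_dvd.mpr h2)
  exact charZero_of_inj_zero this

theorem isAdicComplete : IsAdicComplete (Ideal.span {(2 : W4)}) W4 := by
  have := WittVector.isAdicCompleteIdealSpanP (p := 2) (k := F4)
  exact_mod_cast this

theorem eq_zero_of_forall_two_pow_dvd (a : W4) (h : ∀ n, 2 ^ n ∣ a) : a = 0 := by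
  refine isAdicComplete.haus' a fun n => ?_
  rw [smul_eq_mul, Ideal.mul_top, SModEq.zero, Ideal.span_singleton_pow, Ideal.mem_span_singleton]
  exact h n

theorem exists_limit (a : ℕ → W4) (h : ∀ n, 2 ^ n ∣ a (n + 1) - a n) :
    ∃ l, ∀ n, 2 ^ n ∣ l - a n := by
  obtain ⟨l, hl⟩ := isAdicComplete.prec' a fun {m n} hmn => by
    rw [smul_eq_mul, Ideal.mul_top, Ideal.span_singleton_pow, SModEq.sub_mem,
      Ideal.mem_span_singleton, dvd_sub_comm]
    induction n, hmn using Nat.le_induction with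
    | base => simp
    | succ n hmn ih =>
      have := dvd_add ((pow_dvd_pow 2 hmn).trans (h n)) ih
      simpa using this
  refine ⟨l, fun n => ?_⟩
  have := hl n
  rw [smul_eq_mul, Ideal.mul_top, Ideal.span_singleton_pow, SModEq.sub_mem,
      Ideal.mem_span_singleton, dvd_sub_comm] at this
  exact this

theorem frob_teichmuller (c : F4) :
    frob (WittVector.teichmuller 2 c) = WittVector.teichmuller 2 (c ^ 2) := by
  ext n
  rw [frob, WittVector.coeff_frobenius_charP]
  cases n <;> simp [-map_pow]

theorem teichmuller_sq {ζ : F4} (hζ : IsPrimitiveRoot ζ 3) :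
    WittVector.teichmuller 2 ζ * WittVector.teichmuller 2 ζ = -1 - WittVector.teichmuller 2 ζ := by
  set w := WittVector.teichmuller 2 ζ with hw
  have h1 : w ^ 3 = 1 := by rw [hw, ← map_pow, hζ.pow_eq_one, map_one]
  have h2 : w ≠ 1 := fun h => hζ.ne_one (by norm_num) (by
    have := congrArg (fun a : W4 => a.coeff 0) h
    simpa [hw] using this)
  have h3 : (w - 1) * (w ^ 2 + w + 1) = 0 := by linear_combination h1
  have h4 := (mul_eq_zero.mp h3).resolve_left (sub_ne_zero.mpr h2)
  linear_combination h4

/-- If `q² + q + 2 = 0` then `(2q + 1)² = -7`. Hensel's lemma lifts the root `0` modulo 2, where the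
derivative is `1`; since `q` is even, `2q + 1` is 1 modulo 4. -/
theorem exists_sqrt_neg_seven : ∃ r : W4, r ^ 2 = -7 ∧ 4 ∣ r - 1 := by
  have := isAdicComplete
  have hH : HenselianRing W4 (Ideal.span {(2 : W4)}) := inferInstance
  obtain ⟨q, hq, hq0⟩ := hH.is_henselian (Polynomial.X ^ 2 + Polynomial.X + 2)
    (by monicity!) 0 (by simp) (by simp)
  rw [sub_zero, Ideal.mem_span_singleton] at hq0
  obtain ⟨s, rfl⟩ := hq0
  simp only [Polynomial.IsRoot, Polynomial.eval_add, Polynomial.eval_pow, Polynomial.eval_X,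
    Polynomial.eval_ofNat] at hq
  exact ⟨2 * (2 * s) + 1, by linear_combination 4 * hq, ⟨s, by ring⟩⟩

theorem isUnit_of_coeff_zero_ne_zero {a : W4} (h : a.coeff 0 ≠ 0) : IsUnit a :=
  WittVector.isUnit_of_coeff_zero_ne_zero a h

/-- The conjugate is also a square root of `-7`, so it is `r` or `-r`; congruence to 1 modulo 4 is
preserved by Frobenius and excludes `-r`. -/
theorem frob_eq_of_sq_eq_neg_seven {r : W4} (hr : r ^ 2 = -7) (h4 : 4 ∣ r - 1) : frob r = r := by
  have h1 : (frob r - r) * (frob r + r) = 0 := by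
    have : frob r ^ 2 = -7 := by rw [← map_pow, hr, map_neg, map_ofNat]
    linear_combination this - hr
  rcases mul_eq_zero.mp h1 with h | h
  · exact sub_eq_zero.mp h
  · obtain ⟨s, hs⟩ := h4
    have h5 : frob r - 1 = 4 * frob s := by
      rw [← map_one frob, ← map_sub, hs, map_mul, map_ofNat]
    have h6 : (2 : W4) * (1 + 2 * (s + frob s)) = 2 * 0 := by linear_combination h - hs - h5
    have h7 := mul_left_cancel₀ two_ne_zero h6
    have h8 : (2 : W4) ∣ 1 := ⟨-(s + frob s), by linear_combination h7⟩
    rw [two_dvd_iff] at h8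
    simp at h8

/-- The norm of `1 - 2ω` is `(1 - 2ω)(3 + 2ω) = 7`, and `r` is fixed by Frobenius with `r² = -7`, so
the quotient has norm `-1`. -/
theorem exists_norm_neg_one {ζ : F4} (hζ : IsPrimitiveRoot ζ 3) :
    ∃ r α : W4, r ^ 2 = -7 ∧ 4 ∣ r - 1 ∧ α * r = 1 - 2 * WittVector.teichmuller 2 ζ ∧
      α * frob α = -1 := by
  obtain ⟨r, hr, h4⟩ := exists_sqrt_neg_seven
  have hu : IsUnit r := isUnit_of_coeff_zero_ne_zero fun h => by
    rw [← two_dvd_iff] at h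
    have : (2 : W4) ∣ 1 := by
      have := dvd_sub h (Dvd.dvd.trans (⟨2, by norm_num⟩ : (2 : W4) ∣ 4) h4)
      simpa using this
    rw [two_dvd_iff] at this
    simp at this
  obtain ⟨v, hv⟩ := hu.exists_right_inv
  have hw2 := teichmuller_sq hζ
  have hfw : frob (WittVector.teichmuller 2 ζ) = -1 - WittVector.teichmuller 2 ζ := by
    rw [frob_teichmuller, pow_two, map_mul, teichmuller_sq hζ]
  generalize WittVector.teichmuller 2 ζ = w at hw2 hfw ⊢
  obtain ⟨α, hα⟩ : ∃ α, α * r = 1 - 2 * w := ⟨(1 - 2 * w) * v, by linear_combination (1 - 2 * w) * hv⟩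
  refine ⟨r, α, hr, h4, hα, ?_⟩
  have hα' : frob α * r = 1 - 2 * (-1 - w) := by
    have := congrArg frob hα
    rwa [map_mul, frob_eq_of_sq_eq_neg_seven hr h4, map_sub, map_one, map_mul, map_ofNat, hfw]
      at this
  have h7 : (7 : W4) ≠ 0 := by norm_num
  refine mul_left_cancel₀ h7 ?_
  linear_combination α * frob α * hr - frob α * r * hα - (1 - 2 * w) * hα' + 4 * hw2

end W4

/-! ### The twisted extensions of the Witt vectors -/

namespace TwistedWitt

variable {t : ℤ}

/-- Reduction modulo the generator. -/
def residue (ht : (t : F4) = 0) : TwistedWitt t →+* F4 where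
  toFun x := x.re.coeff 0
  map_zero' := by simp
  map_one' := by simp
  map_add' x y := by simp [← WittVector.constantCoeff_apply]
  map_mul' x y := by
    rw [mul_re, ← WittVector.constantCoeff_apply, map_add, map_mul, map_mul, map_intCast, ht,
      zero_mul, add_zero]
    rfl

theorem mul_gen (x : TwistedWitt t) : x * gen t = ⟨t * x.im, x.re⟩ := by
  ext1 <;> simp [gen]

/-- Even powers of the generator are the scalars `tⁿ`, so with even powers the filtration is 2-adic
in each coordinate. -/
theorem mul_gen_pow (x : TwistedWitt t) (n : ℕ) :
    x * gen t ^ (2 * n) = ⟨t ^ n * x.re, t ^ n * x.im⟩ := by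
  induction n with
  | zero => simp
  | succ n ih =>
    rw [show 2 * (n + 1) = 2 * n + 1 + 1 by ring, pow_succ, pow_succ, ← mul_assoc, ← mul_assoc, ih,
      mul_gen, mul_gen]
    ext1 <;> simp only <;> ring

/-- Since `t` is 2 up to sign, separatedness and completeness reduce to the 2-adic completeness of
the Witt vectors, coordinate by coordinate. -/
theorem isUniformizedBy (ht : (t : F4) = 0) (h2 : t = 2 ∨ t = -2) :
    IsUniformizedBy (residue ht) (gen t) := by
  have hdvd (n : ℕ) (a : W4) : 2 ^ n ∣ a ↔ (t : W4) ^ n ∣ a := by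
    rcases h2 with rfl | rfl
    · simp
    · rw [Int.cast_neg, neg_pow, IsUnit.mul_left_dvd]
      · simp
      · exact (isUnit_one.neg).pow n
  have ht0 : (t : W4) ≠ 0 := by rcases h2 with rfl | rfl <;> simp
  have key (n : ℕ) (x : TwistedWitt t) :
      (∃ c, x = c * gen t ^ (2 * n)) ↔ 2 ^ n ∣ x.re ∧ 2 ^ n ∣ x.im := by
    rw [hdvd, hdvd]
    constructor
    · rintro ⟨c, rfl⟩
      rw [mul_gen_pow]
      exact ⟨dvd_mul_right _ _, dvd_mul_right _ _⟩
    · rintro ⟨⟨a, ha⟩, ⟨b, hb⟩⟩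
      refine ⟨⟨a, b⟩, ?_⟩
      rw [mul_gen_pow]
      ext1
      · exact ha
      · exact hb
  refine ⟨?_, ?_, ?_, ?_, ?_⟩
  · simp [residue, gen]
  · intro x hx
    have h1 : (2 : W4) ^ 1 ∣ x.re := by rw [pow_one, W4.two_dvd_iff]; exact hx
    rw [hdvd, pow_one] at h1
    obtain ⟨c, hc⟩ := h1
    refine ⟨⟨x.im, c⟩, ?_⟩
    rw [mul_gen]
    ext1
    · exact hc
    · rfl
  · intro x hx
    rw [mul_gen] at hx
    have h1 := congrArg re hx
    have h2 := congrArg im hx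
    simp only [zero_re, zero_im, mul_eq_zero, ht0, false_or] at h1 h2
    ext1
    · exact h2
    · exact h1
  · intro x hx
    ext1
    · exact W4.eq_zero_of_forall_two_pow_dvd _ fun n => ((key n x).mp (hx n)).1
    · exact W4.eq_zero_of_forall_two_pow_dvd _ fun n => ((key n x).mp (hx n)).2
  · intro x hx
    have hsub (x y : TwistedWitt t) : (x - y).re = x.re - y.re ∧ (x - y).im = x.im - y.im := by
      rw [sub_eq_add_neg, add_re, add_im, neg_re, neg_im, ← sub_eq_add_neg, ← sub_eq_add_neg]
      exact ⟨rfl, rfl⟩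
    obtain ⟨a, ha⟩ := W4.exists_limit (fun n => (x n).re) fun n => by
      rw [← (hsub _ _).1]
      exact ((key n _).mp (hx n)).1
    obtain ⟨b, hb⟩ := W4.exists_limit (fun n => (x n).im) fun n => by
      rw [← (hsub _ _).2]
      exact ((key n _).mp (hx n)).2
    refine ⟨⟨a, b⟩, fun n => (key n _).mpr ?_⟩
    rw [(hsub _ _).1, (hsub _ _).2]
    exact ⟨ha n, hb n⟩

/-- The isomorphism `a + bT ↦ a + b(αS)` for an element `α` of norm `-1`. -/
def scaleGen (α : W4) (hα : α * frob α = -1) : TwistedWitt (-t) ≃+* TwistedWitt t where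
  toFun x := ⟨x.re, x.im * α⟩
  invFun x := ⟨x.re, x.im * -frob α⟩
  left_inv x := by
    ext1
    · rfl
    · simp only
      linear_combination -x.im * hα
  right_inv x := by
    ext1
    · rfl
    · simp only
      linear_combination -x.im * hα
  map_add' x y := by ext1 <;> simp [add_mul]
  map_mul' x y := by
    ext1
    · simp only [mul_re, map_mul]
      push_cast
      linear_combination -(t : W4) * x.im * frob y.im * hα
    · simp only [mul_im]
      ring

theorem scaleGen_apply (α : W4) (hα : α * frob α = -1) (a b : W4) :
    scaleGen (t := t) α hα (of (-t) a + of (-t) b * gen (-t)) =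
      of t a + of t b * (of t α * gen t) := by
  ext1 <;> simp [scaleGen, of, gen]

end TwistedWitt

end

noncomputable section

/-! ### Power series modulo high degree -/

namespace MvPowerSeries

variable {σ τ R : Type*} [CommRing R]

variable (σ R) in
/-- The ideal of power series without terms of total degree less than `n`. -/
def degIdeal (n : ℕ) : Ideal (MvPowerSeries σ R) where
  carrier := {f | (n : ℕ∞) ≤ f.order}
  zero_mem' := by simp
  add_mem' {f g} hf hg := le_trans (le_min hf hg) min_order_le_add
  smul_mem' c f hf := by
    refine le_trans ?_ (le_order_mul (f := c) (g := f))
    exact le_add_of_nonneg_of_le zero_le hf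

theorem mem_degIdeal_iff {n : ℕ} {f : MvPowerSeries σ R} :
    f ∈ degIdeal σ R n ↔ ∀ d, d.degree < n → coeff d f = 0 := by
  refine ⟨fun h d hd => coeff_of_lt_order ?_, fun h => le_order fun d hd => h d ?_⟩
  · exact lt_of_lt_of_le (by exact_mod_cast hd) h
  · exact_mod_cast hd

theorem mem_degIdeal_one_iff {f : MvPowerSeries σ R} :
    f ∈ degIdeal σ R 1 ↔ constantCoeff f = 0 := by
  rw [← one_le_order_iff_constCoeff_eq_zero]
  simp [degIdeal]

theorem degIdeal_anti {m n : ℕ} (h : m ≤ n) : degIdeal σ R n ≤ degIdeal σ R m :=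
  fun _ hf => le_trans (Nat.cast_le.mpr h : (m : ℕ∞) ≤ n) hf

theorem mul_mem_degIdeal {m n : ℕ} {f g : MvPowerSeries σ R} (hf : f ∈ degIdeal σ R m)
    (hg : g ∈ degIdeal σ R n) : f * g ∈ degIdeal σ R (m + n) := by
  refine le_trans ?_ (le_order_mul (f := f) (g := g))
  push_cast
  exact add_le_add hf hg

theorem eq_of_forall_sub_mem_degIdeal {f g : MvPowerSeries σ R}
    (h : ∀ n, f - g ∈ degIdeal σ R n) : f = g := by
  ext d
  have := mem_degIdeal_iff.mp (h (d.degree + 1)) d (by omega)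
  rwa [map_sub, sub_eq_zero] at this

/-- Modulo the ideal of high-degree series, each monomial in the `a s` equals the corresponding
monomial in the `b s`. -/
theorem subst_sub_subst_mem {a b : σ → MvPowerSeries τ R} (ha : HasSubst a) (hb : HasSubst b)
    {n : ℕ} (h : ∀ s, a s - b s ∈ degIdeal τ R n) (f : MvPowerSeries σ R) :
    f.subst a - f.subst b ∈ degIdeal τ R n := by
  rw [mem_degIdeal_iff]
  intro d hd
  rw [map_sub, sub_eq_zero, coeff_subst ha, coeff_subst hb]
  refine finsum_congr fun e => ?_
  congr 1
  have : (e.prod fun s k => a s ^ k) - (e.prod fun s k => b s ^ k) ∈ degIdeal τ R n := by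
    rw [← Ideal.Quotient.eq]
    simp only [Finsupp.prod, map_prod, map_pow]
    refine Finset.prod_congr rfl fun s _ => ?_
    rw [Ideal.Quotient.eq.mpr (h s)]
  have := mem_degIdeal_iff.mp this d hd
  rwa [map_sub, sub_eq_zero] at this

theorem subst_mem_degIdeal {a : σ → MvPowerSeries τ R} (ha : HasSubst a) {m : ℕ}
    (h : ∀ s, a s ∈ degIdeal τ R m) {n : ℕ} {f : MvPowerSeries σ R} (hf : f ∈ degIdeal σ R n) :
    f.subst a ∈ degIdeal τ R (m * n) := by
  refine le_trans ?_ (le_order_subst ha f)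
  push_cast
  exact mul_le_mul' (le_iInf h) hf

theorem coeff_single_mul_of_constantCoeff {f g : MvPowerSeries σ R} (hf : constantCoeff f = 0)
    (hg : constantCoeff g = 0) (i : σ) : coeff (Finsupp.single i 1) (f * g) = 0 :=
  mem_degIdeal_iff.mp (mul_mem_degIdeal (mem_degIdeal_one_iff.mpr hf)
    (mem_degIdeal_one_iff.mpr hg)) _ (by simp)

theorem expand_injective {p : ℕ} (hp : p ≠ 0) :
    Function.Injective (expand p hp : MvPowerSeries σ R → MvPowerSeries σ R) := fun f g h => by
  ext d
  rw [← coeff_expand_smul p hp, h, coeff_expand_smul]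

theorem expand_eq_subst {p : ℕ} (hp : p ≠ 0) (f : MvPowerSeries (Fin 2) R) :
    expand p hp f = f.subst ![X 0 ^ p, X 1 ^ p] := by
  rw [expand, substAlgHom_apply]
  congr 1
  funext s
  fin_cases s <;> rfl

/-- When the coefficients are fixed by Frobenius, `f(x², y²) = f(x, y)²` in characteristic two; then
substitute. This is what makes `x²` an endomorphism. -/
theorem subst_pair_sq [CharP R 2] {f : MvPowerSeries (Fin 2) R} (hf : f.map (frobenius R 2) = f)
    {u v : MvPowerSeries τ R} (hu : PowerSeries.HasSubst u) (hv : PowerSeries.HasSubst v) :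
    f.subst ![u ^ 2, v ^ 2] = f.subst ![u, v] ^ 2 := by
  have h1 : expand 2 two_ne_zero f = f ^ 2 := by
    rw [← map_frobenius_expand 2 two_ne_zero, map_expand, hf]
  have huv : HasSubst ![u, v] := FormalGroup.hasSubst_pair hu hv
  rw [← subst_pow huv, ← h1, expand_eq_subst, subst_comp_subst_apply _ huv]
  · congr 1
    funext s
    fin_cases s <;> simp [subst_pow huv, subst_X huv]
  · refine FormalGroup.hasSubst_pair ?_ ?_ <;>
      exact PowerSeries.HasSubst.of_constantCoeff_zero (by simp)

instance instCharP {p : ℕ} [CharP R p] : CharP (MvPowerSeries σ R) p :=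
  charP_of_injective_ringHom (f := C) C_injective p

end MvPowerSeries

/-! ### Divided differences and linear terms of one-variable series -/

namespace PowerSeries

variable {σ τ R : Type*} [CommRing R]

theorem X_pow_dvd_iff_mem_degIdeal {n : ℕ} {f : PowerSeries R} :
    X ^ n ∣ f ↔ f ∈ MvPowerSeries.degIdeal Unit R n := by
  rw [X_pow_dvd_iff, MvPowerSeries.mem_degIdeal_iff]
  constructor
  · intro h d hd
    have h1 : d = Finsupp.single () d.degree := by
      ext
      simp [Finsupp.degree_eq_sum]
    rw [h1]
    exact h _ hd
  · intro h m hm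
    exact h (Finsupp.single () m) (by simpa using hm)

/-- The divided difference `(f(y) - f(x)) / (y - x)`. -/
def slope (f : PowerSeries R) : MvPowerSeries (Fin 2) R := fun n => coeff (n 0 + n 1 + 1) f

theorem coeff_slope (f : PowerSeries R) (d : Fin 2 →₀ ℕ) :
    MvPowerSeries.coeff d f.slope = coeff (d 0 + d 1 + 1) f := rfl

theorem slope_mul (f : PowerSeries R) :
    f.slope * (MvPowerSeries.X 1 - MvPowerSeries.X 0) =
      f.subst (MvPowerSeries.X 1 : MvPowerSeries (Fin 2) R)
        - f.subst (MvPowerSeries.X 0 : MvPowerSeries (Fin 2) R) := by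
  ext d
  rw [mul_sub, map_sub, map_sub, coeff_subst_single, coeff_subst_single, MvPowerSeries.X,
    MvPowerSeries.X, MvPowerSeries.coeff_mul_monomial, MvPowerSeries.coeff_mul_monomial,
    coeff_slope, coeff_slope]
  have e1 (s : Fin 2) : Finsupp.single s 1 ≤ d ↔ 1 ≤ d s := by
    rw [Finsupp.single_le_iff]
  have e2 : d = Finsupp.single 0 (d 0) ↔ d 1 = 0 := by
    rw [Finsupp.ext_iff]
    simp [Fin.forall_fin_two]
  have e3 : d = Finsupp.single 1 (d 1) ↔ d 0 = 0 := by
    rw [Finsupp.ext_iff]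
    simp [Fin.forall_fin_two]
  simp only [e1, e2, e3, Finsupp.tsub_apply, mul_one]
  rcases Nat.eq_zero_or_pos (d 0) with h0 | h0 <;> rcases Nat.eq_zero_or_pos (d 1) with h1 | h1
  · simp [h0, h1]
  · simp [h0, h1.ne', Nat.sub_add_cancel h1, Nat.one_le_iff_ne_zero]
  · simp [h1, h0.ne', Nat.sub_add_cancel h0, Nat.one_le_iff_ne_zero]
  · simp only [h0.ne', h1.ne', Nat.one_le_iff_ne_zero, ne_eq, not_false_eq_true, if_true, if_false]
    simp only [Finsupp.single_apply]
    norm_num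
    rw [show d 0 + (d 1 - 1) + 1 = d 0 + d 1 by omega,
      show d 0 - 1 + d 1 + 1 = d 0 + d 1 by omega, sub_self]

theorem subst_subst_X {u : Fin 2 → MvPowerSeries τ R} (hu : MvPowerSeries.HasSubst u)
    (f : PowerSeries R) (i : Fin 2) :
    (f.subst (MvPowerSeries.X i : MvPowerSeries (Fin 2) R)).subst u = f.subst (u i) := by
  rw [PowerSeries.subst, MvPowerSeries.subst_comp_subst_apply (HasSubst.X i).const hu]
  simp only [MvPowerSeries.subst_X hu]
  rfl

theorem slope_subst_mul (f : PowerSeries R) {u v : MvPowerSeries τ R} (hu : HasSubst u)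
    (hv : HasSubst v) : f.slope.subst ![u, v] * (v - u) = f.subst v - f.subst u := by
  have huv := FormalGroup.hasSubst_pair hu hv
  have := congrArg (MvPowerSeries.subst ![u, v]) f.slope_mul
  rw [MvPowerSeries.subst_mul huv, MvPowerSeries.subst_sub huv, MvPowerSeries.subst_sub huv,
    MvPowerSeries.subst_X huv, MvPowerSeries.subst_X huv, subst_subst_X huv,
    subst_subst_X huv] at this
  simpa using this

theorem sub_dvd_subst_sub (f : PowerSeries R) {u v : MvPowerSeries τ R} (hu : HasSubst u)
    (hv : HasSubst v) : v - u ∣ f.subst v - f.subst u :=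
  ⟨_, by rw [← f.slope_subst_mul hu hv, mul_comm]⟩

theorem constantCoeff_slope_subst (f : PowerSeries R) {u v : MvPowerSeries τ R}
    (hu : MvPowerSeries.constantCoeff u = 0) (hv : MvPowerSeries.constantCoeff v = 0) :
    MvPowerSeries.constantCoeff (f.slope.subst ![u, v]) = coeff 1 f := by
  have huv : MvPowerSeries.HasSubst ![u, v] := FormalGroup.hasSubst_pair
    (HasSubst.of_constantCoeff_zero hu) (HasSubst.of_constantCoeff_zero hv)
  have h1 : f.slope - MvPowerSeries.C (coeff 1 f) ∈ MvPowerSeries.degIdeal (Fin 2) R 1 := by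
    rw [MvPowerSeries.mem_degIdeal_one_iff, map_sub, MvPowerSeries.constantCoeff_C,
      ← MvPowerSeries.coeff_zero_eq_constantCoeff_apply, coeff_slope]
    simp
  have h2 := MvPowerSeries.subst_mem_degIdeal huv (m := 1) (fun s => by
    rw [MvPowerSeries.mem_degIdeal_one_iff]
    fin_cases s
    · exact hu
    · exact hv) h1
  rw [mul_one, MvPowerSeries.mem_degIdeal_one_iff, MvPowerSeries.subst_sub huv, map_sub,
    sub_eq_zero, MvPowerSeries.subst_C, MvPowerSeries.constantCoeff_C] at h2
  exact h2

/-- Substitution into a series with invertible linear coefficient is injective. -/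
theorem subst_inj_of_coeff_one {f : PowerSeries R} (hf : IsUnit (coeff 1 f)) {u v : MvPowerSeries τ R}
    (hu : MvPowerSeries.constantCoeff u = 0) (hv : MvPowerSeries.constantCoeff v = 0)
    (h : f.subst u = f.subst v) : u = v := by
  have h1 := f.slope_subst_mul (HasSubst.of_constantCoeff_zero hu) (HasSubst.of_constantCoeff_zero hv)
  rw [h, sub_self] at h1
  have h2 : IsUnit (f.slope.subst ![u, v]) := by
    rw [MvPowerSeries.isUnit_iff_constantCoeff, f.constantCoeff_slope_subst hu hv]
    exact hf
  exact (sub_eq_zero.mp ((h2.mul_right_eq_zero).mp h1)).symm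

theorem sub_C_mul_X_mem_degIdeal {f : PowerSeries R} (hf : constantCoeff f = 0) :
    f - C (coeff 1 f) * X ∈ MvPowerSeries.degIdeal Unit R 2 := by
  rw [← X_pow_dvd_iff_mem_degIdeal, X_pow_dvd_iff]
  intro m hm
  interval_cases m <;> simp [hf]

theorem subst_sub_mem_degIdeal {f : PowerSeries R} (hf : constantCoeff f = 0)
    {u : MvPowerSeries τ R} (hu : MvPowerSeries.constantCoeff u = 0) :
    f.subst u - MvPowerSeries.C (coeff 1 f) * u ∈ MvPowerSeries.degIdeal τ R 2 := by
  have hu' := HasSubst.of_constantCoeff_zero hu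
  have := MvPowerSeries.subst_mem_degIdeal hu'.const (m := 1)
    (fun _ => MvPowerSeries.mem_degIdeal_one_iff.mpr hu) (sub_C_mul_X_mem_degIdeal hf)
  rw [one_mul, ← subst_def, subst_sub hu', subst_mul hu', subst_X hu'] at this
  rwa [show subst u (C (coeff 1 f)) = MvPowerSeries.C (coeff 1 f) from subst_C _] at this

theorem coeff_single_subst {f : PowerSeries R} (hf : constantCoeff f = 0)
    {u : MvPowerSeries τ R} (hu : MvPowerSeries.constantCoeff u = 0) (i : τ) :
    MvPowerSeries.coeff (Finsupp.single i 1) (f.subst u) =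
      coeff 1 f * MvPowerSeries.coeff (Finsupp.single i 1) u := by
  have := MvPowerSeries.mem_degIdeal_iff.mp (subst_sub_mem_degIdeal hf hu) (Finsupp.single i 1)
    (by simp)
  rwa [map_sub, sub_eq_zero, MvPowerSeries.coeff_C_mul] at this

theorem exists_eq_expand_add (f : PowerSeries R) : ∃ a b : PowerSeries R,
    f = expand 2 two_ne_zero a + X * expand 2 two_ne_zero b := by
  refine ⟨mk fun n => coeff (2 * n) f,
    mk fun n => coeff (2 * n + 1) f, ?_⟩
  ext n
  rcases Nat.even_or_odd' n with ⟨m, rfl | rfl⟩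
  · rw [map_add, coeff_expand_mul, coeff_mk]
    rcases m with _ | m
    · simp
    · rw [show 2 * (m + 1) = 2 * m + 1 + 1 by ring, coeff_succ_X_mul,
        coeff_expand_of_not_dvd _ _ _ (by omega), add_zero]
  · rw [map_add, coeff_succ_X_mul, coeff_expand_mul, coeff_mk,
      coeff_expand_of_not_dvd _ _ _ (by omega), zero_add]

end PowerSeries

end

noncomputable section

/-! ### Endomorphism rings of formal group laws in characteristic two -/

namespace FormalGroup

open MvPowerSeries (degIdeal)

/-! ### Linear terms and congruences for a formal group law -/

section General

variable {R : Type*} [CommRing R] {τ : Type*} (F : FormalGroup R)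

theorem hasSubst_toPowerSeries : PowerSeries.HasSubst F.toPowerSeries :=
  PowerSeries.HasSubst.of_constantCoeff_zero F.zero_constantCoeff

theorem toPowerSeries_sub_mem :
    F.toPowerSeries - (MvPowerSeries.X 0 + MvPowerSeries.X 1) ∈ degIdeal (Fin 2) R 2 := by
  rw [MvPowerSeries.mem_degIdeal_iff]
  intro d hd
  have h1 : d = Finsupp.single 0 (d 0) + Finsupp.single 1 (d 1) := by
    ext i
    fin_cases i <;> simp
  have h2 : d 0 + d 1 < 2 := by simpa [Finsupp.degree_eq_sum] using hd
  have h3 : d 0 = 0 ∧ d 1 = 0 ∨ d 0 = 1 ∧ d 1 = 0 ∨ d 0 = 0 ∧ d 1 = 1 := by omega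
  rcases h3 with ⟨h, h'⟩ | ⟨h, h'⟩ | ⟨h, h'⟩ <;> rw [h, h'] at h1 <;> rw [h1]
  · simp [F.zero_constantCoeff]
  · simp [F.lin_coeff_X, MvPowerSeries.coeff_index_single_X]
  · simp [F.lin_coeff_Y, MvPowerSeries.coeff_index_single_X]

theorem subst_pair_sub_mem {u v : MvPowerSeries τ R} (hu : MvPowerSeries.constantCoeff u = 0)
    (hv : MvPowerSeries.constantCoeff v = 0) :
    F.toPowerSeries.subst ![u, v] - (u + v) ∈ degIdeal τ R 2 := by
  have huv : MvPowerSeries.HasSubst ![u, v] := hasSubst_pair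
    (PowerSeries.HasSubst.of_constantCoeff_zero hu) (PowerSeries.HasSubst.of_constantCoeff_zero hv)
  have := MvPowerSeries.subst_mem_degIdeal huv (m := 1) (fun s => by
    rw [MvPowerSeries.mem_degIdeal_one_iff]
    fin_cases s
    · exact hu
    · exact hv) F.toPowerSeries_sub_mem
  rw [one_mul, MvPowerSeries.subst_sub huv, MvPowerSeries.subst_add huv, MvPowerSeries.subst_X huv,
    MvPowerSeries.subst_X huv] at this
  simpa using this

theorem subst_pair_sub_subst_pair_mem {u v u' v' : MvPowerSeries τ R} (hu : PowerSeries.HasSubst u)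
    (hv : PowerSeries.HasSubst v) (hu' : PowerSeries.HasSubst u') (hv' : PowerSeries.HasSubst v')
    {n : ℕ} (h : u - u' ∈ degIdeal τ R n) (h' : v - v' ∈ degIdeal τ R n) :
    F.toPowerSeries.subst ![u, v] - F.toPowerSeries.subst ![u', v'] ∈ degIdeal τ R n := by
  refine MvPowerSeries.subst_sub_subst_mem (hasSubst_pair hu hv) (hasSubst_pair hu' hv')
    (fun s => ?_) _
  fin_cases s
  · exact h
  · exact h'

/-- The expansion `F(x, y) = x + y U(x, y)` with `U(0, 0) = 1`. -/
theorem exists_eq_X_add : ∃ U : MvPowerSeries (Fin 2) R, MvPowerSeries.constantCoeff U = 1 ∧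
    F.toPowerSeries = MvPowerSeries.X 0 + MvPowerSeries.X 1 * U := by
  have h0 : (MvPowerSeries.X 1 : MvPowerSeries (Fin 2) R) ∣ F.toPowerSeries - MvPowerSeries.X 0 := by
    rw [MvPowerSeries.X_dvd_iff]
    intro d hd
    -- From `F(x, 0) = x`: a coefficient of `F` at a monomial without the second variable is the
    -- corresponding coefficient of the first variable.
    have h1 := F.add_zero (PowerSeries.HasSubst.X (S := R) (0 : Fin 2))
    have h2 := congrArg (MvPowerSeries.coeff d) h1
    rw [map_sub, ← h2, sub_eq_zero, MvPowerSeries.coeff_subst (hasSubst_pair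
      (PowerSeries.HasSubst.X 0) PowerSeries.HasSubst.zero), finsum_eq_single _ d]
    · rw [Finsupp.prod_fintype _ _ (by simp)]
      simp only [Fin.prod_univ_two, Matrix.cons_val_zero, Matrix.cons_val_one, hd, pow_zero,
        mul_one]
      have : d = Finsupp.single 0 (d 0) := by
        ext i
        fin_cases i <;> simp [hd]
      rw [MvPowerSeries.coeff_X_pow, if_pos this]
      simp
    · intro e he
      rw [Finsupp.prod_fintype _ _ (by simp)]
      simp only [Fin.prod_univ_two, Matrix.cons_val_zero, Matrix.cons_val_one]
      by_cases h : e 1 = 0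
      · rw [h, pow_zero, mul_one, MvPowerSeries.coeff_X_pow, if_neg, smul_zero]
        rintro rfl
        apply he
        ext i
        fin_cases i <;> simp [h]
      · rw [zero_pow h, mul_zero, map_zero, smul_zero]
  obtain ⟨U, hU⟩ := h0
  have hF : F.toPowerSeries = MvPowerSeries.X 0 + MvPowerSeries.X 1 * U := by
    rw [← hU]; ring
  refine ⟨U, ?_, hF⟩
  have h1 := F.lin_coeff_Y
  rw [hF, map_add, MvPowerSeries.coeff_index_single_X, mul_comm, MvPowerSeries.X] at h1
  have h2 := MvPowerSeries.coeff_add_mul_monomial 0 (Finsupp.single (1 : Fin 2) 1) U 1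
  rw [_root_.zero_add] at h2
  rw [h2] at h1
  simpa using h1

end General

/-! ### Limits of endomorphisms and the linear coefficient -/

namespace Endo

section General

variable {R : Type*} [CommRing R] {F : FormalGroup R}

/-- A power series which is congruent to endomorphisms modulo all degrees is an endomorphism. -/
theorem exists_limit (f : ℕ → F.Endo) {N : ℕ → ℕ} (hN : ∀ n, n < N n)
    (hmono : Monotone N) (h : ∀ n, PowerSeries.X ^ N n ∣ (f (n + 1)).toSeries - (f n).toSeries) :
    ∃ l : F.Endo, ∀ n, PowerSeries.X ^ N n ∣ l.toSeries - (f n).toSeries := by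
  have h' (n m : ℕ) (hnm : n ≤ m) : PowerSeries.X ^ N n ∣ (f m).toSeries - (f n).toSeries := by
    induction m, hnm using Nat.le_induction with
    | base => simp
    | succ m hm ih =>
      have := dvd_add ((pow_dvd_pow _ (hmono hm)).trans (h m)) ih
      simpa using this
  -- As `N m > m`, the coefficient in degree `m` no longer changes from `f m` onwards, so the
  -- diagonal gives the limit.
  let l : PowerSeries R := PowerSeries.mk fun m => PowerSeries.coeff m (f m).toSeries
  have hl (n : ℕ) : PowerSeries.X ^ N n ∣ l - (f n).toSeries := by
    rw [PowerSeries.X_pow_dvd_iff]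
    intro m hm
    rw [map_sub, PowerSeries.coeff_mk, ← map_sub]
    rcases le_total n m with hnm | hnm
    · exact PowerSeries.X_pow_dvd_iff.mp (h' n m hnm) m hm
    · have := PowerSeries.X_pow_dvd_iff.mp (h' m n hnm) m (hN m)
      rw [← neg_sub, map_neg, this, neg_zero]
  have hl0 : PowerSeries.constantCoeff l = 0 := by
    rw [← PowerSeries.coeff_zero_eq_constantCoeff_apply, PowerSeries.coeff_mk,
      PowerSeries.coeff_zero_eq_constantCoeff_apply, (f 0).constantCoeff_eq_zero]
  have hls : PowerSeries.HasSubst l := PowerSeries.HasSubst.of_constantCoeff_zero' hl0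
  have hcong {τ : Type} {u : MvPowerSeries τ R} (hu : MvPowerSeries.constantCoeff u = 0) (n : ℕ) :
      l.subst u - (f n).toSeries.subst u ∈ degIdeal τ R n := by
    have hu' := PowerSeries.HasSubst.of_constantCoeff_zero hu
    have h1 : l - (f n).toSeries ∈ degIdeal Unit R n :=
      MvPowerSeries.degIdeal_anti (hN n).le (PowerSeries.X_pow_dvd_iff_mem_degIdeal.mp (hl n))
    have := MvPowerSeries.subst_mem_degIdeal hu'.const (m := 1)
      (fun _ => MvPowerSeries.mem_degIdeal_one_iff.mpr hu) h1
    rwa [one_mul, ← PowerSeries.subst_def, PowerSeries.subst_sub hu'] at this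
  have hlX (i : Fin 2) : PowerSeries.HasSubst
      (l.subst (MvPowerSeries.X i : MvPowerSeries (Fin 2) R)) :=
    PowerSeries.HasSubst.of_constantCoeff_zero
      (PowerSeries.constantCoeff_subst_eq_zero (by simp) _ hl0)
  refine ⟨⟨l, hl0, MvPowerSeries.eq_of_forall_sub_mem_degIdeal fun n => ?_⟩, hl⟩
  have h1 := hcong F.zero_constantCoeff n
  have h2 := F.subst_pair_sub_subst_pair_mem (hlX 0) (hlX 1)
    ((f n).hasSubst_subst (PowerSeries.HasSubst.X 0))
    ((f n).hasSubst_subst (PowerSeries.HasSubst.X 1)) (hcong (MvPowerSeries.constantCoeff_X 0) n)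
    (hcong (MvPowerSeries.constantCoeff_X 1) n)
  rw [(f n).map_law] at h1
  have := Ideal.sub_mem _ h1 h2
  simpa using this

/-- Since `F(f, 0) = f`, a small summand changes the series only in high degree. This converts sums
for the group law into congruences of series. -/
theorem add_toSeries_sub_mem [F.IsComm] (f g : F.Endo) {n : ℕ}
    (hg : g.toSeries ∈ degIdeal Unit R n) : (f + g).toSeries - f.toSeries ∈ degIdeal Unit R n := by
  have := F.subst_pair_sub_subst_pair_mem f.hasSubst g.hasSubst f.hasSubst PowerSeries.HasSubst.zero
    (n := n) (by simp) (by simpa using hg)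
  rwa [F.add_zero f.hasSubst] at this

/-- The coefficient of `x`, as a ring homomorphism. -/
def linearCoeff [F.IsComm] : F.Endo →+* R where
  toFun f := PowerSeries.coeff 1 f.toSeries
  map_zero' := by simp [zero_toSeries]
  map_one' := by simp [one_toSeries]
  map_add' f g := by
    have := F.subst_pair_sub_mem f.constantCoeff_eq_zero g.constantCoeff_eq_zero
    rw [← add_toSeries] at this
    have := PowerSeries.X_pow_dvd_iff.mp (PowerSeries.X_pow_dvd_iff_mem_degIdeal.mpr this) 1
      (by norm_num)
    rwa [map_sub, map_add, sub_eq_zero] at this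
  map_mul' f g := PowerSeries.coeff_single_subst f.constantCoeff_eq_zero g.constantCoeff_eq_zero ()

/-- The ring structure on the endomorphisms of a commutative formal group law with an
endomorphism `-1`. -/
abbrev ring [F.IsComm] (m : F.Endo) (hm : m + 1 = 0) : Ring F.Endo :=
  { (inferInstance : Semiring F.Endo) with
    neg := fun f => m * f
    zsmul := letI : Neg F.Endo := ⟨fun f => m * f⟩; zsmulRec
    neg_add_cancel := fun f => by
      have : m * f + 1 * f = 0 := by rw [← add_mul, hm, zero_mul]
      rwa [one_mul] at this }

end General

/-! ### The Frobenius endomorphism as a uniformizer -/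

section CharTwo

variable {k : Type*} [Field k] [CharP k 2] {F : FormalGroup k}

/-- The endomorphism `x²`. -/
def frobenius (hF : F.toPowerSeries.map (_root_.frobenius k 2) = F.toPowerSeries) : F.Endo where
  toSeries := PowerSeries.X ^ 2
  constantCoeff_eq_zero := by simp
  map_law := by
    rw [PowerSeries.subst_pow F.hasSubst_toPowerSeries, PowerSeries.subst_X F.hasSubst_toPowerSeries,
      PowerSeries.subst_pow (PowerSeries.HasSubst.X 0), PowerSeries.subst_X (PowerSeries.HasSubst.X 0),
      PowerSeries.subst_pow (PowerSeries.HasSubst.X 1), PowerSeries.subst_X (PowerSeries.HasSubst.X 1),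
      MvPowerSeries.subst_pair_sq hF (PowerSeries.HasSubst.X 0) (PowerSeries.HasSubst.X 1)]
    have : (![MvPowerSeries.X 0, MvPowerSeries.X 1] : Fin 2 → MvPowerSeries (Fin 2) k) =
        MvPowerSeries.X := by
      funext s; fin_cases s <;> rfl
    rw [this, MvPowerSeries.subst_self, id]

theorem mul_frobenius_toSeries (hF : F.toPowerSeries.map (_root_.frobenius k 2) = F.toPowerSeries)
    (g : F.Endo) : (g * frobenius hF).toSeries = PowerSeries.expand 2 two_ne_zero g.toSeries := by
  rw [mul_toSeries, PowerSeries.expand_apply]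
  rfl

theorem mul_frobenius_pow_toSeries
    (hF : F.toPowerSeries.map (_root_.frobenius k 2) = F.toPowerSeries) (g : F.Endo) (n : ℕ) :
    PowerSeries.X ^ 2 ^ n ∣ (g * frobenius hF ^ n).toSeries := by
  induction n with
  | zero => simpa [PowerSeries.X_dvd_iff] using g.constantCoeff_eq_zero
  | succ n ih =>
    obtain ⟨c, hc⟩ := ih
    rw [pow_succ (frobenius hF), ← mul_assoc, mul_frobenius_toSeries, hc, map_mul, map_pow, PowerSeries.expand_X,
      ← pow_mul, ← pow_succ']
    exact dvd_mul_right _ _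

/-- An endomorphism with vanishing linear coefficient is a power series in `x²`. -/
theorem exists_toSeries_eq_expand (f : F.Endo) (hf : PowerSeries.coeff 1 f.toSeries = 0) :
    ∃ a, f.toSeries = PowerSeries.expand 2 two_ne_zero a := by
  obtain ⟨a, b, hab⟩ := PowerSeries.exists_eq_expand_add f.toSeries
  refine ⟨a, ?_⟩
  suffices hb : b = 0 by rw [hab, hb, map_zero, mul_zero, _root_.add_zero]
  obtain ⟨U, hU, hFU⟩ := F.exists_eq_X_add
  have hX0 : PowerSeries.HasSubst (MvPowerSeries.X 0 : MvPowerSeries (Fin 2) k) :=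
    PowerSeries.HasSubst.X 0
  have hX1 : PowerSeries.HasSubst (MvPowerSeries.X 1 : MvPowerSeries (Fin 2) k) :=
    PowerSeries.HasSubst.X 1
  have hsq {u : MvPowerSeries (Fin 2) k} (hu : PowerSeries.HasSubst u) :
      PowerSeries.HasSubst (u ^ 2) := by
    rw [pow_two]
    exact PowerSeries.HasSubst.mul_left hu
  have hexp {u : MvPowerSeries (Fin 2) k} (hu : PowerSeries.HasSubst u) (c : PowerSeries k) :
      (PowerSeries.expand 2 two_ne_zero c).subst u = c.subst (u ^ 2) := by
    rw [PowerSeries.expand_apply, PowerSeries.subst_comp_subst_apply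
      (PowerSeries.HasSubst.X_pow two_ne_zero) hu, PowerSeries.subst_pow hu,
      PowerSeries.subst_X hu]
  have hfs {u : MvPowerSeries (Fin 2) k} (hu : PowerSeries.HasSubst u) :
      f.toSeries.subst u = a.subst (u ^ 2) + u * b.subst (u ^ 2) := by
    rw [hab, PowerSeries.subst_add hu, PowerSeries.subst_mul hu, PowerSeries.subst_X hu, hexp hu,
      hexp hu]
  -- With `F = x + yU`, characteristic two gives `F² = x² + y²U²`. Hence series in the square do not
  -- change modulo `y²` when `x` is replaced by `F(x, y)`.
  have hdiff (c : PowerSeries k) : (MvPowerSeries.X 1 : MvPowerSeries (Fin 2) k) ^ 2 ∣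
      c.subst (F.toPowerSeries ^ 2) - c.subst ((MvPowerSeries.X 0 : MvPowerSeries (Fin 2) k) ^ 2) := by
    refine dvd_trans ?_ (c.sub_dvd_subst_sub (hsq hX0) (hsq F.hasSubst_toPowerSeries))
    rw [hFU]
    refine ⟨U ^ 2, ?_⟩
    rw [CharTwo.add_sq]
    ring
  have hy : (MvPowerSeries.X 1 : MvPowerSeries (Fin 2) k) ^ 2 ∣
      f.toSeries.subst (MvPowerSeries.X 1 : MvPowerSeries (Fin 2) k) := by
    have : PowerSeries.X ^ 2 ∣ f.toSeries := by
      rw [PowerSeries.X_pow_dvd_iff]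
      intro m hm
      interval_cases m
      · simpa using f.constantCoeff_eq_zero
      · exact hf
    obtain ⟨c, hc⟩ := this
    rw [hc, PowerSeries.subst_mul hX1, PowerSeries.subst_pow hX1, PowerSeries.subst_X hX1]
    exact dvd_mul_right _ _
  -- Here `f(F(x, y)) = F(f(x), f(y))`, and `f(y)` is divisible by `y²` because the linear
  -- coefficient vanishes.
  have hlaw : (MvPowerSeries.X 1 : MvPowerSeries (Fin 2) k) ^ 2 ∣
      f.toSeries.subst F.toPowerSeries
        - f.toSeries.subst (MvPowerSeries.X 0 : MvPowerSeries (Fin 2) k) := by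
    have hp := hasSubst_pair (f.hasSubst_subst hX0) (f.hasSubst_subst hX1)
    rw [f.map_law]
    nth_rw 1 [hFU]
    rw [MvPowerSeries.subst_add hp, MvPowerSeries.subst_mul hp, MvPowerSeries.subst_X hp,
      MvPowerSeries.subst_X hp]
    simp only [Matrix.cons_val_zero, Matrix.cons_val_one, add_sub_cancel_left]
    exact hy.mul_right _
  rw [hfs F.hasSubst_toPowerSeries, hfs hX0] at hlaw
  -- Modulo `y²`, only the odd part `x b(x²)` can change, by `(F - x) b(x²) = y U b(x²)`. Thus `y`
  -- divides `U b(x²)`, and as `U` is a unit, `b = 0`.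
  have h1 : (MvPowerSeries.X 1 : MvPowerSeries (Fin 2) k) ^ 2 ∣
      MvPowerSeries.X 1 * (U * b.subst ((MvPowerSeries.X 0 : MvPowerSeries (Fin 2) k) ^ 2)) := by
    have h2 := dvd_sub hlaw (dvd_add (hdiff a) ((hdiff b).mul_left F.toPowerSeries))
    convert h2 using 1
    linear_combination -(b.subst ((MvPowerSeries.X 0 : MvPowerSeries (Fin 2) k) ^ 2)) * hFU
  rw [pow_two] at h1
  have hX1' : (MvPowerSeries.X 1 : MvPowerSeries (Fin 2) k) ≠ 0 :=
    nonZeroDivisors.ne_zero MvPowerSeries.X_mem_nonzeroDivisors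
  have h3 := (mul_dvd_mul_iff_left hX1').mp h1
  have hUu : IsUnit U := by
    rw [MvPowerSeries.isUnit_iff_constantCoeff, hU]
    exact isUnit_one
  rw [hUu.dvd_mul_left, ← hexp hX0, MvPowerSeries.X_dvd_iff] at h3
  ext n
  have h4 := h3 (Finsupp.single 0 (2 * n)) (by simp)
  classical
  rw [PowerSeries.coeff_subst_single] at h4
  simpa using h4

/-- Write the series as `a(x²)`. The endomorphism identity for it is the one for `a` with `x², y²`
in place of `x, y`, because `F(x², y²) = F(x, y)²`; and substituting squares for the variables is
injective. -/
theorem exists_eq_mul_frobenius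
    (hF : F.toPowerSeries.map (_root_.frobenius k 2) = F.toPowerSeries) (f : F.Endo)
    (hf : PowerSeries.coeff 1 f.toSeries = 0) : ∃ g : F.Endo, f = g * frobenius hF := by
  obtain ⟨a, ha⟩ := f.exists_toSeries_eq_expand hf
  have ha0 : PowerSeries.constantCoeff a = 0 := by
    have := f.constantCoeff_eq_zero
    rwa [ha, PowerSeries.constantCoeff_expand] at this
  have hX (i : Fin 2) : PowerSeries.HasSubst (MvPowerSeries.X i : MvPowerSeries (Fin 2) k) :=
    PowerSeries.HasSubst.X i
  have haX (i : Fin 2) : PowerSeries.HasSubst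
      (a.subst (MvPowerSeries.X i : MvPowerSeries (Fin 2) k)) :=
    PowerSeries.HasSubst.of_constantCoeff_zero
      (PowerSeries.constantCoeff_subst_eq_zero (by simp) _ ha0)
  have hexp {u : MvPowerSeries (Fin 2) k} (hu : PowerSeries.HasSubst u) :
      f.toSeries.subst u = a.subst (u ^ 2) := by
    rw [ha, PowerSeries.expand_apply, PowerSeries.subst_comp_subst_apply
      (PowerSeries.HasSubst.X_pow two_ne_zero) hu, PowerSeries.subst_pow hu,
      PowerSeries.subst_X hu]
  have hX2 : MvPowerSeries.HasSubst
      ![(MvPowerSeries.X 0 : MvPowerSeries (Fin 2) k) ^ 2, MvPowerSeries.X 1 ^ 2] :=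
    hasSubst_pair (PowerSeries.HasSubst.of_constantCoeff_zero (by simp))
      (PowerSeries.HasSubst.of_constantCoeff_zero (by simp))
  have hXX : (![MvPowerSeries.X 0, MvPowerSeries.X 1] : Fin 2 → MvPowerSeries (Fin 2) k) =
      MvPowerSeries.X := by
    funext s; fin_cases s <;> rfl
  refine ⟨⟨a, ha0, MvPowerSeries.expand_injective two_ne_zero ?_⟩, Endo.ext ?_⟩
  · rw [MvPowerSeries.expand_eq_subst, MvPowerSeries.expand_eq_subst,
      F.subst_law_subst (haX 0) (haX 1) hX2, PowerSeries.subst_subst_X hX2,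
      PowerSeries.subst_subst_X hX2, PowerSeries.subst, MvPowerSeries.subst_comp_subst_apply
        F.hasSubst_toPowerSeries.const hX2, MvPowerSeries.subst_pair_sq hF (hX 0) (hX 1), hXX,
      MvPowerSeries.subst_self, id]
    have := f.map_law
    rw [hexp F.hasSubst_toPowerSeries, hexp (hX 0), hexp (hX 1)] at this
    exact this
  · rw [mul_frobenius_toSeries]
    exact ha

theorem exists_eq_mul_frobenius_pow
    (hF : F.toPowerSeries.map (_root_.frobenius k 2) = F.toPowerSeries) (n : ℕ) (f : F.Endo)
    (hf : PowerSeries.X ^ 2 ^ n ∣ f.toSeries) : ∃ g : F.Endo, f = g * frobenius hF ^ n := by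
  induction n generalizing f with
  | zero => exact ⟨f, by simp⟩
  | succ n ih =>
    obtain ⟨g, rfl⟩ := exists_eq_mul_frobenius hF f
      (PowerSeries.X_pow_dvd_iff.mp hf 1 (Nat.one_lt_two_pow (by omega)))
    obtain ⟨h, rfl⟩ := ih g (by
      rw [PowerSeries.X_pow_dvd_iff] at hf ⊢
      intro m hm
      have := hf (2 * m) (by rw [pow_succ']; omega)
      rwa [mul_frobenius_toSeries, PowerSeries.coeff_expand_mul] at this)
    exact ⟨h, by rw [pow_succ, mul_assoc]⟩

/-- Multiples of the `n`-th power of Frobenius are exactly the endomorphisms divisible by `x^(2^n)`,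
so the filtration is the one by degree and limits of series provide completeness. -/
theorem isUniformizedBy [F.IsComm]
    (hF : F.toPowerSeries.map (_root_.frobenius k 2) = F.toPowerSeries) (m : F.Endo)
    (hm : m + 1 = 0) :
    letI := ring m hm
    IsUniformizedBy (linearCoeff (F := F)) (frobenius hF) := by
  let := ring m hm
  refine ⟨?_, ?_, ?_, ?_, ?_⟩
  · change PowerSeries.coeff 1 (PowerSeries.X ^ 2 : PowerSeries k) = 0
    rw [PowerSeries.coeff_X_pow, if_neg (by norm_num)]
  · exact fun f hf => exists_eq_mul_frobenius hF f hf
  · intro f hf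
    have h1 := mul_frobenius_toSeries hF f
    refine Endo.ext (PowerSeries.ext fun n => ?_)
    rw [← PowerSeries.coeff_expand_mul 2 two_ne_zero, ← h1, hf]
    simp [zero_toSeries]
  · intro f hf
    refine Endo.ext (PowerSeries.ext fun n => ?_)
    obtain ⟨c, hc⟩ := hf n
    have h1 := mul_frobenius_pow_toSeries hF c (2 * n)
    rw [← hc] at h1
    rw [PowerSeries.X_pow_dvd_iff.mp h1 n
      (n.lt_two_pow_self.trans_le (Nat.pow_le_pow_right (by norm_num) (by omega)))]
    simp [zero_toSeries]
  · intro f hf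
    obtain ⟨l, hl⟩ := exists_limit f (N := fun n => 2 ^ (2 * n))
      (fun n => n.lt_two_pow_self.trans_le (Nat.pow_le_pow_right (by norm_num) (by omega)))
      (fun i j hij => Nat.pow_le_pow_right (by norm_num) (by omega)) fun n => by
        obtain ⟨c, hc⟩ := hf n
        rw [sub_eq_iff_eq_add'] at hc
        rw [hc, PowerSeries.X_pow_dvd_iff_mem_degIdeal]
        exact add_toSeries_sub_mem _ _
          (PowerSeries.X_pow_dvd_iff_mem_degIdeal.mp (mul_frobenius_pow_toSeries hF c (2 * n)))
    refine ⟨l, fun n => exists_eq_mul_frobenius_pow hF _ _ ?_⟩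
    -- `F(l, -f n)` and `F(f n, -f n) = 0` agree to the degree to which `l` and `f n` do, so
    -- congruent series have a small difference for the group law.
    have h1 := F.subst_pair_sub_subst_pair_mem l.hasSubst (m * f n).hasSubst (f n).hasSubst
      (m * f n).hasSubst (PowerSeries.X_pow_dvd_iff_mem_degIdeal.mp (hl n)) (by simp)
    have h2 : (f n + -f n).toSeries = 0 := by rw [add_neg_cancel]; rfl
    change _ - (f n + -f n).toSeries ∈ _ at h1
    rw [h2, sub_zero, ← PowerSeries.X_pow_dvd_iff_mem_degIdeal] at h1
    rw [sub_eq_add_neg]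
    exact h1

end CharTwo

end Endo

end FormalGroup

end

noncomputable section

/-! ### Multiplication by a cube root of unity and the structure of the endomorphism ring -/

namespace FormalGroup

namespace Endo

section Scale

variable {R : Type*} [CommRing R] {F : FormalGroup R}

theorem C_mul_X_subst {τ : Type*} {u : MvPowerSeries τ R} (hu : PowerSeries.HasSubst u) (c : R) :
    (PowerSeries.C c * PowerSeries.X).subst u = MvPowerSeries.C c * u := by
  rw [PowerSeries.subst_mul hu, PowerSeries.subst_X hu]
  congr 1
  exact PowerSeries.subst_C c

/-- Multiplication by a constant `c` with `F(cx, cy) = c F(x, y)`. -/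
def scale {c : R} (h : F.toPowerSeries.rescale (fun _ => c) = MvPowerSeries.C c * F.toPowerSeries) :
    F.Endo where
  toSeries := PowerSeries.C c * PowerSeries.X
  constantCoeff_eq_zero := by simp
  map_law := by
    rw [C_mul_X_subst F.hasSubst_toPowerSeries, C_mul_X_subst (PowerSeries.HasSubst.X 0),
      C_mul_X_subst (PowerSeries.HasSubst.X 1), ← h, MvPowerSeries.rescale_eq_subst]
    congr 1
    funext s
    fin_cases s <;> simp [MvPowerSeries.smul_eq_C_mul]

theorem mul_toSeries_of_eq {f g : F.Endo} {c : R}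
    (hf : f.toSeries = PowerSeries.C c * PowerSeries.X) :
    (f * g).toSeries = PowerSeries.C c * g.toSeries := by
  rw [mul_toSeries, hf]
  exact C_mul_X_subst g.hasSubst c

/-- A series with invertible linear coefficient can be cancelled on the left. This replaces the
absence of zero divisors when the factor `z - 1` is removed from `z³ - 1`. -/
theorem eq_zero_of_mul_eq_zero [F.IsComm] {f g : F.Endo} (hf : IsUnit (linearCoeff f))
    (h : f * g = 0) : g = 0 := by
  refine Endo.ext (PowerSeries.subst_inj_of_coeff_one hf g.constantCoeff_eq_zero
    (MvPowerSeries.constantCoeff_zero) ?_)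
  have h1 := congrArg Endo.toSeries h
  rw [mul_toSeries] at h1
  rw [h1, zero_toSeries, PowerSeries.subst_zero_of_constantCoeff_zero f.constantCoeff_eq_zero]

end Scale

variable {F : FormalGroup F4}

/-- The endomorphism ring of a formal group law over the field with four elements with Frobenius
invariant coefficients, with multiplication by a cube root of unity, and with `T² = ±2`. -/
theorem exists_ringEquiv_twistedWitt {ζ : F4} (hζ : IsPrimitiveRoot ζ 3) [F.IsComm]
    (hF : F.toPowerSeries.map (_root_.frobenius F4 2) = F.toPowerSeries) (m : F.Endo)
    (hm : m + 1 = 0) (z : F.Endo) (hz : z.toSeries = PowerSeries.C ζ * PowerSeries.X) {t : ℤ}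
    (ht : t = 2 ∧ frobenius hF * frobenius hF = 1 + 1 ∨
      t = -2 ∧ frobenius hF * frobenius hF + (1 + 1) = 0) :
    ∃ Φ : TwistedWitt t ≃+* F.Endo,
      (Φ (TwistedWitt.gen t)).toSeries = PowerSeries.X ^ 2 ∧
      ∀ c : F4, (Φ (TwistedWitt.of t (WittVector.teichmuller 2 c))).toSeries =
        PowerSeries.C c * PowerSeries.X := by
  let := ring m hm
  have h2 : (2 : F4) = 0 := CharTwo.two_eq_zero
  have ht0 : (t : F4) = 0 := by rcases ht with ⟨rfl, -⟩ | ⟨rfl, -⟩ <;> simp [h2]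
  have ht2 : t = 2 ∨ t = -2 := ht.imp And.left And.left
  have hT : frobenius hF * frobenius hF = (t : F.Endo) := by
    rcases ht with ⟨rfl, h⟩ | ⟨rfl, h⟩
    · rw [h]; norm_num
    · rw [eq_neg_of_add_eq_zero_left h]; norm_num
  have hχz : linearCoeff z = ζ := by
    change PowerSeries.coeff 1 z.toSeries = ζ
    rw [hz, PowerSeries.coeff_C_mul, PowerSeries.coeff_one_X, mul_one]
  have hzz : (z * z).toSeries = PowerSeries.C (ζ ^ 2) * PowerSeries.X := by
    rw [mul_toSeries_of_eq hz, hz, ← mul_assoc, ← map_mul, pow_two]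
  have hz3 : z * (z * z) = 1 := Endo.ext <| by
    rw [mul_toSeries_of_eq hz, hzz, ← mul_assoc, ← map_mul, ← pow_succ', hζ.pow_eq_one, map_one,
      one_mul, one_toSeries]
  have hz2 : z * z = -1 - z := by
    have h1 : (z - 1) * (z * z + z + 1) = 0 := by
      have : (z - 1) * (z * z + z + 1) = z * (z * z) - 1 := by noncomm_ring
      rw [this, hz3, sub_self]
    have h3 : z * z + z + 1 = 0 := eq_zero_of_mul_eq_zero (by
      rw [isUnit_iff_ne_zero, map_sub, hχz, map_one]
      exact sub_ne_zero.mpr (hζ.ne_one (by norm_num))) h1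
    rw [add_assoc] at h3
    rw [eq_neg_of_add_eq_zero_left h3]
    abel
  have hTz : frobenius hF * z = (-1 - z) * frobenius hF := by
    rw [← hz2]
    refine Endo.ext ?_
    rw [mul_toSeries_of_eq hzz, mul_toSeries, hz]
    have hs : PowerSeries.HasSubst (PowerSeries.C ζ * PowerSeries.X : PowerSeries F4) :=
      PowerSeries.HasSubst.of_constantCoeff_zero' (by simp)
    change PowerSeries.subst _ (PowerSeries.X ^ 2) = PowerSeries.C (ζ ^ 2) * PowerSeries.X ^ 2
    rw [PowerSeries.subst_pow hs, PowerSeries.subst_X hs, mul_pow, map_pow]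
  have hw2 : TwistedWitt.of t (WittVector.teichmuller 2 ζ)
      * TwistedWitt.of t (WittVector.teichmuller 2 ζ)
        = -1 - TwistedWitt.of t (WittVector.teichmuller 2 ζ) := by
    rw [← map_mul, W4.teichmuller_sq hζ, map_sub, map_neg, map_one]
  have hTw : TwistedWitt.gen t * TwistedWitt.of t (WittVector.teichmuller 2 ζ)
      = (-1 - TwistedWitt.of t (WittVector.teichmuller 2 ζ)) * TwistedWitt.gen t := by
    have h1 : (-1 - TwistedWitt.of t (WittVector.teichmuller 2 ζ)) =
        TwistedWitt.of t (frob (WittVector.teichmuller 2 ζ)) := by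
      rw [W4.frob_teichmuller, pow_two, map_mul, map_mul, hw2]
    rw [h1, TwistedWitt.of_mul_gen, frob_frob]
  have hχw : TwistedWitt.residue ht0 (TwistedWitt.of t (WittVector.teichmuller 2 ζ)) = ζ :=
    WittVector.teichmuller_coeff_zero 2 ζ
  set w := TwistedWitt.of t (WittVector.teichmuller 2 ζ) with hw
  -- The common dense subring: the order generated in the product by the pair of cube roots of unity
  -- and the pair of uniformizers.
  let A := quaternionOrder (D := TwistedWitt t × F.Endo) (w, z)
    (TwistedWitt.gen t, frobenius hF) t (Prod.ext hw2 hz2) (Prod.ext hTw hTz)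
    (Prod.ext TwistedWitt.gen_mul_gen hT)
  have hB := TwistedWitt.isUniformizedBy ht0 ht2
  have hC := isUniformizedBy hF m hm
  have hχ1 (i j k l : ℤ) : TwistedWitt.residue ht0 ((i : TwistedWitt t) + j * w
      + (k + l * w) * TwistedWitt.gen t) = i + j * ζ := by
    rw [map_add, map_mul _ _ (TwistedWitt.gen t), hB.map_eq_zero, mul_zero, _root_.add_zero, map_add,
      map_mul, map_intCast, map_intCast, hχw]
  have hχ2 (i j k l : ℤ) : linearCoeff ((i : F.Endo) + (j : F.Endo) * z
      + ((k : F.Endo) + (l : F.Endo) * z) * frobenius hF) = i + j * ζ := by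
    have hc (n : ℤ) : linearCoeff (F := F) (n : F.Endo) = n := map_intCast linearCoeff n
    rw [map_add, map_mul _ _ (frobenius hF), hC.map_eq_zero, mul_zero, _root_.add_zero, map_add,
      map_mul, hc, hc, hχz]
  have hωA : (w, z) ∈ A := ⟨0, 1, 0, 0, by simp⟩
  have hτA : (TwistedWitt.gen t, frobenius hF) ∈ A := ⟨0, 0, 1, 0, by simp⟩
  obtain ⟨e, he⟩ := IsUniformizedBy.exists_ringEquiv hB hC A hτA
    (by
      rintro _ ⟨i, j, k, l, rfl⟩
      exact (hχ1 i j k l).trans (hχ2 i j k l).symm)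
    (fun c => by
      rcases F4.eq_cases hζ c with rfl | rfl | rfl | rfl
      · exact ⟨0, A.zero_mem, map_zero _⟩
      · exact ⟨1, A.one_mem, map_one _⟩
      · exact ⟨_, hωA, hχw⟩
      · exact ⟨_, A.pow_mem hωA 2, by rw [Prod.pow_fst, map_pow, hχw]⟩)
    (by
      rintro _ ⟨i, j, k, l, rfl⟩ h
      have h' : (i : F4) + j * ζ = 0 := (hχ1 i j k l).symm.trans h
      obtain ⟨⟨i, rfl⟩, ⟨j, rfl⟩⟩ := F4.even_of_add_mul_eq_zero hζ h'
      -- Since `2 = ετ²` with `ε = ±1`, an element of the order with even `i, j` is a multiple of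
      -- `τ` inside the order.
      obtain ⟨ε, hε⟩ : ∃ ε : ℤ, 2 = ε * t := by
        rcases ht2 with rfl | rfl
        · exact ⟨1, by norm_num⟩
        · exact ⟨-1, by norm_num⟩
      have key {D : Type} [Ring D] (w τ : D) (hτ : τ * τ = (t : D)) :
          ((i + i : ℤ) : D) + ((j + j : ℤ) : D) * w + (k + l * w) * τ =
            (k + l * w + (((ε * i : ℤ) : D) + ((ε * j : ℤ) : D) * w) * τ) * τ := by
        have h1 : (k + l * w + (((ε * i : ℤ) : D) + ((ε * j : ℤ) : D) * w) * τ) * τ =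
            (((ε * i : ℤ) : D) + ((ε * j : ℤ) : D) * w) * (τ * τ) + (k + l * w) * τ := by
          noncomm_ring
        rw [h1, hτ, ← Int.cast_comm]
        congr 1
        rw [mul_add, ← mul_assoc, ← Int.cast_mul, ← Int.cast_mul]
        congr 3
        · linear_combination i * hε
        · linear_combination j * hε
      exact ⟨_, ⟨k, l, ε * i, ε * j, rfl⟩, key _ _ (Prod.ext TwistedWitt.gen_mul_gen hT)⟩)
  refine ⟨e, ?_, fun c => ?_⟩
  · exact congrArg Endo.toSeries (he _ hτA)
  · rcases F4.eq_cases hζ c with rfl | rfl | rfl | rfl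
    · rw [WittVector.teichmuller_zero, map_zero (TwistedWitt.of t), map_zero PowerSeries.C, zero_mul]
      exact congrArg Endo.toSeries (map_zero e)
    · rw [map_one (WittVector.teichmuller 2), map_one (TwistedWitt.of t), map_one PowerSeries.C,
        one_mul]
      exact congrArg Endo.toSeries (map_one e)
    · exact (congrArg Endo.toSeries (he _ hωA)).trans hz
    · rw [pow_two, map_mul (WittVector.teichmuller 2), map_mul (TwistedWitt.of t), ← pow_two ζ]
      exact (congrArg Endo.toSeries (he _ (A.mul_mem hωA hωA))).trans hzz

end Endo

end FormalGroup

end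

noncomputable section

/-! ### The Honda formal group law -/

/-! ### Integral power series and congruences modulo 2 -/

namespace MvPowerSeries

variable {σ τ : Type*}

theorem map_injective {R S : Type*} [CommRing R] [CommRing S] {f : R →+* S}
    (hf : Function.Injective f) :
    Function.Injective (map f : MvPowerSeries σ R → MvPowerSeries σ S) := fun u v h => by
  ext d
  refine hf ?_
  rw [← coeff_map, ← coeff_map, h]

theorem exists_coeff_eq {R : Type*} [CommRing R] (c : (σ →₀ ℕ) → R) :
    ∃ f : MvPowerSeries σ R, ∀ d, coeff d f = c d :=
  ⟨c, fun _ => rfl⟩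

/-- An integral power series, viewed over the rationals. -/
abbrev toRat : MvPowerSeries σ ℤ →+* MvPowerSeries σ ℚ := map (Int.castRingHom ℚ)

theorem toRat_injective : Function.Injective (toRat : MvPowerSeries σ ℤ → MvPowerSeries σ ℚ) :=
  map_injective Int.cast_injective

theorem toRat_mem_degIdeal_iff {u : MvPowerSeries σ ℤ} {n : ℕ} :
    toRat u ∈ degIdeal σ ℚ n ↔ u ∈ degIdeal σ ℤ n := by
  simp [mem_degIdeal_iff]

theorem constantCoeff_toRat {u : MvPowerSeries σ ℤ} (hu : constantCoeff u = 0) :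
    constantCoeff (toRat u) = 0 := by
  rw [toRat, constantCoeff_map, hu, map_zero]

theorem two_dvd_iff_coeff {u : MvPowerSeries σ ℤ} : 2 ∣ u ↔ ∀ d, 2 ∣ coeff d u := by
  have h2 : (2 : MvPowerSeries σ ℤ) = C 2 := (map_ofNat C 2).symm
  constructor
  · rintro ⟨v, rfl⟩ d
    rw [h2, coeff_C_mul]
    exact dvd_mul_right _ _
  · intro h
    choose v hv using h
    obtain ⟨f, hf⟩ := exists_coeff_eq v
    refine ⟨f, ?_⟩
    ext d
    rw [h2, coeff_C_mul, hv, hf]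

/-- Over the field with two elements Frobenius fixes the coefficients, so raising a series to the
fourth power raises its variables to the fourth power. -/
theorem two_dvd_expand_sub (u : MvPowerSeries σ ℤ) :
    2 ∣ expand 4 (by norm_num) u - u ^ 4 := by
  have h : map (Int.castRingHom (ZMod 2)) (expand 4 (by norm_num) u - u ^ 4) = 0 := by
    rw [map_sub, map_pow, map_expand, sub_eq_zero]
    have h1 := map_iterateFrobenius_expand 2 two_ne_zero (map (Int.castRingHom (ZMod 2)) u) 2
    have h2 : iterateFrobenius (ZMod 2) 2 2 = RingHom.id _ := Subsingleton.elim _ _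
    rw [h2, map_id] at h1
    exact h1
  rw [two_dvd_iff_coeff]
  intro d
  have h1 := congrArg (coeff d) h
  rw [coeff_map, map_zero] at h1
  exact (ZMod.intCast_zmod_eq_zero_iff_dvd _ 2).mp h1

end MvPowerSeries

/-! ### The functional equation of the logarithm and integrality -/

namespace HondaLog

open MvPowerSeries (degIdeal toRat)

variable {σ τ : Type*}

theorem coeff_four_pow (k : ℕ) : PowerSeries.coeff (4 ^ k) hondaLog = (1 / 2 : ℚ) ^ k := by
  rw [hondaLog, PowerSeries.coeff_mk, Finset.sum_eq_single k]
  · simp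
  · intro j _ hj
    rw [if_neg]
    intro h
    exact hj (Nat.pow_right_injective (by norm_num) h).symm
  · intro h
    exact absurd (Finset.mem_range.mpr ((Nat.lt_pow_self (by norm_num)).trans (Nat.lt_succ_self _))) h

theorem coeff_eq_zero {n : ℕ} (h : ∀ k, n ≠ 4 ^ k) : PowerSeries.coeff n hondaLog = 0 := by
  rw [hondaLog, PowerSeries.coeff_mk]
  exact Finset.sum_eq_zero fun k _ => if_neg (h k)

theorem coeff_one : PowerSeries.coeff 1 hondaLog = 1 := by
  simpa using coeff_four_pow 0

theorem isUnit_coeff_one : IsUnit (PowerSeries.coeff 1 hondaLog) := by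
  rw [coeff_one]
  exact isUnit_one

theorem constantCoeff_eq_zero : PowerSeries.constantCoeff hondaLog = 0 := by
  rw [← PowerSeries.coeff_zero_eq_constantCoeff_apply]
  exact coeff_eq_zero fun k => (pow_pos (by norm_num) k).ne

theorem functional_equation :
    hondaLog = PowerSeries.X + PowerSeries.C (1 / 2) * PowerSeries.expand 4 (by norm_num) hondaLog := by
  ext n
  rw [map_add, PowerSeries.coeff_C_mul, PowerSeries.coeff_expand, PowerSeries.coeff_X]
  by_cases h : ∃ k, n = 4 ^ k
  · obtain ⟨k, rfl⟩ := h
    rcases k with _ | k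
    · simp [coeff_one]
    · rw [coeff_four_pow, if_neg, if_pos (dvd_pow_self _ (by omega)), pow_succ 4,
        Nat.mul_div_cancel _ (by norm_num), coeff_four_pow, pow_succ, zero_add, mul_comm]
      exact (Nat.one_lt_pow (by omega) (by norm_num)).ne'
  · push Not at h
    rw [coeff_eq_zero h, if_neg (by simpa using h 0)]
    split_ifs with h4
    · rw [coeff_eq_zero fun k hk => h (k + 1) ?_]
      · simp
      · rw [pow_succ, ← hk, Nat.div_mul_cancel h4]
    · simp

theorem subst_eq {u : MvPowerSeries σ ℚ} (hu : MvPowerSeries.constantCoeff u = 0) :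
    hondaLog.subst u = u + MvPowerSeries.C (1 / 2) * hondaLog.subst (u ^ 4) := by
  have hu' := PowerSeries.HasSubst.of_constantCoeff_zero hu
  nth_rw 1 [functional_equation]
  rw [PowerSeries.subst_add hu', PowerSeries.subst_mul hu', PowerSeries.subst_X hu',
    PowerSeries.expand_apply, PowerSeries.subst_comp_subst_apply
      (PowerSeries.HasSubst.X_pow (by norm_num)) hu', PowerSeries.subst_pow hu',
    PowerSeries.subst_X hu']
  congr 2
  exact PowerSeries.subst_C _

theorem subst_inj {u v : MvPowerSeries σ ℚ} (hu : MvPowerSeries.constantCoeff u = 0)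
    (hv : MvPowerSeries.constantCoeff v = 0) (h : hondaLog.subst u = hondaLog.subst v) : u = v :=
  PowerSeries.subst_inj_of_coeff_one isUnit_coeff_one hu hv h

/-- The Honda logarithm maps congruences modulo `2` to congruences modulo `2`. -/
theorem exists_subst_sub_eq {u v : MvPowerSeries σ ℤ} (hu : MvPowerSeries.constantCoeff u = 0)
    (hv : MvPowerSeries.constantCoeff v = 0) (h : 2 ∣ u - v) :
    ∃ e, hondaLog.subst (toRat u) - hondaLog.subst (toRat v) = toRat (2 * e) := by
  have hu' := PowerSeries.HasSubst.of_constantCoeff_zero (MvPowerSeries.constantCoeff_toRat hu)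
  have hv' := PowerSeries.HasSubst.of_constantCoeff_zero (MvPowerSeries.constantCoeff_toRat hv)
  have key (d : σ →₀ ℕ) : ∃ z : ℤ, MvPowerSeries.coeff d
      (hondaLog.subst (toRat u) - hondaLog.subst (toRat v)) = ((2 * z : ℤ) : ℚ) := by
    rw [map_sub, PowerSeries.coeff_subst hu', PowerSeries.coeff_subst hv',
      ← finsum_sub_distrib (PowerSeries.coeff_subst_finite hu' _ _)
        (PowerSeries.coeff_subst_finite hv' _ _)]
    refine finsum_induction (fun q : ℚ => ∃ z : ℤ, q = ((2 * z : ℤ) : ℚ)) ⟨0, by simp⟩ ?_ ?_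
    · rintro _ _ ⟨a, rfl⟩ ⟨b, rfl⟩
      exact ⟨a + b, by push_cast; ring⟩
    · intro n
      rw [← smul_sub, ← map_sub, ← map_pow, ← map_pow, ← map_sub, MvPowerSeries.coeff_map]
      by_cases hn : ∃ k, n = 4 ^ k
      · obtain ⟨k, rfl⟩ := hn
        -- From `u ≡ v` modulo 2 follows `u^(4^k) ≡ v^(4^k)` modulo `2^(2k+1)`; the denominator
        -- `2^k` leaves the even factor `2^(k+1)`.
        have h1 := dvd_sub_pow_of_dvd_sub (p := 2) (by exact_mod_cast h) (2 * k)
        rw [pow_mul 2 2 k, show 2 ^ 2 = 4 by norm_num] at h1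
        obtain ⟨c, hc⟩ := h1
        have h2 : ((2 : ℕ) : MvPowerSeries σ ℤ) ^ (2 * k + 1) = MvPowerSeries.C (2 ^ (2 * k + 1)) := by
          simp
        rw [hc, h2, MvPowerSeries.coeff_C_mul, coeff_four_pow]
        refine ⟨2 ^ k * MvPowerSeries.coeff d c, ?_⟩
        simp only [eq_intCast, smul_eq_mul]
        push_cast
        rw [pow_add, mul_comm 2 k, pow_mul, one_div, inv_pow]
        have : (2 : ℚ) ^ k ≠ 0 := by positivity
        field_simp
      · push Not at hn
        exact ⟨0, by rw [coeff_eq_zero hn]; simp⟩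
  choose z hz using key
  obtain ⟨f, hf⟩ := MvPowerSeries.exists_coeff_eq z
  refine ⟨f, ?_⟩
  ext d
  rw [hz, MvPowerSeries.coeff_map, show (2 : MvPowerSeries σ ℤ) = MvPowerSeries.C 2 from
    (map_ofNat MvPowerSeries.C 2).symm, MvPowerSeries.coeff_C_mul, hf]
  rfl

/-- The difference of logarithms is `u - v` times a divided difference with constant term `1`. -/
theorem subst_sub_subst_sub_mem {u v : MvPowerSeries σ ℚ}
    (hu : MvPowerSeries.constantCoeff u = 0) (hv : MvPowerSeries.constantCoeff v = 0) {n : ℕ}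
    (h : u - v ∈ degIdeal σ ℚ n) :
    (hondaLog.subst u - hondaLog.subst v) - (u - v) ∈ degIdeal σ ℚ (n + 1) := by
  rw [← hondaLog.slope_subst_mul (PowerSeries.HasSubst.of_constantCoeff_zero hv)
    (PowerSeries.HasSubst.of_constantCoeff_zero hu)]
  have h1 : hondaLog.slope.subst ![v, u] - 1 ∈ degIdeal σ ℚ 1 := by
    rw [MvPowerSeries.mem_degIdeal_one_iff, map_sub, PowerSeries.constantCoeff_slope_subst _ hv hu,
      coeff_one, map_one, sub_self]
  have := MvPowerSeries.mul_mem_degIdeal h h1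
  convert this using 1
  ring

/-- The Honda logarithm reflects congruences modulo `2`. -/
theorem two_dvd_sub {u v : MvPowerSeries σ ℤ} (hu : MvPowerSeries.constantCoeff u = 0)
    (hv : MvPowerSeries.constantCoeff v = 0) {e : MvPowerSeries σ ℤ}
    (h : hondaLog.subst (toRat u) - hondaLog.subst (toRat v) = toRat (2 * e)) : 2 ∣ u - v := by
  -- Degree by degree: once `v + 2d` agrees with `u` below degree `n + 1`, the discrepancy in that
  -- degree equals the one of the logarithms, which is even.
  have key (n : ℕ) : ∃ d, u - v - 2 * d ∈ degIdeal σ ℤ (n + 1) := by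
    induction n with
    | zero =>
      refine ⟨0, ?_⟩
      rw [zero_add, MvPowerSeries.mem_degIdeal_one_iff]
      simp [hu, hv]
    | succ n ih =>
      obtain ⟨d, hd⟩ := ih
      have hv' : MvPowerSeries.constantCoeff (v + 2 * d) = 0 := by
        have := MvPowerSeries.mem_degIdeal_one_iff.mp
          (MvPowerSeries.degIdeal_anti (by omega : 1 ≤ n + 1) hd)
        rw [map_sub, map_sub, hu, hv, sub_zero, zero_sub, neg_eq_zero] at this
        rw [map_add, hv, this, add_zero]
      obtain ⟨e', he'⟩ := exists_subst_sub_eq hv' hv ⟨d, by ring⟩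
      have h1 := subst_sub_subst_sub_mem (MvPowerSeries.constantCoeff_toRat hu)
        (MvPowerSeries.constantCoeff_toRat hv') (n := n + 1) (by
          rw [← map_sub, MvPowerSeries.toRat_mem_degIdeal_iff]
          convert hd using 1
          ring)
      have h2 : hondaLog.subst (toRat u) - hondaLog.subst (toRat (v + 2 * d))
          = toRat (2 * e - 2 * e') := by
        rw [map_sub, ← h, ← he']
        ring
      rw [h2, ← map_sub, ← map_sub, MvPowerSeries.toRat_mem_degIdeal_iff] at h1
      refine ⟨d + (e - e'), ?_⟩
      rw [← neg_mem_iff]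
      convert h1 using 1
      ring
  rw [MvPowerSeries.two_dvd_iff_coeff]
  intro d
  obtain ⟨c, hc⟩ := key d.degree
  have := MvPowerSeries.mem_degIdeal_iff.mp hc d (by omega)
  rw [map_sub, sub_eq_zero, show (2 : MvPowerSeries σ ℤ) = MvPowerSeries.C 2 from
    (map_ofNat MvPowerSeries.C 2).symm, MvPowerSeries.coeff_C_mul] at this
  exact ⟨_, this⟩

theorem exists_rational_law : ∃ G : MvPowerSeries (Fin 2) ℚ, MvPowerSeries.constantCoeff G = 0 ∧
    hondaLog.subst G = hondaLog.subst (MvPowerSeries.X 0 : MvPowerSeries (Fin 2) ℚ)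
      + hondaLog.subst (MvPowerSeries.X 1 : MvPowerSeries (Fin 2) ℚ) := by
  have : Invertible (PowerSeries.coeff 1 hondaLog) := coeff_one ▸ invertibleOne
  set s := hondaLog.subst (MvPowerSeries.X 0 : MvPowerSeries (Fin 2) ℚ)
      + hondaLog.subst (MvPowerSeries.X 1 : MvPowerSeries (Fin 2) ℚ) with hs
  have hs0 : MvPowerSeries.constantCoeff s = 0 := by
    rw [hs, map_add, PowerSeries.constantCoeff_subst_eq_zero (by simp) _ constantCoeff_eq_zero,
      PowerSeries.constantCoeff_subst_eq_zero (by simp) _ constantCoeff_eq_zero, add_zero]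
  have hs' := PowerSeries.HasSubst.of_constantCoeff_zero hs0
  refine ⟨hondaLog.substInv.subst s, PowerSeries.constantCoeff_subst_eq_zero hs0 _
    (PowerSeries.constantCoeff_substInv _), ?_⟩
  rw [← PowerSeries.subst_comp_subst_apply (PowerSeries.HasSubst.substInv _) hs',
    PowerSeries.subst_substInv_right _ constantCoeff_eq_zero, PowerSeries.subst_X hs']

/-- Hazewinkel's functional equation argument: the rational law satisfies a fixed-point equation
whose right side is integral on integral series and gains a degree of precision. -/
theorem exists_integral_law : ∃ G : MvPowerSeries (Fin 2) ℤ, MvPowerSeries.constantCoeff G = 0 ∧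
    hondaLog.subst (toRat G) = hondaLog.subst (MvPowerSeries.X 0 : MvPowerSeries (Fin 2) ℚ)
      + hondaLog.subst (MvPowerSeries.X 1 : MvPowerSeries (Fin 2) ℚ) := by
  obtain ⟨G, hG0, hG⟩ := exists_rational_law
  have hX4 : MvPowerSeries.HasSubst
      ![(MvPowerSeries.X 0 : MvPowerSeries (Fin 2) ℚ) ^ 4, MvPowerSeries.X 1 ^ 4] :=
    FormalGroup.hasSubst_pair (PowerSeries.HasSubst.of_constantCoeff_zero (by simp))
      (PowerSeries.HasSubst.of_constantCoeff_zero (by simp))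
  have h4 : (4 : ℕ) ≠ 0 := by norm_num
  have hG4 : hondaLog.subst (MvPowerSeries.expand 4 h4 G) =
      hondaLog.subst ((MvPowerSeries.X 0 : MvPowerSeries (Fin 2) ℚ) ^ 4)
        + hondaLog.subst ((MvPowerSeries.X 1 : MvPowerSeries (Fin 2) ℚ) ^ 4) := by
    have := congrArg (MvPowerSeries.subst
      ![(MvPowerSeries.X 0 : MvPowerSeries (Fin 2) ℚ) ^ 4, MvPowerSeries.X 1 ^ 4]) hG
    rw [MvPowerSeries.subst_add hX4, PowerSeries.subst_subst_X hX4, PowerSeries.subst_subst_X hX4,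
      PowerSeries.subst, MvPowerSeries.subst_comp_subst_apply
        (PowerSeries.HasSubst.of_constantCoeff_zero hG0).const hX4,
      ← MvPowerSeries.expand_eq_subst h4] at this
    exact this
  -- The functional equation applied to `G`, `x` and `y`; the sum `ℓ(x⁴) + ℓ(y⁴)` is `ℓ(G(x⁴, y⁴))`.
  have heq : G = MvPowerSeries.X 0 + MvPowerSeries.X 1 + MvPowerSeries.C (1 / 2) *
      (hondaLog.subst (MvPowerSeries.expand 4 h4 G) - hondaLog.subst (G ^ 4)) := by
    have h1 := hG
    rw [subst_eq hG0, subst_eq (MvPowerSeries.constantCoeff_X 0),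
      subst_eq (MvPowerSeries.constantCoeff_X 1)] at h1
    rw [hG4]
    linear_combination h1
  have key (n : ℕ) : ∃ P, G - toRat P ∈ degIdeal (Fin 2) ℚ (n + 1) := by
    induction n with
    | zero =>
      refine ⟨0, ?_⟩
      rw [zero_add, MvPowerSeries.mem_degIdeal_one_iff]
      simpa using hG0
    | succ n ih =>
      obtain ⟨P, hP⟩ := ih
      have hP0 : MvPowerSeries.constantCoeff P = 0 := by
        have := MvPowerSeries.mem_degIdeal_one_iff.mp
          (MvPowerSeries.degIdeal_anti (by omega : 1 ≤ n + 1) hP)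
        rw [map_sub, hG0, zero_sub, neg_eq_zero] at this
        simpa using this
      have hE0 : MvPowerSeries.constantCoeff (MvPowerSeries.expand 4 h4 P) = 0 := by
        rw [MvPowerSeries.constantCoeff_expand, hP0]
      have hP40 : MvPowerSeries.constantCoeff (P ^ 4) = 0 := by simp [hP0]
      have hGE0 : MvPowerSeries.constantCoeff (MvPowerSeries.expand 4 h4 G) = 0 := by
        rw [MvPowerSeries.constantCoeff_expand, hG0]
      have hG40 : MvPowerSeries.constantCoeff (G ^ 4) = 0 := by simp [hG0]
      -- `P(x⁴, y⁴)` and `P⁴` are congruent modulo 2, so their logarithms differ by `2e` and half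
      -- the difference is integral.
      obtain ⟨e, he⟩ := exists_subst_sub_eq hE0 hP40 (MvPowerSeries.two_dvd_expand_sub P)
      have hcong {u v : MvPowerSeries (Fin 2) ℚ} (hu : MvPowerSeries.constantCoeff u = 0)
          (hv : MvPowerSeries.constantCoeff v = 0) (h : u - v ∈ degIdeal (Fin 2) ℚ (n + 1 + 1)) :
          hondaLog.subst u - hondaLog.subst v ∈ degIdeal (Fin 2) ℚ (n + 1 + 1) :=
        MvPowerSeries.subst_sub_subst_mem (PowerSeries.HasSubst.of_constantCoeff_zero hu).const
          (PowerSeries.HasSubst.of_constantCoeff_zero hv).const (fun _ => h) _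
      have h1 := hcong hGE0 (MvPowerSeries.constantCoeff_toRat hE0) (by
        have : MvPowerSeries.expand 4 h4 (G - toRat P) ∈ degIdeal (Fin 2) ℚ (4 * (n + 1)) := by
          rw [MvPowerSeries.expand_eq_subst]
          refine MvPowerSeries.subst_mem_degIdeal hX4 (fun s => ?_) hP
          have hX (i : Fin 2) : (MvPowerSeries.X i : MvPowerSeries (Fin 2) ℚ) ^ 4
              ∈ degIdeal (Fin 2) ℚ 4 := by
            refine MvPowerSeries.mem_degIdeal_iff.mpr fun d hd => ?_
            rw [MvPowerSeries.coeff_X_pow, if_neg]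
            rintro rfl
            simp at hd
          fin_cases s
          · exact hX 0
          · exact hX 1
        rw [map_sub] at this
        rw [toRat, MvPowerSeries.map_expand]
        exact MvPowerSeries.degIdeal_anti (by omega) this)
      -- In `G⁴ - P⁴ = (G - P)(G + P)(G² + P²)` the last two factors have no constant term, so one
      -- degree is gained.
      have h2 := hcong hG40 (MvPowerSeries.constantCoeff_toRat hP40) (by
        rw [map_pow]
        have h3 : (G + toRat P) * (G ^ 2 + toRat P ^ 2) ∈ degIdeal (Fin 2) ℚ 1 := by
          rw [MvPowerSeries.mem_degIdeal_one_iff]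
          simp [hG0, hP0]
        have := MvPowerSeries.mul_mem_degIdeal hP h3
        convert this using 1
        ring)
      refine ⟨MvPowerSeries.X 0 + MvPowerSeries.X 1 + e, ?_⟩
      have h5 : toRat (MvPowerSeries.X 0 + MvPowerSeries.X 1 + e) =
          MvPowerSeries.X 0 + MvPowerSeries.X 1 + MvPowerSeries.C (1 / 2) *
            (hondaLog.subst (toRat (MvPowerSeries.expand 4 h4 P))
              - hondaLog.subst (toRat (P ^ 4))) := by
        rw [he, map_mul, map_ofNat, ← mul_assoc, ← map_ofNat MvPowerSeries.C 2, ← map_mul]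
        norm_num
      rw [h5]
      nth_rw 1 [heq]
      have := Ideal.mul_mem_left _ (MvPowerSeries.C (1 / 2)) (Ideal.sub_mem _ h1 h2)
      convert this using 1
      ring
  choose P hP using key
  -- `P n` is correct up to and including degree `n`, so the coefficient at `d` is read from `P
  -- d.degree`; the approximations need not be compared with each other.
  obtain ⟨Q, hQ⟩ := MvPowerSeries.exists_coeff_eq fun d => MvPowerSeries.coeff d (P d.degree)
  have hG' : toRat Q = G := by
    ext d
    have := MvPowerSeries.mem_degIdeal_iff.mp (hP d.degree) d (by omega)
    rw [map_sub, sub_eq_zero] at this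
    rw [this, MvPowerSeries.coeff_map, MvPowerSeries.coeff_map, hQ]
  refine ⟨Q, ?_, hG'.symm ▸ hG⟩
  have := congrArg MvPowerSeries.constantCoeff hG'
  rw [hG0, toRat, MvPowerSeries.constantCoeff_map] at this
  simpa using this

end HondaLog

end

noncomputable section

/-! ### The integral law seen through its logarithm -/

namespace HondaLog

open MvPowerSeries (degIdeal toRat)

variable {τ : Type*}

section Law

variable {G : MvPowerSeries (Fin 2) ℤ}

theorem constantCoeff_subst_pair (hG0 : MvPowerSeries.constantCoeff G = 0)
    {u v : MvPowerSeries τ ℤ} (hu : MvPowerSeries.constantCoeff u = 0)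
    (hv : MvPowerSeries.constantCoeff v = 0) :
    MvPowerSeries.constantCoeff (G.subst ![u, v]) = 0 :=
  MvPowerSeries.constantCoeff_subst_eq_zero (FormalGroup.hasSubst_pair
    (PowerSeries.HasSubst.of_constantCoeff_zero hu) (PowerSeries.HasSubst.of_constantCoeff_zero hv))
    (fun s => by
      fin_cases s
      · exact hu
      · exact hv) hG0

theorem subst_toRat_subst_pair (hG0 : MvPowerSeries.constantCoeff G = 0)
    (hG : hondaLog.subst (toRat G) = hondaLog.subst (MvPowerSeries.X 0 : MvPowerSeries (Fin 2) ℚ)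
      + hondaLog.subst (MvPowerSeries.X 1 : MvPowerSeries (Fin 2) ℚ))
    {u v : MvPowerSeries τ ℤ} (hu : MvPowerSeries.constantCoeff u = 0)
    (hv : MvPowerSeries.constantCoeff v = 0) :
    hondaLog.subst (toRat (G.subst ![u, v])) =
      hondaLog.subst (toRat u) + hondaLog.subst (toRat v) := by
  have hu' := PowerSeries.HasSubst.of_constantCoeff_zero hu
  have hv' := PowerSeries.HasSubst.of_constantCoeff_zero hv
  have hp := FormalGroup.hasSubst_pair
    (PowerSeries.HasSubst.of_constantCoeff_zero (MvPowerSeries.constantCoeff_toRat hu))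
    (PowerSeries.HasSubst.of_constantCoeff_zero (MvPowerSeries.constantCoeff_toRat hv))
  have h1 : toRat (G.subst ![u, v]) = (toRat G).subst ![toRat u, toRat v] := by
    rw [toRat, MvPowerSeries.map_subst (FormalGroup.hasSubst_pair hu' hv')]
    congr 1
    funext s
    fin_cases s <;> rfl
  have h2 := congrArg (MvPowerSeries.subst ![toRat u, toRat v]) hG
  rw [MvPowerSeries.subst_add hp, PowerSeries.subst_subst_X hp, PowerSeries.subst_subst_X hp,
    PowerSeries.subst, MvPowerSeries.subst_comp_subst_apply
      (PowerSeries.HasSubst.of_constantCoeff_zero (MvPowerSeries.constantCoeff_toRat hG0)).const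
        hp] at h2
  rw [h1]
  exact h2

theorem subst_toRat_inj {u v : MvPowerSeries τ ℤ} (hu : MvPowerSeries.constantCoeff u = 0)
    (hv : MvPowerSeries.constantCoeff v = 0)
    (h : hondaLog.subst (toRat u) = hondaLog.subst (toRat v)) : u = v :=
  MvPowerSeries.toRat_injective (subst_inj (MvPowerSeries.constantCoeff_toRat hu)
    (MvPowerSeries.constantCoeff_toRat hv) h)

/-- The coefficients of the Honda formal group law vanish outside the degrees congruent to `1`
modulo `3`. -/
theorem degree_mod_three (hG0 : MvPowerSeries.constantCoeff G = 0)
    (hG : hondaLog.subst (toRat G) = hondaLog.subst (MvPowerSeries.X 0 : MvPowerSeries (Fin 2) ℚ)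
      + hondaLog.subst (MvPowerSeries.X 1 : MvPowerSeries (Fin 2) ℚ))
    {d : Fin 2 →₀ ℕ} (hd : MvPowerSeries.coeff d G ≠ 0) : d.degree % 3 = 1 := by
  -- Over the complex numbers `ℓ(a x) = a ℓ(x)` for a primitive cube root of unity `a`, because
  -- `4^k` is 1 modulo 3. Hence `G(a x, a y) = a G(x, y)`, and coefficients are compared.
  obtain ⟨a, ha⟩ : ∃ a : ℂ, IsPrimitiveRoot a 3 :=
    ⟨_, Complex.isPrimitiveRoot_exp 3 (by norm_num)⟩
  let f : ℚ →+* ℂ := algebraMap ℚ ℂ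
  let L : PowerSeries ℂ := hondaLog.map f
  let H : MvPowerSeries (Fin 2) ℂ := (toRat G).map f
  have ha4 (k : ℕ) : a ^ 4 ^ k = a := by
    induction k with
    | zero => simp
    | succ k ih => rw [pow_succ, pow_mul, ih, pow_succ, ha.pow_eq_one, one_mul]
  have hL1 : PowerSeries.coeff 1 L = 1 := by
    rw [PowerSeries.coeff_map, coeff_one, map_one]
  have hLa {σ : Type} {u : MvPowerSeries σ ℂ} (hu : MvPowerSeries.constantCoeff u = 0) :
      L.subst (MvPowerSeries.C a * u) = MvPowerSeries.C a * L.subst u := by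
    have hu' := PowerSeries.HasSubst.of_constantCoeff_zero hu
    have h1 : L.subst (a • PowerSeries.X : PowerSeries ℂ) = PowerSeries.C a * L := by
      rw [← PowerSeries.rescale_eq_subst]
      ext n
      rw [PowerSeries.coeff_rescale, PowerSeries.coeff_C_mul, PowerSeries.coeff_map]
      by_cases hn : ∃ k, n = 4 ^ k
      · obtain ⟨k, rfl⟩ := hn
        rw [ha4]
      · push Not at hn
        rw [coeff_eq_zero hn, map_zero, mul_zero, mul_zero]
    have h2 := congrArg (PowerSeries.subst u) h1
    rw [PowerSeries.subst_comp_subst_apply (PowerSeries.HasSubst.smul_X' a) hu',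
      PowerSeries.subst_smul hu', PowerSeries.subst_X hu', PowerSeries.subst_mul hu'] at h2
    rw [← MvPowerSeries.smul_eq_C_mul, h2]
    congr 1
    exact PowerSeries.subst_C a
  have hH0 : MvPowerSeries.constantCoeff H = 0 := by
    rw [MvPowerSeries.constantCoeff_map, MvPowerSeries.constantCoeff_toRat hG0, map_zero]
  have hH : L.subst H = L.subst (MvPowerSeries.X 0 : MvPowerSeries (Fin 2) ℂ)
      + L.subst (MvPowerSeries.X 1 : MvPowerSeries (Fin 2) ℂ) := by
    have := congrArg (MvPowerSeries.map f) hG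
    rw [map_add, PowerSeries.map_subst (PowerSeries.HasSubst.of_constantCoeff_zero
      (MvPowerSeries.constantCoeff_toRat hG0)), PowerSeries.map_subst (PowerSeries.HasSubst.X 0),
      PowerSeries.map_subst (PowerSeries.HasSubst.X 1), MvPowerSeries.map_X,
      MvPowerSeries.map_X] at this
    exact this
  have hs : MvPowerSeries.HasSubst ((fun _ : Fin 2 => a) • MvPowerSeries.X :
      Fin 2 → MvPowerSeries (Fin 2) ℂ) := MvPowerSeries.HasSubst.smul_X _
  have hR0 : MvPowerSeries.constantCoeff (H.rescale fun _ : Fin 2 => a) = 0 := by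
    rw [← MvPowerSeries.coeff_zero_eq_constantCoeff_apply, MvPowerSeries.coeff_rescale]
    simp [hH0]
  have hC0 : MvPowerSeries.constantCoeff (MvPowerSeries.C a * H) = 0 := by simp [hH0]
  have key : H.rescale (fun _ : Fin 2 => a) = MvPowerSeries.C a * H := by
    refine PowerSeries.subst_inj_of_coeff_one (f := L) (by rw [hL1]; exact isUnit_one) hR0 hC0 ?_
    rw [hLa hH0, hH, MvPowerSeries.rescale_eq_subst, mul_add,
      ← hLa (MvPowerSeries.constantCoeff_X 0), ← hLa (MvPowerSeries.constantCoeff_X 1)]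
    have h2 := congrArg (MvPowerSeries.subst ((fun _ : Fin 2 => a) • MvPowerSeries.X :
      Fin 2 → MvPowerSeries (Fin 2) ℂ)) hH
    rw [MvPowerSeries.subst_add hs, PowerSeries.subst_subst_X hs, PowerSeries.subst_subst_X hs,
      PowerSeries.subst, MvPowerSeries.subst_comp_subst_apply
        (PowerSeries.HasSubst.of_constantCoeff_zero hH0).const hs] at h2
    simp only [Pi.smul_apply', MvPowerSeries.smul_eq_C_mul] at h2
    exact h2
  have h3 := congrArg (MvPowerSeries.coeff d) key
  rw [MvPowerSeries.coeff_rescale, MvPowerSeries.coeff_C_mul] at h3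
  have h4 : MvPowerSeries.coeff d H ≠ 0 := by
    rw [MvPowerSeries.coeff_map, MvPowerSeries.coeff_map]
    simpa using hd
  have h5 := mul_right_cancel₀ h4 h3
  rw [Finsupp.prod_fintype _ _ (by simp), Fin.prod_univ_two, ← pow_add] at h5
  have h6 : d.degree = d 0 + d 1 := by simp [Finsupp.degree_eq_sum]
  rw [h6]
  have h7 : a ^ (d 0 + d 1) = a ^ 1 := by rw [h5, pow_one]
  have := (ha.pow_inj (Nat.mod_lt (d 0 + d 1) (by norm_num)) (by norm_num : 1 < 3)) (by
    rw [← h7, ← pow_mod_orderOf a (d 0 + d 1), ← ha.eq_orderOf])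
  exact this

end Law

end HondaLog

/-! ### The Honda formal group law and its endomorphisms -/

namespace FormalGroup

open MvPowerSeries (degIdeal toRat)

/-- A power series `G` over the integers with `ℓ(G(x, y)) = ℓ(x) + ℓ(y)` is a formal group law. -/
def honda (G : MvPowerSeries (Fin 2) ℤ) (hG0 : MvPowerSeries.constantCoeff G = 0)
    (hG : hondaLog.subst (toRat G) = hondaLog.subst (MvPowerSeries.X 0 : MvPowerSeries (Fin 2) ℚ)
      + hondaLog.subst (MvPowerSeries.X 1 : MvPowerSeries (Fin 2) ℚ)) : FormalGroup ℤ :=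
  have hlin (i : Fin 2) : MvPowerSeries.coeff (Finsupp.single i 1) G =
      MvPowerSeries.coeff (Finsupp.single i 1)
        (MvPowerSeries.X 0 + MvPowerSeries.X 1 : MvPowerSeries (Fin 2) ℤ) := by
    have h0 : PowerSeries.constantCoeff hondaLog = 0 := HondaLog.constantCoeff_eq_zero
    have h := congrArg (MvPowerSeries.coeff (Finsupp.single i 1)) hG
    rw [map_add, PowerSeries.coeff_single_subst h0 (MvPowerSeries.constantCoeff_toRat hG0),
      PowerSeries.coeff_single_subst h0 (MvPowerSeries.constantCoeff_X 0),
      PowerSeries.coeff_single_subst h0 (MvPowerSeries.constantCoeff_X 1), HondaLog.coeff_one,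
      one_mul, one_mul, one_mul, ← map_add, ← MvPowerSeries.map_X (Int.castRingHom ℚ),
      ← MvPowerSeries.map_X (Int.castRingHom ℚ), ← map_add, MvPowerSeries.coeff_map,
      MvPowerSeries.coeff_map] at h
    exact Int.cast_injective h
  { toPowerSeries := G
    zero_constantCoeff := hG0
    lin_coeff_X := by rw [hlin]; simp [MvPowerSeries.coeff_index_single_X]
    lin_coeff_Y := by rw [hlin]; simp [MvPowerSeries.coeff_index_single_X]
    assoc := by
      have hX (i : Fin 3) : MvPowerSeries.constantCoeff
        (MvPowerSeries.X i : MvPowerSeries (Fin 3) ℤ) = 0 := MvPowerSeries.constantCoeff_X i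
      have h01 := HondaLog.constantCoeff_subst_pair hG0 (hX 0) (hX 1)
      have h12 := HondaLog.constantCoeff_subst_pair hG0 (hX 1) (hX 2)
      refine HondaLog.subst_toRat_inj (HondaLog.constantCoeff_subst_pair hG0 h01 (hX 2))
        (HondaLog.constantCoeff_subst_pair hG0 (hX 0) h12) ?_
      rw [HondaLog.subst_toRat_subst_pair hG0 hG h01 (hX 2),
        HondaLog.subst_toRat_subst_pair hG0 hG (hX 0) (hX 1),
        HondaLog.subst_toRat_subst_pair hG0 hG (hX 0) h12,
        HondaLog.subst_toRat_subst_pair hG0 hG (hX 1) (hX 2), add_assoc] }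

namespace Endo

variable {k : Type*} [Field k] [CharP k 2] {F : FormalGroup k}

/-- If `T² = 2`, then the convergent series `1 + T² + T⁴ + ⋯` is `-1`. -/
theorem exists_add_one_eq_zero [F.IsComm]
    (hF : F.toPowerSeries.map (_root_.frobenius k 2) = F.toPowerSeries)
    (h : frobenius hF * frobenius hF = 1 + 1) : ∃ m : F.Endo, m + 1 = 0 := by
  let f : ℕ → F.Endo := fun n => ∑ i ∈ Finset.range n, frobenius hF ^ (2 * i)
  -- With `T² = 1 + 1`, two copies of `T^(2n)` add up to `T^(2n+2)`, so the partial sums plus one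
  -- telescope.
  have hf (n : ℕ) : f n + 1 = frobenius hF ^ (2 * n) := by
    induction n with
    | zero => simp [f]
    | succ n ih =>
      have h1 : f (n + 1) = f n + frobenius hF ^ (2 * n) := Finset.sum_range_succ _ _
      rw [h1, add_right_comm, ih, mul_add, pow_add, mul_one, pow_two, h, mul_add, mul_one]
  have hdvd (n : ℕ) : PowerSeries.X ^ 2 ^ n ∣ (frobenius hF ^ n).toSeries := by
    have := mul_frobenius_pow_toSeries hF 1 n
    rwa [one_mul] at this
  have hlt (n : ℕ) : n < 2 ^ (2 * n) :=
    n.lt_two_pow_self.trans_le (Nat.pow_le_pow_right (by norm_num) (by omega))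
  obtain ⟨l, hl⟩ := exists_limit f (N := fun n => 2 ^ (2 * n)) hlt
    (fun i j hij => Nat.pow_le_pow_right (by norm_num) (by omega)) fun n => by
      have h1 : f (n + 1) = f n + frobenius hF ^ (2 * n) := Finset.sum_range_succ _ _
      rw [h1, PowerSeries.X_pow_dvd_iff_mem_degIdeal]
      exact add_toSeries_sub_mem _ _ (PowerSeries.X_pow_dvd_iff_mem_degIdeal.mp (hdvd (2 * n)))
  refine ⟨l, Endo.ext (PowerSeries.ext fun n => ?_)⟩
  have h1 := F.subst_pair_sub_subst_pair_mem l.hasSubst (1 : F.Endo).hasSubst (f n).hasSubst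
    (1 : F.Endo).hasSubst (PowerSeries.X_pow_dvd_iff_mem_degIdeal.mp (hl n)) (by simp)
  rw [← PowerSeries.X_pow_dvd_iff_mem_degIdeal, ← add_toSeries, ← add_toSeries, hf] at h1
  have h2 := (dvd_sub_right (hdvd (2 * n))).mp (dvd_sub_comm.mp h1)
  rw [PowerSeries.X_pow_dvd_iff.mp h2 n (hlt n)]
  simp [zero_toSeries]

end Endo

/-- The Honda formal group law and its endomorphism ring. -/
theorem exists_honda {ζ : F4} (hζ : IsPrimitiveRoot ζ 3) :
    ∃ (F : FormalGroup F4) (_ : F.IsComm), IsHondaFormalGroup F ∧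
      ∃ Φ : TwistedWitt 2 ≃+* F.Endo,
        (Φ (TwistedWitt.gen 2)).toSeries = PowerSeries.X ^ 2 ∧
        ∀ c : F4, (Φ (TwistedWitt.of 2 (WittVector.teichmuller 2 c))).toSeries =
          PowerSeries.C c * PowerSeries.X := by
  obtain ⟨G, hG0, hG⟩ := HondaLog.exists_integral_law
  have hX (i : Fin 2) : MvPowerSeries.constantCoeff
    (MvPowerSeries.X i : MvPowerSeries (Fin 2) ℤ) = 0 := MvPowerSeries.constantCoeff_X i
  have hmap {τ : Type} {u v : MvPowerSeries τ ℤ} (hu : MvPowerSeries.constantCoeff u = 0)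
      (hv : MvPowerSeries.constantCoeff v = 0) :
      (G.subst ![u, v]).map (Int.castRingHom F4) = (G.map (Int.castRingHom F4)).subst
        ![u.map (Int.castRingHom F4), v.map (Int.castRingHom F4)] := by
    rw [MvPowerSeries.map_subst (hasSubst_pair (PowerSeries.HasSubst.of_constantCoeff_zero hu)
      (PowerSeries.HasSubst.of_constantCoeff_zero hv))]
    congr 1
    funext s
    fin_cases s <;> rfl
  let F := (honda G hG0 hG).map (Int.castRingHom F4)
  have hFser : F.toPowerSeries = G.map (Int.castRingHom F4) := rfl
  have hcomm : F.IsComm := ⟨by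
    have h1 : G = G.subst ![MvPowerSeries.X 1, MvPowerSeries.X 0] := by
      refine HondaLog.subst_toRat_inj hG0
        (HondaLog.constantCoeff_subst_pair hG0 (hX 1) (hX 0)) ?_
      rw [HondaLog.subst_toRat_subst_pair hG0 hG (hX 1) (hX 0), hG, add_comm, toRat,
        MvPowerSeries.map_X, MvPowerSeries.map_X]
    rw [hFser]
    nth_rw 1 [h1]
    rw [hmap (hX 1) (hX 0), MvPowerSeries.map_X, MvPowerSeries.map_X]⟩
  have hF : F.toPowerSeries.map (_root_.frobenius F4 2) = F.toPowerSeries := by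
    ext d
    rw [hFser, MvPowerSeries.coeff_map, MvPowerSeries.coeff_map, eq_intCast, map_intCast]
  have hscale : F.toPowerSeries.rescale (fun _ => ζ) = MvPowerSeries.C ζ * F.toPowerSeries := by
    ext d
    rw [MvPowerSeries.coeff_rescale, MvPowerSeries.coeff_C_mul, hFser, MvPowerSeries.coeff_map]
    by_cases hd : MvPowerSeries.coeff d G = 0
    · rw [hd, map_zero, mul_zero, mul_zero]
    · have h1 := HondaLog.degree_mod_three hG0 hG hd
      congr 1
      rw [Finsupp.prod_fintype _ _ (by simp), Fin.prod_univ_two, ← pow_add]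
      have h6 : d.degree = d 0 + d 1 := by simp [Finsupp.degree_eq_sum]
      rw [← h6, ← Nat.div_add_mod d.degree 3, h1, pow_add, pow_mul, hζ.pow_eq_one, one_pow,
        one_mul, pow_one]
  have hT : Endo.frobenius hF * Endo.frobenius hF = 1 + 1 := by
    have hx : MvPowerSeries.constantCoeff (PowerSeries.X : PowerSeries ℤ) = 0 :=
      MvPowerSeries.constantCoeff_X ()
    have hx4 : MvPowerSeries.constantCoeff ((PowerSeries.X : PowerSeries ℤ) ^ 4) = 0 := by
      rw [map_pow, hx, zero_pow (by norm_num)]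
    -- `ℓ([2](x)) = 2ℓ(x) = 2x + ℓ(x⁴)`, so the logarithms of `[2](x)` and `x⁴` differ by `2x`;
    -- reflection of congruences gives `[2](x) ≡ x⁴` modulo 2, whence `T² = 2`.
    have h1 : 2 ∣ (G.subst ![PowerSeries.X, PowerSeries.X] : PowerSeries ℤ) - PowerSeries.X ^ 4 := by
      refine HondaLog.two_dvd_sub (HondaLog.constantCoeff_subst_pair hG0 hx hx) hx4
        (e := PowerSeries.X) ?_
      have hxr := MvPowerSeries.constantCoeff_toRat hx
      rw [HondaLog.subst_toRat_subst_pair hG0 hG hx hx, HondaLog.subst_eq hxr, ← map_pow]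
      have h2 : (MvPowerSeries.C (1 / 2 : ℚ) : MvPowerSeries Unit ℚ) * 2 = 1 := by
        rw [← map_ofNat MvPowerSeries.C 2, ← map_mul]
        norm_num
      rw [map_mul, map_ofNat]
      linear_combination h2 * hondaLog.subst (toRat ((PowerSeries.X : PowerSeries ℤ) ^ 4))
    obtain ⟨e, he⟩ := h1
    have h2 := congrArg (MvPowerSeries.map (Int.castRingHom F4)) he
    rw [map_sub, hmap hx hx, map_mul, map_ofNat, show (2 : MvPowerSeries Unit F4) = 0 from
      CharTwo.two_eq_zero, zero_mul, sub_eq_zero, map_pow,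
      show MvPowerSeries.map (Int.castRingHom F4) (PowerSeries.X : PowerSeries ℤ) =
        (PowerSeries.X : PowerSeries F4) from MvPowerSeries.map_X _ _] at h2
    refine Endo.ext ?_
    rw [Endo.mul_frobenius_toSeries, Endo.add_toSeries]
    refine Eq.trans ?_ h2.symm
    change PowerSeries.expand 2 two_ne_zero (PowerSeries.X ^ 2) = _
    rw [map_pow, PowerSeries.expand_X, ← pow_mul]
  obtain ⟨m, hm⟩ := Endo.exists_add_one_eq_zero hF hT
  refine ⟨F, hcomm, ⟨honda G hG0 hG, hG, rfl⟩, ?_⟩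
  exact Endo.exists_ringEquiv_twistedWitt hζ hF m hm (Endo.scale hscale) rfl (Or.inl ⟨rfl, hT⟩)

end FormalGroup

end

noncomputable section

/-! ### The group law of `y² + y = x³` in characteristic two -/

/-- The curve `y² + y = x³`. -/
def supersingularCurve (K : Type*) [Field K] : WeierstrassCurve.Affine K where
  a₁ := 0
  a₂ := 0
  a₃ := 1
  a₄ := 0
  a₆ := 0

namespace supersingularCurve

variable {K : Type*} [Field K] [CharP K 2]

theorem nonsingular {z w : K} (h : w = z ^ 3 + w ^ 2) (hw : w ≠ 0) :
    (supersingularCurve K).Nonsingular (z / w) (1 / w) := by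
  rw [WeierstrassCurve.Affine.nonsingular_iff', WeierstrassCurve.Affine.equation_iff]
  have h2 : (2 : K) = 0 := CharTwo.two_eq_zero
  constructor
  · simp only [supersingularCurve]
    field_simp
    linear_combination h + w ^ 2 * h2
  · right
    simp [supersingularCurve, h2]

/-- The point with `z = x / y` and `w = 1 / y`. -/
def point (z w : K) (h : w = z ^ 3 + w ^ 2) (hw : w ≠ 0) : (supersingularCurve K).Point :=
  .some _ _ (nonsingular h hw)

theorem point_inj {z w z' w' : K} {h : w = z ^ 3 + w ^ 2} {hw : w ≠ 0}
    {h' : w' = z' ^ 3 + w' ^ 2} {hw' : w' ≠ 0} (e : point z w h hw = point z' w' h' hw') :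
    z = z' := by
  simp only [point, WeierstrassCurve.Affine.Point.some.injEq] at e
  obtain ⟨e1, e2⟩ := e
  have e3 : w = w' := by simpa using e2
  subst e3
  field_simp at e1
  exact e1

/-- The chord through the points is `w = l z + n`, with third root `t`. In the coordinates `x =
z/w`, `y = 1/w` its slope is `l/n` up to sign, and inversion `y ↦ y + 1` divides `z` and `w` by `1 +
w`. -/
theorem point_add [DecidableEq K] {z₁ w₁ z₂ w₂ l t u v : K} {h₁ : w₁ = z₁ ^ 3 + w₁ ^ 2} {hw₁ : w₁ ≠ 0}
    {h₂ : w₂ = z₂ ^ 3 + w₂ ^ 2} {hw₂ : w₂ ≠ 0} {h : v = u ^ 3 + v ^ 2} {hv : v ≠ 0}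
    (hl : l * (z₂ - z₁) = w₂ - w₁) (hx : z₁ * w₂ ≠ z₂ * w₁) (ht : t = z₁ + z₂ + l ^ 2)
    (hs : 1 + (w₁ + l * (t - z₁)) ≠ 0)
    (hu : u * (1 + (w₁ + l * (t - z₁))) = t)
    (hvv : v * (1 + (w₁ + l * (t - z₁))) = w₁ + l * (t - z₁)) :
    point z₁ w₁ h₁ hw₁ + point z₂ w₂ h₂ hw₂ = point u v h hv := by
  have h2 : (2 : K) = 0 := CharTwo.two_eq_zero
  obtain ⟨n, hn⟩ : ∃ n, w₁ = l * z₁ + n := ⟨w₁ - l * z₁, by ring⟩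
  have hn2 : w₂ = l * z₂ + n := by linear_combination hn - hl
  have hz : z₁ - z₂ ≠ 0 := by
    intro e
    apply hx
    rw [sub_eq_zero] at e
    subst e
    rw [hn, hn2]
  have hn0 : n ≠ 0 := by
    rintro rfl
    apply hx
    rw [hn, hn2]
    ring
  have hwt : w₁ + l * (t - z₁) = l * t + n := by linear_combination hn
  rw [hwt] at hs hu hvv
  have hwt0 : l * t + n ≠ 0 := by
    intro e
    rw [e, add_zero, mul_one] at hvv
    exact hv hvv
  -- The roots `z₁, z₂, t` belong to `z³ + l²z² + lz + n + n²` in characteristic two. This identity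
  -- comes from subtracting the two curve equations and cancelling `z₁ - z₂`; the next three
  -- complete Vieta's formulas.
  have e2 : l = z₁ ^ 2 + z₁ * z₂ + z₂ ^ 2 + l ^ 2 * (z₁ + z₂) := by
    refine mul_left_cancel₀ hz ?_
    linear_combination h₁ - h₂ - hn + hn2 + (w₁ + l * z₁ + n) * hn - (w₂ + l * z₂ + n) * hn2
      + l * n * (z₁ - z₂) * h2
  have e3 : n + n ^ 2 = z₁ * z₂ * t := by
    subst ht
    linear_combination h₁ - hn + (w₁ + l * z₁ + n) * hn + z₁ * e2 +
      (- l * z₁  + l * z₁ * n + n ^ 2 + z₁ ^ 3 + l ^ 2 * z₁ ^ 2) * h2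
  have f1 : z₁ + z₂ + t = l ^ 2 := by linear_combination ht + (z₁ + z₂) * h2
  have f2 : z₁ * z₂ + t * (z₁ + z₂) = l := by
    linear_combination (z₁ + z₂) * ht - e2 + z₁ * z₂ * h2
  -- The product of the three values of `w` and the numerator of the sum of the three
  -- `x`-coordinates; their quotient gives the sum `(l/n)²` required by the addition formula.
  have hW : (l * z₁ + n) * (l * z₂ + n) * (l * t + n) = n ^ 3 := by
    linear_combination l * n ^ 2 * f1 + l ^ 2 * n * f2 - l ^ 3 * e3 + (l ^ 3 * n + l ^ 3 * n ^ 2) * h2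
  have hN : z₁ * (l * z₂ + n) * (l * t + n) + z₂ * (l * z₁ + n) * (l * t + n)
      + t * (l * z₁ + n) * (l * z₂ + n) = l ^ 2 * n := by
    linear_combination n ^ 2 * f1 - 3 * l ^ 2 * e3
      + (l * n * (z₁ * z₂ + t * (z₁ + z₂)) + l ^ 2 * n + 2 * l ^ 2 * n ^ 2) * h2
  have hX : z₁ / w₁ ≠ z₂ / w₂ := by
    rw [Ne, div_eq_div_iff hw₁ hw₂]
    exact hx
  have hslope : (supersingularCurve K).slope (z₁ / w₁) (z₂ / w₂) (1 / w₁) (1 / w₂) = l / n := by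
    rw [WeierstrassCurve.Affine.slope_of_X_ne hX, div_eq_div_iff (sub_ne_zero.mpr hX) hn0]
    field_simp
    rw [hn, hn2]
    linear_combination n * l * (z₂ - z₁) * h2
  have hxt : u / v = t / (l * t + n) := by
    rw [div_eq_div_iff hv hwt0]
    linear_combination v * hu - u * hvv
  have hyt : 1 / v = 1 / (l * t + n) + 1 := by
    field_simp
    linear_combination -hvv
  have haddX : (supersingularCurve K).addX (z₁ / w₁) (z₂ / w₂) (l / n) = t / (l * t + n) := by
    simp only [WeierstrassCurve.Affine.addX, supersingularCurve]
    rw [hn] at hw₁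
    rw [hn2] at hw₂
    rw [hn, hn2]
    field_simp
    linear_combination (-n ^ 2) * hN + l ^ 2 * hW
  have hnegAddY : (supersingularCurve K).negAddY (z₁ / w₁) (z₂ / w₂) (1 / w₁) (l / n)
      = 1 / (l * t + n) := by
    rw [WeierstrassCurve.Affine.negAddY, haddX]
    rw [hn] at hw₁
    rw [hn]
    field_simp
    linear_combination (l * t * n - l * z₁ * n) * h2
  rw [point, point, point, WeierstrassCurve.Affine.Point.add_of_X_ne hX]
  simp only [WeierstrassCurve.Affine.Point.some.injEq]
  constructor
  · rw [hslope, haddX, hxt]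
  · rw [hslope, WeierstrassCurve.Affine.addY, hnegAddY, WeierstrassCurve.Affine.negY, hyt]
    simp only [supersingularCurve]
    linear_combination (-1 / (l * t + n) - 1) * h2

end supersingularCurve

end

noncomputable section

/-! ### The formal group law of the curve -/

namespace curveC

open MvPowerSeries (degIdeal)

variable {τ : Type*}

theorem wSeries_eq_add : curveC.wSeries = PowerSeries.X ^ 3 + curveC.wSeries ^ 2 := by
  have h := curveC.wSeries_eq
  have h0 : PowerSeries.C (R := F4) (-1) = 1 := by rw [CharTwo.neg_eq, map_one]
  simp only [curveC, map_zero, zero_mul, add_zero] at h ⊢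
  rwa [h0, one_mul] at h

theorem constantCoeff_wSeries : PowerSeries.constantCoeff curveC.wSeries = 0 :=
  PowerSeries.X_dvd_iff.mp curveC.X_dvd_wSeries

theorem coeff_one_wSeries : PowerSeries.coeff 1 curveC.wSeries = 0 := by
  rw [wSeries_eq_add]
  have h : PowerSeries.X ^ 2 ∣ PowerSeries.X ^ 3 + curveC.wSeries ^ 2 :=
    dvd_add (pow_dvd_pow _ (by norm_num)) (pow_dvd_pow_of_dvd curveC.X_dvd_wSeries 2)
  exact PowerSeries.X_pow_dvd_iff.mp h 1 (by norm_num)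

theorem constantCoeff_w {u : MvPowerSeries τ F4} (hu : MvPowerSeries.constantCoeff u = 0) :
    MvPowerSeries.constantCoeff (curveC.wSeries.subst u) = 0 :=
  PowerSeries.constantCoeff_subst_eq_zero hu _ constantCoeff_wSeries

theorem w_eq {u : MvPowerSeries τ F4} (hu : MvPowerSeries.constantCoeff u = 0) :
    curveC.wSeries.subst u = u ^ 3 + curveC.wSeries.subst u ^ 2 := by
  have hu' := PowerSeries.HasSubst.of_constantCoeff_zero hu
  have h := congrArg (PowerSeries.subst u) wSeries_eq_add
  rwa [PowerSeries.subst_add hu', PowerSeries.subst_pow hu', PowerSeries.subst_pow hu',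
    PowerSeries.subst_X hu'] at h

/-- The difference of two solutions is annihilated by a series with constant term `1`. This
uniqueness identifies `w` in every later computation. -/
theorem eq_w {u v : MvPowerSeries τ F4} (hu : MvPowerSeries.constantCoeff u = 0)
    (hv : MvPowerSeries.constantCoeff v = 0) (h : v = u ^ 3 + v ^ 2) :
    v = curveC.wSeries.subst u := by
  have h2 : (2 : MvPowerSeries τ F4) = 0 := CharTwo.two_eq_zero
  set w := curveC.wSeries.subst u with hw
  have hw1 : w = u ^ 3 + w ^ 2 := w_eq hu
  have hu1 : IsUnit (1 - (v - w)) := by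
    rw [MvPowerSeries.isUnit_iff_constantCoeff, map_sub, map_sub, hv, hw, constantCoeff_w hu]
    simp
  have h3 : (1 - (v - w)) * (v - w) = 0 := by
    linear_combination h - hw1 + w * (v - w) * h2
  exact sub_eq_zero.mp ((hu1.mul_right_eq_zero).mp h3)

theorem ne_zero_of_w {u : MvPowerSeries τ F4} (hu : MvPowerSeries.constantCoeff u = 0)
    (h : u ≠ 0) : curveC.wSeries.subst u ≠ 0 := by
  intro h0
  have h1 := w_eq hu
  rw [h0, zero_pow two_ne_zero, add_zero] at h1
  exact h (pow_eq_zero_iff (by norm_num) |>.mp h1.symm)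

theorem thirdPointSeries_eq : curveC.thirdPointSeries =
    MvPowerSeries.X 0 + MvPowerSeries.X 1 + curveC.wSeries.slope ^ 2 := by
  have h1 : MvPowerSeries.invOfUnit (1 : MvPowerSeries (Fin 2) F4) 1 = 1 := by
    have := MvPowerSeries.mul_invOfUnit (1 : MvPowerSeries (Fin 2) F4) 1 (by simp)
    rwa [one_mul] at this
  have h3 : curveC.slopeSeries = curveC.wSeries.slope := rfl
  rw [WeierstrassCurve.thirdPointSeries, h3]
  generalize curveC.wSeries.slope = s
  simp only [curveC, map_zero, zero_mul, mul_zero, add_zero, zero_add, h1, mul_one,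
    CharTwo.neg_eq, CharTwo.sub_eq_add, map_one, one_mul]

theorem negSeries_mul : curveC.negSeries * (1 + curveC.wSeries) = PowerSeries.X := by
  have h0 : PowerSeries.C (R := F4) (-1) = 1 := by rw [CharTwo.neg_eq, map_one]
  have h1 : 1 - PowerSeries.C curveC.a₁ * PowerSeries.X - PowerSeries.C curveC.a₃ * curveC.wSeries
      = 1 + curveC.wSeries := by
    have e1 : curveC.a₁ = 0 := rfl
    have e3 : curveC.a₃ = -1 := rfl
    rw [e1, e3, h0, map_zero, zero_mul, sub_zero, one_mul, CharTwo.sub_eq_add]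
  rw [WeierstrassCurve.negSeries, h1, mul_assoc, mul_comm (PowerSeries.invOfUnit _ _),
    PowerSeries.mul_invOfUnit _ _ (by simp [constantCoeff_wSeries]), mul_one, CharTwo.neg_eq]

theorem neg_subst_mul {u : MvPowerSeries τ F4} (hu : MvPowerSeries.constantCoeff u = 0) :
    curveC.negSeries.subst u * (1 + curveC.wSeries.subst u) = u := by
  have hu' := PowerSeries.HasSubst.of_constantCoeff_zero hu
  have h := congrArg (PowerSeries.subst u) negSeries_mul
  rw [PowerSeries.subst_mul hu', PowerSeries.subst_add hu', PowerSeries.subst_X hu'] at h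
  rwa [← PowerSeries.coe_substAlgHom hu', map_one, PowerSeries.coe_substAlgHom hu'] at h

theorem constantCoeff_negSeries : PowerSeries.constantCoeff curveC.negSeries = 0 := by
  have := congrArg PowerSeries.constantCoeff negSeries_mul
  simpa [constantCoeff_wSeries] using this

theorem coeff_one_negSeries : PowerSeries.coeff 1 curveC.negSeries = 1 := by
  have h := congrArg (PowerSeries.coeff 1) negSeries_mul
  have h2 : PowerSeries.coeff 1 (curveC.negSeries * curveC.wSeries) = 0 :=
    MvPowerSeries.coeff_single_mul_of_constantCoeff constantCoeff_negSeries constantCoeff_wSeries ()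
  rwa [mul_add, mul_one, map_add, h2, add_zero, PowerSeries.coeff_one_X] at h

/-- The pair `(u, w)` divided by `1 + w` again satisfies the curve equation, so uniqueness applies.
-/
theorem w_neg_mul {u : MvPowerSeries τ F4} (hu : MvPowerSeries.constantCoeff u = 0) :
    curveC.wSeries.subst (curveC.negSeries.subst u) * (1 + curveC.wSeries.subst u)
      = curveC.wSeries.subst u := by
  have h2 : (2 : MvPowerSeries τ F4) = 0 := CharTwo.two_eq_zero
  have hn0 : MvPowerSeries.constantCoeff (curveC.negSeries.subst u) = 0 :=
    PowerSeries.constantCoeff_subst_eq_zero hu _ constantCoeff_negSeries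
  have hn := neg_subst_mul hu
  have hw := w_eq hu
  have hw0 := constantCoeff_w hu
  set w := curveC.wSeries.subst u
  set n := curveC.negSeries.subst u
  have hunit : IsUnit (1 + w) := by
    rw [MvPowerSeries.isUnit_iff_constantCoeff, map_add, hw0]
    simp
  obtain ⟨i, hi⟩ := hunit.exists_right_inv
  have h1 : w * i = curveC.wSeries.subst n := by
    refine eq_w hn0 (by rw [map_mul, hw0, zero_mul]) ?_
    have h3 : n = u * i := by linear_combination i * hn - n * hi
    rw [h3, mul_pow]
    have h4 : u ^ 3 = w * (1 + w) := by linear_combination -hw - w ^ 2 * h2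
    rw [h4]
    linear_combination (-w * i ^ 2 - w * i) * hi
  rw [← h1]
  linear_combination w * hi

/-- The slope of the line through the points with parameters `u` and `v`. -/
def slopeAt (u v : MvPowerSeries τ F4) : MvPowerSeries τ F4 := curveC.wSeries.slope.subst ![u, v]

/-- The parameter of the third point on the line through the points with parameters
`u` and `v`. -/
def thirdAt (u v : MvPowerSeries τ F4) : MvPowerSeries τ F4 := u + v + slopeAt u v ^ 2

section Pair

variable {u v : MvPowerSeries τ F4}

theorem constantCoeff_slopeAt (hu : MvPowerSeries.constantCoeff u = 0)
    (hv : MvPowerSeries.constantCoeff v = 0) :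
    MvPowerSeries.constantCoeff (slopeAt u v) = 0 := by
  rw [slopeAt, PowerSeries.constantCoeff_slope_subst _ hu hv, coeff_one_wSeries]

theorem constantCoeff_thirdAt (hu : MvPowerSeries.constantCoeff u = 0)
    (hv : MvPowerSeries.constantCoeff v = 0) :
    MvPowerSeries.constantCoeff (thirdAt u v) = 0 := by
  simp [thirdAt, hu, hv, constantCoeff_slopeAt hu hv]

theorem slopeAt_mul (hu : MvPowerSeries.constantCoeff u = 0)
    (hv : MvPowerSeries.constantCoeff v = 0) :
    slopeAt u v * (v - u) = curveC.wSeries.subst v - curveC.wSeries.subst u :=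
  PowerSeries.slope_subst_mul _ (PowerSeries.HasSubst.of_constantCoeff_zero hu)
    (PowerSeries.HasSubst.of_constantCoeff_zero hv)

theorem law_subst (hu : MvPowerSeries.constantCoeff u = 0)
    (hv : MvPowerSeries.constantCoeff v = 0) :
    curveC.formalGroupSeries.subst ![u, v] = curveC.negSeries.subst (thirdAt u v) := by
  have hp : MvPowerSeries.HasSubst ![u, v] := FormalGroup.hasSubst_pair
    (PowerSeries.HasSubst.of_constantCoeff_zero hu) (PowerSeries.HasSubst.of_constantCoeff_zero hv)
  have h0 : MvPowerSeries.constantCoeff curveC.thirdPointSeries = 0 := by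
    rw [thirdPointSeries_eq]
    simp only [map_add, MvPowerSeries.constantCoeff_X, map_pow, zero_add]
    rw [← MvPowerSeries.coeff_zero_eq_constantCoeff_apply, PowerSeries.coeff_slope]
    simp [coeff_one_wSeries]
  rw [WeierstrassCurve.formalGroupSeries, PowerSeries.subst, MvPowerSeries.subst_comp_subst_apply
    (PowerSeries.HasSubst.of_constantCoeff_zero h0).const hp, thirdPointSeries_eq,
    MvPowerSeries.subst_add hp, MvPowerSeries.subst_add hp, MvPowerSeries.subst_pow hp,
    MvPowerSeries.subst_X hp, MvPowerSeries.subst_X hp]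
  rfl

theorem constantCoeff_law_subst (hu : MvPowerSeries.constantCoeff u = 0)
    (hv : MvPowerSeries.constantCoeff v = 0) :
    MvPowerSeries.constantCoeff (curveC.formalGroupSeries.subst ![u, v]) = 0 := by
  rw [law_subst hu hv]
  exact PowerSeries.constantCoeff_subst_eq_zero (constantCoeff_thirdAt hu hv) _
    constantCoeff_negSeries

theorem coeff_single_thirdAt (hu : MvPowerSeries.constantCoeff u = 0)
    (hv : MvPowerSeries.constantCoeff v = 0) (i : τ) :
    MvPowerSeries.coeff (Finsupp.single i 1) (thirdAt u v) =
      MvPowerSeries.coeff (Finsupp.single i 1) u + MvPowerSeries.coeff (Finsupp.single i 1) v := by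
  have h := constantCoeff_slopeAt hu hv
  rw [thirdAt, map_add, map_add, pow_two, MvPowerSeries.coeff_single_mul_of_constantCoeff h h,
    add_zero]

theorem coeff_single_law_subst (hu : MvPowerSeries.constantCoeff u = 0)
    (hv : MvPowerSeries.constantCoeff v = 0) (i : τ) :
    MvPowerSeries.coeff (Finsupp.single i 1) (curveC.formalGroupSeries.subst ![u, v]) =
      MvPowerSeries.coeff (Finsupp.single i 1) u + MvPowerSeries.coeff (Finsupp.single i 1) v := by
  rw [law_subst hu hv, PowerSeries.coeff_single_subst constantCoeff_negSeries
    (constantCoeff_thirdAt hu hv), coeff_one_negSeries, one_mul, coeff_single_thirdAt hu hv]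

/-- The value of the chord at the third root satisfies the curve equation and has no constant term,
so it is `w` there. Distinctness of `u` and `v` is used to cancel `u - v`. -/
theorem w_thirdAt (hu : MvPowerSeries.constantCoeff u = 0)
    (hv : MvPowerSeries.constantCoeff v = 0) (hne : u ≠ v) :
    curveC.wSeries.subst (thirdAt u v) =
      curveC.wSeries.subst u + slopeAt u v * (thirdAt u v - u) := by
  have h2 : (2 : MvPowerSeries τ F4) = 0 := CharTwo.two_eq_zero
  have hl := slopeAt_mul hu hv
  have h1 := w_eq hu
  have h3 := w_eq hv
  have ht : thirdAt u v = u + v + slopeAt u v ^ 2 := rfl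
  symm
  refine eq_w (constantCoeff_thirdAt hu hv) ?_ ?_
  · simp [constantCoeff_w hu, constantCoeff_thirdAt hu hv, constantCoeff_slopeAt hu hv, hu]
  rw [ht]
  generalize slopeAt u v = l at *
  generalize curveC.wSeries.subst u = w₁ at *
  generalize curveC.wSeries.subst v = w₂ at *
  have e2 : l = u ^ 2 + u * v + v ^ 2 + l ^ 2 * (u + v) := by
    refine mul_left_cancel₀ (sub_ne_zero.mpr hne) ?_
    linear_combination h1 - h3 - hl - (l * (v - u) + (w₂ - w₁)) * hl
      + (l ^ 2 * v ^ 2 - l ^ 2 * u * v - w₂ ^ 2 + w₁ * w₂) * h2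
  linear_combination h1 + (v + l ^ 2) * e2
    - (w₁ * l * v + w₁ * l ^ 3 + 2 * l ^ 2 * u * v + l ^ 2 * u ^ 2 + l ^ 2 * v ^ 2 + l ^ 4 * u
      + 2 * l ^ 4 * v + l ^ 6 + u * v ^ 2 + u ^ 2 * v) * h2

end Pair

end curveC

end

noncomputable section

/-! ### The slope equation, tangents and inverses -/

namespace curveC

section Slope

variable {τ : Type*} {u v : MvPowerSeries τ F4}

/-- The factor `y - x` is cancelled for independent variables; the identity can then be specialised
to equal arguments, where it gives the tangent slope. -/
theorem slope_eq : curveC.wSeries.slope = MvPowerSeries.X 0 ^ 2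
    + MvPowerSeries.X 0 * MvPowerSeries.X 1 + MvPowerSeries.X 1 ^ 2
    + curveC.wSeries.slope ^ 2 * (MvPowerSeries.X 1 - MvPowerSeries.X 0) := by
  have h2 : (2 : MvPowerSeries (Fin 2) F4) = 0 := CharTwo.two_eq_zero
  have hne : (MvPowerSeries.X 1 : MvPowerSeries (Fin 2) F4) - MvPowerSeries.X 0 ≠ 0 := by
    intro h
    have := congrArg (MvPowerSeries.coeff (Finsupp.single 0 1)) h
    simp [MvPowerSeries.coeff_index_single_X] at this
  have hl := curveC.wSeries.slope_mul
  have h0 := w_eq (MvPowerSeries.constantCoeff_X (R := F4) (0 : Fin 2))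
  have h1 := w_eq (MvPowerSeries.constantCoeff_X (R := F4) (1 : Fin 2))
  generalize curveC.wSeries.slope = l at *
  generalize curveC.wSeries.subst (MvPowerSeries.X 0 : MvPowerSeries (Fin 2) F4) = w₁ at *
  generalize curveC.wSeries.subst (MvPowerSeries.X 1 : MvPowerSeries (Fin 2) F4) = w₂ at *
  generalize (MvPowerSeries.X 0 : MvPowerSeries (Fin 2) F4) = x at *
  generalize (MvPowerSeries.X 1 : MvPowerSeries (Fin 2) F4) = y at *
  refine mul_left_cancel₀ hne ?_
  linear_combination h1 - h0 + hl - (l * (y - x) + (w₂ - w₁)) * hl + (w₁ * w₂ - w₁ ^ 2) * h2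

theorem slopeAt_eq (hu : MvPowerSeries.constantCoeff u = 0)
    (hv : MvPowerSeries.constantCoeff v = 0) :
    slopeAt u v = u ^ 2 + u * v + v ^ 2 + slopeAt u v ^ 2 * (v - u) := by
  have hp : MvPowerSeries.HasSubst ![u, v] := FormalGroup.hasSubst_pair
    (PowerSeries.HasSubst.of_constantCoeff_zero hu) (PowerSeries.HasSubst.of_constantCoeff_zero hv)
  have h := congrArg (MvPowerSeries.subst ![u, v]) slope_eq
  rw [MvPowerSeries.subst_add hp, MvPowerSeries.subst_add hp, MvPowerSeries.subst_add hp,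
    MvPowerSeries.subst_mul hp, MvPowerSeries.subst_mul hp, MvPowerSeries.subst_sub hp,
    MvPowerSeries.subst_pow hp, MvPowerSeries.subst_pow hp, MvPowerSeries.subst_pow hp,
    MvPowerSeries.subst_X hp, MvPowerSeries.subst_X hp] at h
  exact h

theorem slopeAt_comm (hu : MvPowerSeries.constantCoeff u = 0)
    (hv : MvPowerSeries.constantCoeff v = 0) (hne : u ≠ v) : slopeAt v u = slopeAt u v := by
  refine mul_right_cancel₀ (sub_ne_zero.mpr hne.symm) ?_
  linear_combination -slopeAt_mul hv hu - slopeAt_mul hu hv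

/-- The line through a point and its inverse passes through the origin, so `l u = w` and the third
point has parameter zero. -/
theorem law_neg (hu : MvPowerSeries.constantCoeff u = 0) (h0 : u ≠ 0) :
    curveC.formalGroupSeries.subst ![u, curveC.negSeries.subst u] = 0 := by
  have h2 : (2 : MvPowerSeries τ F4) = 0 := CharTwo.two_eq_zero
  have hn0 : MvPowerSeries.constantCoeff (curveC.negSeries.subst u) = 0 :=
    PowerSeries.constantCoeff_subst_eq_zero hu _ constantCoeff_negSeries
  suffices h : thirdAt u (curveC.negSeries.subst u) = 0 by
    rw [law_subst hu hn0, h,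
      PowerSeries.subst_zero_of_constantCoeff_zero constantCoeff_negSeries]
  have hl := slopeAt_mul hu hn0
  have hw := w_eq hu
  have hw0 := ne_zero_of_w hu h0
  have hn := neg_subst_mul hu
  have hwn := w_neg_mul hu
  have hs : 1 + curveC.wSeries.subst u ≠ 0 := fun h => h0 (by rw [← hn, h, mul_zero])
  rw [thirdAt]
  generalize slopeAt u (curveC.negSeries.subst u) = l at *
  generalize curveC.wSeries.subst (curveC.negSeries.subst u) = w' at *
  generalize curveC.wSeries.subst u = w at *
  generalize curveC.negSeries.subst u = n at *
  have hlu : l * u = w := by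
    refine mul_right_cancel₀ hw0 ?_
    linear_combination -(1 + w) * hl + l * hn - hwn
  refine mul_right_cancel₀ (mul_ne_zero (pow_ne_zero 2 h0) hs) ?_
  linear_combination u ^ 2 * hn + (1 + w) * (l * u + w) * hlu - w * hw + (w ^ 2 + u ^ 3) * h2

end Slope

/-! ### Associativity -/

section Assoc

variable {u v : MvPowerSeries (Fin 3) F4}

instance : CharP (FractionRing (MvPowerSeries (Fin 3) F4)) 2 :=
  charP_of_injective_algebraMap (FaithfulSMul.algebraMap_injective (MvPowerSeries (Fin 3) F4) _) 2

/-- The point of the curve with parameter `u`. -/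
def pointAt (u : MvPowerSeries (Fin 3) F4) (hu : MvPowerSeries.constantCoeff u = 0) (h0 : u ≠ 0) :
    (supersingularCurve (FractionRing (MvPowerSeries (Fin 3) F4))).Point :=
  supersingularCurve.point (algebraMap _ _ u) (algebraMap _ _ (curveC.wSeries.subst u))
    (by rw [← map_pow, ← map_pow, ← map_add, ← w_eq hu])
    (by
      rw [Ne, FaithfulSMul.algebraMap_eq_zero_iff]
      exact ne_zero_of_w hu h0)

theorem pointAt_inj {hu : MvPowerSeries.constantCoeff u = 0} {hu0 : u ≠ 0}
    {hv : MvPowerSeries.constantCoeff v = 0} {hv0 : v ≠ 0}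
    (h : pointAt u hu hu0 = pointAt v hv hv0) : u = v :=
  FaithfulSMul.algebraMap_injective _ (FractionRing (MvPowerSeries (Fin 3) F4))
    (supersingularCurve.point_inj h)

/-- The linear part of a power series. -/
def linearPart (u : MvPowerSeries (Fin 3) F4) (i : Fin 3) : F4 :=
  MvPowerSeries.coeff (Finsupp.single i 1) u

/-- Points with equal `x`-coordinate are equal or inverse to each other, and in both cases the
parameters have the same linear part in characteristic two. Different linear parts thus make the
chord formula applicable. -/
theorem mul_w_ne (hu : MvPowerSeries.constantCoeff u = 0) (hv : MvPowerSeries.constantCoeff v = 0)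
    (hu0 : u ≠ 0) (hv0 : v ≠ 0) (hne : linearPart u ≠ linearPart v) :
    u * curveC.wSeries.subst v ≠ v * curveC.wSeries.subst u := by
  have h2 : (2 : MvPowerSeries (Fin 3) F4) = 0 := CharTwo.two_eq_zero
  have hw1 := w_eq hu
  have hw2 := w_eq hv
  have hw10 := ne_zero_of_w hu hu0
  have hw20 := ne_zero_of_w hv hv0
  have hc := constantCoeff_w hu
  intro h
  generalize curveC.wSeries.subst u = w₁ at *
  generalize curveC.wSeries.subst v = w₂ at *
  -- Cubing the equality and replacing cubes by `w + w²` leaves two factors: `w₁ = w₂`, or the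
  -- relation for inverse points, which gives `u = v(1 + w₁)`.
  have key : (w₁ * w₂) * ((w₁ + w₂) * (w₁ + w₂ + w₁ * w₂)) = 0 := by
    have h3 : (u * w₂) ^ 3 = (v * w₁) ^ 3 := by rw [h]
    linear_combination h3 + w₂ ^ 3 * hw1 - w₁ ^ 3 * hw2
      + (w₁ ^ 3 * w₂ + w₁ ^ 2 * w₂ ^ 2 + w₁ ^ 2 * w₂ ^ 3) * h2
  rcases mul_eq_zero.mp ((mul_eq_zero.mp key).resolve_left (mul_ne_zero hw10 hw20)) with h4 | h4
  · have h5 := CharTwo.add_eq_zero.mp h4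
    rw [h5] at h
    exact hne (by rw [mul_right_cancel₀ hw20 h])
  · have h5 : u = v + v * w₁ := by
      refine mul_right_cancel₀ hw20 ?_
      linear_combination h + v * h4 - v * (w₂ + w₁ * w₂) * h2
    apply hne
    funext i
    rw [linearPart, linearPart, h5, map_add,
      MvPowerSeries.coeff_single_mul_of_constantCoeff hv hc, add_zero]

theorem linearPart_law (hu : MvPowerSeries.constantCoeff u = 0)
    (hv : MvPowerSeries.constantCoeff v = 0) :
    linearPart (curveC.formalGroupSeries.subst ![u, v]) = linearPart u + linearPart v :=
  funext fun i => coeff_single_law_subst hu hv i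

theorem ne_zero_of_linearPart (h : linearPart u ≠ 0) : u ≠ 0 := by
  rintro rfl
  exact h (funext fun i => map_zero _)

theorem law_ne_zero (hu : MvPowerSeries.constantCoeff u = 0)
    (hv : MvPowerSeries.constantCoeff v = 0) (hne : linearPart u ≠ linearPart v) :
    curveC.formalGroupSeries.subst ![u, v] ≠ 0 := by
  refine ne_zero_of_linearPart ?_
  rw [linearPart_law hu hv]
  intro h
  apply hne
  funext i
  exact CharTwo.add_eq_zero.mp (congrFun h i)

-- The power series law computes the group law of the curve over the fraction field, as long as the
-- linear parts differ.
open Classical in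
theorem pointAt_add (hu : MvPowerSeries.constantCoeff u = 0)
    (hv : MvPowerSeries.constantCoeff v = 0) (hu0 : u ≠ 0) (hv0 : v ≠ 0)
    (hne : linearPart u ≠ linearPart v) :
    pointAt u hu hu0 + pointAt v hv hv0 =
      pointAt (curveC.formalGroupSeries.subst ![u, v]) (constantCoeff_law_subst hu hv)
        (law_ne_zero hu hv hne) := by
  have huv : u ≠ v := fun h => hne (by rw [h])
  have ht0 := constantCoeff_thirdAt hu hv
  have hw := w_thirdAt hu hv huv
  have h1 := neg_subst_mul ht0
  have h3 := w_neg_mul ht0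
  rw [← law_subst hu hv] at h1 h3
  have hs : 1 + curveC.wSeries.subst (thirdAt u v) ≠ 0 := by
    intro h
    have := congrArg MvPowerSeries.constantCoeff h
    rw [map_add, constantCoeff_w ht0] at this
    simp at this
  rw [hw] at h1 h3 hs
  let f := algebraMap (MvPowerSeries (Fin 3) F4) (FractionRing (MvPowerSeries (Fin 3) F4))
  have hf : Function.Injective f := FaithfulSMul.algebraMap_injective _ _
  refine supersingularCurve.point_add (l := f (slopeAt u v)) (t := f (thirdAt u v)) ?_ ?_ ?_ ?_ ?_ ?_
  · have := congrArg f (slopeAt_mul hu hv)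
    simpa only [map_mul, map_sub] using this
  · intro h
    apply mul_w_ne hu hv hu0 hv0 hne
    apply hf
    simpa only [map_mul] using h
  · rw [thirdAt, map_add, map_add, map_pow]
  · intro h
    apply hs
    apply hf
    simpa only [map_add, map_one, map_mul, map_sub, map_zero] using h
  · have := congrArg f h1
    simpa only [map_add, map_one, map_mul, map_sub] using this
  · have := congrArg f h3
    simpa only [map_add, map_one, map_mul, map_sub] using this

/-- Every addition needed for the three variables involves different linear parts, so associativity
in the group of points transfers to the parameters. -/
theorem law_assoc : curveC.formalGroupSeries.subst
    ![curveC.formalGroupSeries.subst ![MvPowerSeries.X 0, MvPowerSeries.X 1],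
      (MvPowerSeries.X 2 : MvPowerSeries (Fin 3) F4)] =
    curveC.formalGroupSeries.subst
      ![(MvPowerSeries.X 0 : MvPowerSeries (Fin 3) F4),
        curveC.formalGroupSeries.subst ![MvPowerSeries.X 1, MvPowerSeries.X 2]] := by
  classical
  have hc (i : Fin 3) : MvPowerSeries.constantCoeff (MvPowerSeries.X i : MvPowerSeries (Fin 3) F4) = 0 :=
    MvPowerSeries.constantCoeff_X i
  have hl (i j : Fin 3) : linearPart (MvPowerSeries.X i) j = if j = i then 1 else 0 := by
    rw [linearPart, MvPowerSeries.coeff_index_single_X]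
  have h0 (i : Fin 3) : (MvPowerSeries.X i : MvPowerSeries (Fin 3) F4) ≠ 0 :=
    ne_zero_of_linearPart fun h => by simpa [hl] using congrFun h i
  have n01 : linearPart (MvPowerSeries.X 0) ≠ linearPart (MvPowerSeries.X 1) := fun h => by
    simpa [hl] using congrFun h 0
  have n12 : linearPart (MvPowerSeries.X 1) ≠ linearPart (MvPowerSeries.X 2) := fun h => by
    simpa [hl] using congrFun h 1
  have n012 : linearPart (curveC.formalGroupSeries.subst ![MvPowerSeries.X 0, MvPowerSeries.X 1])
      ≠ linearPart (MvPowerSeries.X 2) := fun h => by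
    rw [linearPart_law (hc 0) (hc 1)] at h
    simpa [hl] using congrFun h 0
  have n120 : linearPart (MvPowerSeries.X 0) ≠
      linearPart (curveC.formalGroupSeries.subst ![MvPowerSeries.X 1, MvPowerSeries.X 2]) := fun h => by
    rw [linearPart_law (hc 1) (hc 2)] at h
    simpa [hl] using congrFun h 0
  have h := add_assoc (pointAt _ (hc 0) (h0 0)) (pointAt _ (hc 1) (h0 1)) (pointAt _ (hc 2) (h0 2))
  rw [pointAt_add (hc 0) (hc 1) (h0 0) (h0 1) n01, pointAt_add (hc 1) (hc 2) (h0 1) (h0 2) n12,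
    pointAt_add _ _ _ _ n012, pointAt_add _ _ _ _ n120] at h
  exact pointAt_inj h

end Assoc

/-! ### The formal group law of the curve and its Frobenius invariance -/

theorem subst_X_pair (f : MvPowerSeries (Fin 2) F4) :
    f.subst ![(MvPowerSeries.X 0 : MvPowerSeries (Fin 2) F4), MvPowerSeries.X 1] = f := by
  have : (![MvPowerSeries.X 0, MvPowerSeries.X 1] : Fin 2 → MvPowerSeries (Fin 2) F4) =
      MvPowerSeries.X := by
    funext s; fin_cases s <;> rfl
  rw [this, MvPowerSeries.subst_self, id]

/-- The formal group law of the curve `y² - y = x³`. -/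
def formalGroup : FormalGroup F4 where
  toPowerSeries := curveC.formalGroupSeries
  zero_constantCoeff := by
    rw [← subst_X_pair curveC.formalGroupSeries]
    exact constantCoeff_law_subst (MvPowerSeries.constantCoeff_X 0) (MvPowerSeries.constantCoeff_X 1)
  lin_coeff_X := by
    rw [← subst_X_pair curveC.formalGroupSeries, coeff_single_law_subst
      (MvPowerSeries.constantCoeff_X 0) (MvPowerSeries.constantCoeff_X 1)]
    simp [MvPowerSeries.coeff_index_single_X]
  lin_coeff_Y := by
    rw [← subst_X_pair curveC.formalGroupSeries, coeff_single_law_subst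
      (MvPowerSeries.constantCoeff_X 0) (MvPowerSeries.constantCoeff_X 1)]
    simp [MvPowerSeries.coeff_index_single_X]
  assoc := law_assoc

instance : formalGroup.IsComm where
  comm := by
    have hX : (MvPowerSeries.X 0 : MvPowerSeries (Fin 2) F4) ≠ MvPowerSeries.X 1 := fun h => by
      have := congrArg (MvPowerSeries.coeff (Finsupp.single 0 1)) h
      simp [MvPowerSeries.coeff_index_single_X] at this
    have h0 := MvPowerSeries.constantCoeff_X (R := F4) (0 : Fin 2)
    have h1 := MvPowerSeries.constantCoeff_X (R := F4) (1 : Fin 2)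
    change curveC.formalGroupSeries = curveC.formalGroupSeries.subst _
    nth_rw 1 [← subst_X_pair curveC.formalGroupSeries]
    rw [law_subst h0 h1, law_subst h1 h0, thirdAt, thirdAt, slopeAt_comm h0 h1 hX,
      add_comm (MvPowerSeries.X 0)]

/-- The curve is defined over the prime field: by uniqueness `w` is fixed by Frobenius, and then so
are the slope, the third point and the inverse. -/
theorem map_frobenius : formalGroup.toPowerSeries.map (frobenius F4 2) = formalGroup.toPowerSeries := by
  have hX : MvPowerSeries.map (frobenius F4 2) (PowerSeries.X : PowerSeries F4) = PowerSeries.X :=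
    MvPowerSeries.map_X _ _
  have hw : MvPowerSeries.map (frobenius F4 2) curveC.wSeries = curveC.wSeries := by
    have h := eq_w (u := (PowerSeries.X : PowerSeries F4)) (MvPowerSeries.constantCoeff_X ())
      (v := MvPowerSeries.map (frobenius F4 2) curveC.wSeries)
      (by
        rw [MvPowerSeries.constantCoeff_map]
        exact (congrArg _ constantCoeff_wSeries).trans (map_zero _))
      (by
        nth_rw 1 [wSeries_eq_add]
        rw [map_add, map_pow, map_pow, hX])
    rw [h]
    exact PowerSeries.X_subst _
  have hs : MvPowerSeries.map (frobenius F4 2) curveC.wSeries.slope = curveC.wSeries.slope := by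
    ext d
    rw [MvPowerSeries.coeff_map, PowerSeries.coeff_slope]
    nth_rw 2 [← hw]
    rfl
  have ht : MvPowerSeries.map (frobenius F4 2) curveC.thirdPointSeries = curveC.thirdPointSeries := by
    rw [thirdPointSeries_eq, map_add, map_add, map_pow, hs, MvPowerSeries.map_X,
      MvPowerSeries.map_X]
  have hn : MvPowerSeries.map (frobenius F4 2) curveC.negSeries = curveC.negSeries := by
    have h := congrArg (MvPowerSeries.map (frobenius F4 2)) negSeries_mul
    rw [map_mul, map_add, map_one, hw, hX, ← negSeries_mul] at h
    refine mul_right_cancel₀ ?_ h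
    intro h0
    have := congrArg PowerSeries.constantCoeff h0
    rw [map_add, constantCoeff_wSeries] at this
    simp at this
  have ht0 : MvPowerSeries.constantCoeff curveC.thirdPointSeries = 0 := by
    rw [← subst_X_pair curveC.thirdPointSeries, thirdPointSeries_eq]
    have hp : MvPowerSeries.HasSubst
        ![(MvPowerSeries.X 0 : MvPowerSeries (Fin 2) F4), MvPowerSeries.X 1] :=
      MvPowerSeries.HasSubst.X_X
    rw [MvPowerSeries.subst_add hp, MvPowerSeries.subst_add hp, MvPowerSeries.subst_pow hp,
      MvPowerSeries.subst_X hp, MvPowerSeries.subst_X hp]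
    exact constantCoeff_thirdAt (MvPowerSeries.constantCoeff_X 0) (MvPowerSeries.constantCoeff_X 1)
  change MvPowerSeries.map (frobenius F4 2) curveC.formalGroupSeries = curveC.formalGroupSeries
  rw [WeierstrassCurve.formalGroupSeries, PowerSeries.map_subst
    (PowerSeries.HasSubst.of_constantCoeff_zero ht0), ht]
  congr 1

/-! ### The automorphism of order three -/

section Scale

variable {ζ : F4} {τ : Type*} {u v : MvPowerSeries τ F4}

theorem w_scale (hζ : ζ ^ 3 = 1) (hu : MvPowerSeries.constantCoeff u = 0) :
    curveC.wSeries.subst (MvPowerSeries.C ζ * u) = curveC.wSeries.subst u := by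
  symm
  refine eq_w (by rw [map_mul, hu, mul_zero]) (constantCoeff_w hu) ?_
  rw [mul_pow, ← map_pow, hζ, map_one, one_mul]
  exact w_eq hu

/-- As `w` is unchanged, the slope is multiplied by `ζ⁻¹ = ζ²`, and its square by `ζ⁴ = ζ`. -/
theorem thirdAt_scale (hζ : ζ ^ 3 = 1) (hu : MvPowerSeries.constantCoeff u = 0)
    (hv : MvPowerSeries.constantCoeff v = 0) (hne : u ≠ v) :
    thirdAt (MvPowerSeries.C ζ * u) (MvPowerSeries.C ζ * v) = MvPowerSeries.C ζ * thirdAt u v := by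
  have hu' : MvPowerSeries.constantCoeff (MvPowerSeries.C ζ * u) = 0 := by rw [map_mul, hu, mul_zero]
  have hv' : MvPowerSeries.constantCoeff (MvPowerSeries.C ζ * v) = 0 := by rw [map_mul, hv, mul_zero]
  have h1 := slopeAt_mul hu hv
  have h2 := slopeAt_mul hu' hv'
  rw [w_scale hζ hu, w_scale hζ hv] at h2
  have hz : (MvPowerSeries.C ζ : MvPowerSeries τ F4) ^ 3 = 1 := by rw [← map_pow, hζ, map_one]
  have hs : slopeAt (MvPowerSeries.C ζ * u) (MvPowerSeries.C ζ * v) =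
      MvPowerSeries.C ζ ^ 2 * slopeAt u v := by
    refine mul_right_cancel₀ (sub_ne_zero.mpr hne.symm) ?_
    linear_combination MvPowerSeries.C ζ ^ 2 * h2 - MvPowerSeries.C ζ ^ 2 * h1 -
      slopeAt (MvPowerSeries.C ζ * u) (MvPowerSeries.C ζ * v) * (v - u) * hz
  rw [thirdAt, thirdAt, hs]
  linear_combination MvPowerSeries.C ζ * slopeAt u v ^ 2 * hz

theorem neg_scale (hζ : ζ ^ 3 = 1) (hu : MvPowerSeries.constantCoeff u = 0) :
    curveC.negSeries.subst (MvPowerSeries.C ζ * u) =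
      MvPowerSeries.C ζ * curveC.negSeries.subst u := by
  have hu' : MvPowerSeries.constantCoeff (MvPowerSeries.C ζ * u) = 0 := by rw [map_mul, hu, mul_zero]
  have h1 := neg_subst_mul hu'
  have h2 := neg_subst_mul hu
  rw [w_scale hζ hu] at h1
  have hs : 1 + curveC.wSeries.subst u ≠ 0 := by
    intro h
    have := congrArg MvPowerSeries.constantCoeff h
    rw [map_add, constantCoeff_w hu] at this
    simp at this
  refine mul_right_cancel₀ hs ?_
  linear_combination h1 - MvPowerSeries.C ζ * h2

theorem rescale_law (hζ : ζ ^ 3 = 1) :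
    formalGroup.toPowerSeries.rescale (fun _ => ζ) =
      MvPowerSeries.C ζ * formalGroup.toPowerSeries := by
  have h0 := MvPowerSeries.constantCoeff_X (R := F4) (0 : Fin 2)
  have h1 := MvPowerSeries.constantCoeff_X (R := F4) (1 : Fin 2)
  have hX : (MvPowerSeries.X 0 : MvPowerSeries (Fin 2) F4) ≠ MvPowerSeries.X 1 := fun h => by
    have := congrArg (MvPowerSeries.coeff (Finsupp.single 0 1)) h
    simp [MvPowerSeries.coeff_index_single_X] at this
  have hs : ((fun _ => ζ : Fin 2 → F4) • MvPowerSeries.X : Fin 2 → MvPowerSeries (Fin 2) F4) =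
      ![MvPowerSeries.C ζ * MvPowerSeries.X 0, MvPowerSeries.C ζ * MvPowerSeries.X 1] := by
    funext s
    fin_cases s <;> simp [MvPowerSeries.smul_eq_C_mul]
  change MvPowerSeries.rescale _ curveC.formalGroupSeries = _ * curveC.formalGroupSeries
  rw [MvPowerSeries.rescale_eq_subst, hs, law_subst (by rw [map_mul, h0, mul_zero])
    (by rw [map_mul, h1, mul_zero]), thirdAt_scale hζ h0 h1 hX,
    neg_scale hζ (constantCoeff_thirdAt h0 h1), ← law_subst h0 h1, subst_X_pair]

end Scale

/-- The tangent at `x` has third intersection `x⁴`, so doubling gives the inverse of `x⁴`, which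
cancels `T²(x) = x⁴`. -/
theorem frobenius_sq_add : FormalGroup.Endo.frobenius map_frobenius
    * FormalGroup.Endo.frobenius map_frobenius + (1 + 1) = 0 := by
  have hx : MvPowerSeries.constantCoeff (PowerSeries.X : PowerSeries F4) = 0 :=
    MvPowerSeries.constantCoeff_X ()
  have hx4 : MvPowerSeries.constantCoeff ((PowerSeries.X : PowerSeries F4) ^ 4) = 0 := by
    rw [map_pow, hx, zero_pow (by norm_num)]
  have h2 : (2 : PowerSeries F4) = 0 := CharTwo.two_eq_zero
  have hthird : thirdAt (PowerSeries.X : PowerSeries F4) PowerSeries.X = PowerSeries.X ^ 4 := by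
    rw [thirdAt, slopeAt_eq hx hx]
    linear_combination (PowerSeries.X + 4 * PowerSeries.X ^ 4) * h2
  refine FormalGroup.Endo.ext ?_
  rw [FormalGroup.Endo.add_toSeries, FormalGroup.Endo.mul_frobenius_toSeries,
    FormalGroup.Endo.add_toSeries]
  have hT : PowerSeries.expand 2 two_ne_zero
      (FormalGroup.Endo.frobenius map_frobenius).toSeries = PowerSeries.X ^ 4 := by
    change PowerSeries.expand 2 two_ne_zero (PowerSeries.X ^ 2) = _
    rw [map_pow, PowerSeries.expand_X, ← pow_mul]
  have hdouble : formalGroup.toPowerSeries.subst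
      ![(1 : formalGroup.Endo).toSeries, (1 : formalGroup.Endo).toSeries] =
        curveC.negSeries.subst ((PowerSeries.X : PowerSeries F4) ^ 4) := by
    rw [← hthird]
    exact law_subst hx hx
  rw [hT, hdouble]
  exact law_neg hx4 (pow_ne_zero 4 PowerSeries.X_ne_zero)

/-- The endomorphism ring of the formal group law of the curve. -/
theorem exists_ringEquiv {ζ : F4} (hζ : IsPrimitiveRoot ζ 3) :
    ∃ Φ : TwistedWitt (-2) ≃+* formalGroup.Endo,
      (Φ (TwistedWitt.gen (-2))).toSeries = PowerSeries.X ^ 2 ∧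
      ∀ c : F4, (Φ (TwistedWitt.of (-2) (WittVector.teichmuller 2 c))).toSeries =
        PowerSeries.C c * PowerSeries.X :=
  FormalGroup.Endo.exists_ringEquiv_twistedWitt hζ map_frobenius _
    -- The relation `T² + 2 = 0` exhibits `T² + 1` as the endomorphism `-1`.
    (by rw [add_assoc]; exact frobenius_sq_add)
    (FormalGroup.Endo.scale (rescale_law hζ.pow_eq_one)) rfl (Or.inr ⟨rfl, frobenius_sq_add⟩)

end curveC

end

/-! ### Comparison of the two automorphism groups -/

theorem mainTheorem5 (ζ : F4) (hζ : IsPrimitiveRoot ζ 3) :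
    ∃ (FC F2 : FormalGroup F4) (_ : FC.IsComm) (_ : F2.IsComm),
      -- `FC` is the formal group law of `y² - y = x³`, and `F2` is the Honda formal group law
      FC.toPowerSeries = curveC.formalGroupSeries ∧ IsHondaFormalGroup F2 ∧
      ∃ (ΦC : TwistedWitt (-2) ≃+* FC.Endo) (Φ2 : TwistedWitt 2 ≃+* F2.Endo),
        -- `T` and `S` correspond to `x²`, and the Teichmüller lift of `c` corresponds to `cx`
        (ΦC (TwistedWitt.gen (-2))).toSeries = PowerSeries.X ^ 2 ∧
        (∀ c : F4, (ΦC (TwistedWitt.of (-2) (WittVector.teichmuller 2 c))).toSeries =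
          PowerSeries.C c * PowerSeries.X) ∧
        (Φ2 (TwistedWitt.gen 2)).toSeries = PowerSeries.X ^ 2 ∧
        (∀ c : F4, (Φ2 (TwistedWitt.of 2 (WittVector.teichmuller 2 c))).toSeries =
          PowerSeries.C c * PowerSeries.X) ∧
        ∃ r α : W4,
          -- `r` is the square root of `-7` that is congruent to `1` modulo `4`,
          -- and `α = (1 - 2ω) / r`
          r ^ 2 = -7 ∧ 4 ∣ r - 1 ∧ α * r = 1 - 2 * WittVector.teichmuller 2 ζ ∧
          α * frob α = -1 ∧
          ∃ e : (FC.Endo)ˣ ≃* (F2.Endo)ˣ,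
            ∀ (γ : (FC.Endo)ˣ) (a b : W4),
              (γ : FC.Endo) =
                ΦC (TwistedWitt.of (-2) a + TwistedWitt.of (-2) b * TwistedWitt.gen (-2)) →
              (e γ : F2.Endo) =
                Φ2 (TwistedWitt.of 2 a
                  + TwistedWitt.of 2 b * (TwistedWitt.of 2 α * TwistedWitt.gen 2)) := by
  obtain ⟨F2, hF2, hHonda, Φ2, hS, hc2⟩ := FormalGroup.exists_honda hζ
  obtain ⟨ΦC, hT, hcC⟩ := curveC.exists_ringEquiv hζ
  obtain ⟨r, α, hr, hr4, hαr, hα⟩ := W4.exists_norm_neg_one hζ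
  refine ⟨curveC.formalGroup, F2, inferInstance, hF2, rfl, hHonda, ΦC, Φ2, hT, hcC, hS, hc2,
    r, α, hr, hr4, hαr, hα,
    Units.mapEquiv ((ΦC.symm.trans (TwistedWitt.scaleGen α hα)).trans Φ2).toMulEquiv, ?_⟩
  intro γ a b hγ
  change Φ2 (TwistedWitt.scaleGen α hα (ΦC.symm (γ : curveC.formalGroup.Endo))) = _
  rw [hγ, ΦC.symm_apply_apply, TwistedWitt.scaleGen_apply]
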